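/- **Setting.** Fix $m\ge 1$. For each $n$ let $n_0=n,\ n_1(n),\dots,n_m(n)=:p$ be dimensions with $\lim_{n\to\infty} n/n_q(n)=y_q>0$ for $q=1,\dots,m$. Let $X^{(q)}_{jk}$ ($1\le q\le m$, $1\le j\le n_{q-1}$, $1\le k\le n_q$) be complex random variables with $\mathbf E X^{(q)}_{jk}=0$ and $\mathbf E|X^{(q)}_{jk}|^2=1$, and let $Y^{(q)}_{jk}$ be complex random variables such that $(\mathrm{Re}\,Y^{(q)}_{jk},\mathrm{Im}\,Y^{(q)}_{jk})$ is bivariate Gaussian (possibly degenerate) with the same first and second moments (including the mixed one) as $(\mathrm{Re}\,X^{(q)}_{jk},\mathrm{Im}\,X^{(q)}_{jk})$; for each $n$ all these variables are defined on one probability space and are independent. Put $\mathbf X^{(q)}=(n_q^{-1/2}X^{(q)}_{jk})$, $\mathbf Y^{(q)}=(n_q^{-1/2}Y^{(q)}_{jk})$, $\mathbf X=(\mathbf X^{(1)},\dots,\mathbf X^{(m)})$ and $\mathbf Y=(\mathbf Y^{(1)},\dots,\mathbf Y^{(m)})$. For each $n$ let $\mathbf B$ be a non-random complex $n\times p$ matrix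 and let $\mathbb F$ be a map from $m$-tuples $\mathbf Z=(\mathbf Z^{(1)},\dots,\mathbf Z^{(m)})$ of complex $n_0\times n_1,\dots,n_{m-1}\times n_m$ matrices to complex $n\times p$ matrices which is three times continuously differentiable in the real and imaginary parts of the entries $Z^{(q)}_{jk}$. For $z\in\mathbb C$ with $\mathrm{Im}\,z>0$ put $$\mathbf V_{\mathbf Z}=\begin{bmatrix}\mathbf O&\mathbb F(\mathbf Z)+\mathbf B\\(\mathbb F(\mathbf Z)+\mathbf B)^*&\mathbf O\end{bmatrix},\quad \mathbf R_{\mathbf Z}=(\mathbf V_{\mathbf Z}-z\mathbf I)^{-1},\quad m_n(z,\mathbf Z)=\frac1{2n}\Big(\mathrm{Tr}\,\mathbf R_{\mathbf Z}+\frac{p-n}{z}\Big),$$ so that $m_n(z,\mathbf Z)$ is the Stieltjes transform of the symmetrized empirical distribution of the singular values of $\mathbb F(\mathbf Z)+\mathbf B$, and $$g^{(q)}_{jk}(\mathbf Z)=\mathrm{Tr}\Big(\frac{\partial\mathbf V_{\mathbf Z}}{\partial\,\mathrm{Re}\,Z^{(q)}_{jk}}\mathbf R_{\mathbf Z}^2\Big),\qquad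 \widehat g^{(q)}_{jk}(\mathbf Z)=\mathrm{Tr}\Big(\frac{\partial\mathbf V_{\mathbf Z}}{\partial\,\mathrm{Im}\,Z^{(q)}_{jk}}\mathbf R_{\mathbf Z}^2\Big).$$ **Theorem.** Assume: 1. (Lindeberg condition) for every $\tau>0$, $L_n(\tau):=n^{-2}\sum_{q=1}^m\sum_{j=1}^{n_{q-1}}\sum_{k=1}^{n_q}\mathbf E|X^{(q)}_{jk}|^2\,\mathbb I\{|X^{(q)}_{jk}|>\tau\sqrt n\}\to0$ as $n\to\infty$. 2. (Rank condition) there is a constant $C$ independent of $n$ such that $\mathrm{rank}\{\mathbb F(\mathbf P^{(1)},\dots,\mathbf P^{(m)})-\mathbb F(\mathbf Q^{(1)},\dots,\mathbf Q^{(m)})\}\le C\sum_{q=1}^m\mathrm{rank}\{\mathbf P^{(q)}-\mathbf Q^{(q)}\}$ for all $n$ and all matrix tuples $\mathbf P,\mathbf Q$ of the given sizes. 3. Let $(\tau_n)$ be a sequence with $\tau_n\to0$, $L_n(\tau_n)\tau_n^{-4}\to0$ and $\tau_n\ge n^{-1/3}$ for $n\ge1$ (such sequences exist by 1). Put $\widehat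 X^{(q)}_{jk}=X^{(q)}_{jk}\mathbb I\{|X^{(q)}_{jk}|\le\tau_n\sqrt n\}$, $\widehat Y^{(q)}_{jk}=Y^{(q)}_{jk}\mathbb I\{|Y^{(q)}_{jk}|\le\tau_n\sqrt n\}$ and, for $0\le\varphi\le\pi/2$, let $\mathbf Z(\varphi)$ be the tuple of the matrices $\big(n_q^{-1/2}(\widehat X^{(q)}_{jk}\cos\varphi+\widehat Y^{(q)}_{jk}\sin\varphi)\big)$. For a function $h$ of matrix tuples and for given $(q,j,k)$ write $h(\varphi,\theta)$ for $h$ evaluated at $\mathbf Z(\varphi)$ with its entry $Z^{(q)}_{jk}(\varphi)$ replaced by $\theta Z^{(q)}_{jk}(\varphi)$. Fix $z$ with $\mathrm{Im}\,z>0$ and suppose that there are constants $A_0,A_1,A_2>0$, independent of $n$, such that for all $n$, all $q,j,k$, all $\varphi\in[0,\pi/2]$ and all $\theta\in[0,1]$, both for $g=g^{(q)}_{jk}$ and for $g=\widehat g^{(q)}_{jk}$, $$\big\|\mathbf E\{h(\varphi,\theta)\,|\,X^{(q)}_{jk},Y^{(q)}_{jk}\}\big\|_\infty\le\begin{cases}A_0,&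 h=g,\\ A_1,& h=\dfrac{\partial g}{\partial\,\mathrm{Re}\,Z^{(q)}_{jk}},\ \dfrac{\partial g}{\partial\,\mathrm{Im}\,Z^{(q)}_{jk}},\\ A_2,& h=\dfrac{\partial^2 g}{\partial(\mathrm{Re}\,Z^{(q)}_{jk})^2},\ \dfrac{\partial^2 g}{\partial(\mathrm{Im}\,Z^{(q)}_{jk})^2},\ \dfrac{\partial^2 g}{\partial\,\mathrm{Re}\,Z^{(q)}_{jk}\,\partial\,\mathrm{Im}\,Z^{(q)}_{jk}}.\end{cases}$$ Then, for this $z$, $\ m_n(z,\mathbf Y)-m_n(z,\mathbf X)\to0$ in probability as $n\to\infty$. -/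

import Mathlib

open MeasureTheory ProbabilityTheory Filter Topology Matrix

-- The entrywise sup norm on matrices; it is used only to speak of (real) differentiability of maps
-- between finite-dimensional spaces of matrices, which does not depend on the choice of the norm.
attribute [local instance] Matrix.normedAddCommGroup Matrix.normedSpace

noncomputable section

namespace SVUniversality

variable {m : ℕ}

/-- The space of `m`-tuples of complex matrices of sizes
`n₀ × n₁, n₁ × n₂, …, n_{m-1} × n_m`, where `n_q = d q`. -/
abbrev MatTuple (d : Fin (m + 1) → ℕ) : Type :=
  (q : Fin m) → Matrix (Fin (d q.castSucc)) (Fin (d q.succ)) ℂ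

/-- The space of complex `n₀ × n_m` matrices. -/
abbrev OutMat (d : Fin (m + 1) → ℕ) : Type :=
  Matrix (Fin (d 0)) (Fin (d (Fin.last m))) ℂ

/-- The positions `(q, j, k)` of the entries of a matrix tuple. -/
abbrev EntryIdx (d : Fin (m + 1) → ℕ) : Type :=
  (q : Fin m) × (Fin (d q.castSucc) × Fin (d q.succ))

/-- Families of complex random variables `X_{jk}^{(q)}` (not yet divided by `√n_q`). -/
abbrev EntryArray (d : Fin (m + 1) → ℕ) (Ω : Type*) : Type _ :=
  (q : Fin m) → Fin (d q.castSucc) → Fin (d q.succ) → Ω → ℂ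

section Matrices

variable {d : Fin (m + 1) → ℕ}

/-- Replace the entry at position `(j, k)` of the `q`-th matrix by `w`. -/
def setEntry (Z : MatTuple d) (q : Fin m) (j : Fin (d q.castSucc)) (k : Fin (d q.succ)) (w : ℂ) :
    MatTuple d :=
  Function.update Z q ((Z q).updateRow j (Function.update (Z q j) k w))

/-- The partial derivative `∂G / ∂ Re Z_{jk}^{(q)}`. -/
def pderivRe {E : Type*} [NormedAddCommGroup E] [NormedSpace ℝ E] (q : Fin m)
    (j : Fin (d q.castSucc)) (k : Fin (d q.succ)) (G : MatTuple d → E) (Z : MatTuple d) : E :=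
  deriv (fun s : ℝ => G (setEntry Z q j k (Z q j k + (s : ℂ)))) 0

/-- The partial derivative `∂G / ∂ Im Z_{jk}^{(q)}`. -/
def pderivIm {E : Type*} [NormedAddCommGroup E] [NormedSpace ℝ E] (q : Fin m)
    (j : Fin (d q.castSucc)) (k : Fin (d q.succ)) (G : MatTuple d → E) (Z : MatTuple d) : E :=
  deriv (fun s : ℝ => G (setEntry Z q j k (Z q j k + (s : ℂ) * Complex.I))) 0

/-- The Hermitian matrix `V_Z = [0, F_Z + B; (F_Z + B)^*, 0]`. -/
def hermitization (F : MatTuple d → OutMat d) (B : OutMat d) (Z : MatTuple d) :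
    Matrix (Fin (d 0) ⊕ Fin (d (Fin.last m))) (Fin (d 0) ⊕ Fin (d (Fin.last m))) ℂ :=
  Matrix.fromBlocks 0 (F Z + B) (F Z + B)ᴴ 0

/-- The resolvent `R_Z(z) = (V_Z - z I)⁻¹`. -/
def resolventMat (F : MatTuple d → OutMat d) (B : OutMat d) (z : ℂ) (Z : MatTuple d) :
    Matrix (Fin (d 0) ⊕ Fin (d (Fin.last m))) (Fin (d 0) ⊕ Fin (d (Fin.last m))) ℂ :=
  (hermitization F B Z - z • 1)⁻¹

/-- The Stieltjes transform `m_n(z, Z) = (2n)⁻¹ (Tr R_Z(z) + (p - n) / z)` of the symmetrized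
empirical distribution of the singular values of `F_Z + B`, where `n = n₀` and `p = n_m`. -/
def stieltjes (F : MatTuple d → OutMat d) (B : OutMat d) (z : ℂ) (Z : MatTuple d) : ℂ :=
  1 / (2 * (d 0 : ℂ)) *
    ((resolventMat F B z Z).trace + ((d (Fin.last m) : ℂ) - (d 0 : ℂ)) / z)

/-- `g_{jk}^{(q)} = Tr ((∂V / ∂ Re Z_{jk}^{(q)}) R²)`. -/
def gRe (F : MatTuple d → OutMat d) (B : OutMat d) (z : ℂ) (q : Fin m)
    (j : Fin (d q.castSucc)) (k : Fin (d q.succ)) (Z : MatTuple d) : ℂ :=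
  (pderivRe q j k (hermitization F B) Z * resolventMat F B z Z ^ 2).trace

/-- `ĝ_{jk}^{(q)} = Tr ((∂V / ∂ Im Z_{jk}^{(q)}) R²)`. -/
def gIm (F : MatTuple d → OutMat d) (B : OutMat d) (z : ℂ) (q : Fin m)
    (j : Fin (d q.castSucc)) (k : Fin (d q.succ)) (Z : MatTuple d) : ℂ :=
  (pderivIm q j k (hermitization F B) Z * resolventMat F B z Z ^ 2).trace

end Matrices

section Probability

variable {d : Fin (m + 1) → ℕ} {Ω : Type*}

/-- The random matrix tuple with entries `X_{jk}^{(q)} / √n_q`. -/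
def matTuple (X : EntryArray d Ω) (ω : Ω) : MatTuple d :=
  fun q => Matrix.of fun j k => ((Real.sqrt (d q.succ) : ℝ) : ℂ)⁻¹ * X q j k ω

/-- Truncation `x ↦ x 𝟙{|x| ≤ c}`. -/
def trunc (c : ℝ) (x : ℂ) : ℂ := if ‖x‖ ≤ c then x else 0

/-- The interpolation `Z(φ) = X̂ cos φ + Ŷ sin φ` between the matrix tuples of the variables
`X` and `Y` truncated at level `c`. -/
def interp (X Y : EntryArray d Ω) (c φ : ℝ) (ω : Ω) : MatTuple d :=
  matTuple (fun q j k ω => trunc c (X q j k ω) * (Real.cos φ : ℂ)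
    + trunc c (Y q j k ω) * (Real.sin φ : ℂ)) ω

/-- `interp X Y c φ` with the entry `Z_{jk}^{(q)}` replaced by `θ Z_{jk}^{(q)}`. -/
def interpScaled (X Y : EntryArray d Ω) (c φ θ : ℝ) (q : Fin m)
    (j : Fin (d q.castSucc)) (k : Fin (d q.succ)) (ω : Ω) : MatTuple d :=
  setEntry (interp X Y c φ ω) q j k ((θ : ℂ) * interp X Y c φ ω q j k)

variable [MeasurableSpace Ω]

/-- The Lindeberg function
`L_n(t) = n⁻² ∑_q ∑_j ∑_k E |X_{jk}^{(q)}|² 𝟙{|X_{jk}^{(q)}| > t √n}`, where `n = n₀`. -/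
def lindeberg (μ : Measure Ω) (X : EntryArray d Ω) (t : ℝ) : ℝ :=
  1 / (d 0 : ℝ) ^ 2 * ∑ q : Fin m, ∑ j : Fin (d q.castSucc), ∑ k : Fin (d q.succ),
    ∫ ω, {ω' | t * Real.sqrt (d 0) < ‖X q j k ω'‖}.indicator (fun ω' => ‖X q j k ω'‖ ^ 2) ω ∂μ

/-- `‖E{G | U, W}‖_∞ ≤ A`. -/
def CondExpBound (μ : Measure Ω) (U W G : Ω → ℂ) (A : ℝ) : Prop :=
  ∀ᵐ ω ∂μ, ‖(μ[G | MeasurableSpace.comap (fun ω' => (U ω', W ω')) inferInstance]) ω‖ ≤ A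

/-- `Y` has a (possibly degenerate) bivariate Gaussian law with the same first and second
moments of real and imaginary parts as `X`. -/
structure IsGaussianMatch (μ : Measure Ω) (X Y : Ω → ℂ) : Prop where
  gaussian : HasGaussianLaw Y μ
  mean_re : ∫ ω, (Y ω).re ∂μ = ∫ ω, (X ω).re ∂μ
  mean_im : ∫ ω, (Y ω).im ∂μ = ∫ ω, (X ω).im ∂μ
  sq_re : ∫ ω, (Y ω).re ^ 2 ∂μ = ∫ ω, (X ω).re ^ 2 ∂μ
  sq_im : ∫ ω, (Y ω).im ^ 2 ∂μ = ∫ ω, (X ω).im ^ 2 ∂μ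
  re_mul_im : ∫ ω, (Y ω).re * (Y ω).im ∂μ = ∫ ω, (X ω).re * (X ω).im ∂μ

/-- The standing assumptions on the entries for a fixed `n`: all the variables `X_{jk}^{(q)}`
and `Y_{jk}^{(q)}` are (jointly) independent, the `X_{jk}^{(q)}` are centred with
`E |X_{jk}^{(q)}|² = 1`, and the `Y_{jk}^{(q)}` are Gaussian with matching moments. -/
structure IsEntryModel (μ : Measure Ω) (X Y : EntryArray d Ω) : Prop where
  measurable_X : ∀ q j k, Measurable (X q j k)
  measurable_Y : ∀ q j k, Measurable (Y q j k)
  indep : iIndepFun (Sum.elim (fun i : EntryIdx d => X i.1 i.2.1 i.2.2)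
    (fun i : EntryIdx d => Y i.1 i.2.1 i.2.2)) μ
  mean_X : ∀ q j k, ∫ ω, X q j k ω ∂μ = 0
  var_X : ∀ q j k, ∫ ω, ‖X q j k ω‖ ^ 2 ∂μ = 1
  gauss_Y : ∀ q j k, IsGaussianMatch μ (X q j k) (Y q j k)

/-- The bounds on the conditional expectations, given `X_{jk}^{(q)}` and `Y_{jk}^{(q)}`, of one of
the functions `g = g_{jk}^{(q)}`, `g = ĝ_{jk}^{(q)}` and of its first and second partial derivatives
in the variables `Re Z_{jk}^{(q)}`, `Im Z_{jk}^{(q)}`, all evaluated at `Z(φ)` with `Z_{jk}^{(q)}`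
replaced by `θ Z_{jk}^{(q)}`; `c` is the truncation level. -/
structure DerivBounds (μ : Measure Ω) (X Y : EntryArray d Ω) (c φ θ : ℝ) (A₀ A₁ A₂ : ℝ)
    (q : Fin m) (j : Fin (d q.castSucc)) (k : Fin (d q.succ)) (g : MatTuple d → ℂ) : Prop where
  zero : CondExpBound μ (X q j k) (Y q j k)
    (fun ω => g (interpScaled X Y c φ θ q j k ω)) A₀
  re : CondExpBound μ (X q j k) (Y q j k)
    (fun ω => pderivRe q j k g (interpScaled X Y c φ θ q j k ω)) A₁
  im : CondExpBound μ (X q j k) (Y q j k)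
    (fun ω => pderivIm q j k g (interpScaled X Y c φ θ q j k ω)) A₁
  re_re : CondExpBound μ (X q j k) (Y q j k)
    (fun ω => pderivRe q j k (pderivRe q j k g) (interpScaled X Y c φ θ q j k ω)) A₂
  im_im : CondExpBound μ (X q j k) (Y q j k)
    (fun ω => pderivIm q j k (pderivIm q j k g) (interpScaled X Y c φ θ q j k ω)) A₂
  re_im : CondExpBound μ (X q j k) (Y q j k)
    (fun ω => pderivRe q j k (pderivIm q j k g) (interpScaled X Y c φ θ q j k ω)) A₂

end Probability

end SVUniversality

end

open SVUniversality

namespace SVUniversality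

/-! ### Rank, trace and resolvents of Hermitian matrices -/

section LinearAlgebra

/-! The `L¹` distance of the two Stieltjes transforms is split into the fluctuation of each around
its mean, the cost in mean of truncating the entries at `c = τ_n √n`, and the difference of the
means after truncation. Markov's inequality then gives convergence in probability.

The first two rest on one deterministic fact, `norm_stieltjes_sub_le`: a rank `r` change of `F Z`
moves the transform by at most `2 r / (n Im z)`. Under the rank condition, changing one row of one
matrix therefore costs `O(1/n)`. There are `O(n)` independent rows, so a bounded-difference form of
the Efron–Stein inequality makes the fluctuation `O(n^{-1/2})`. Truncation costs `O(1/n)` times the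
expected number of entries above `c`, which is at most the sum of the truncated second moments
("tails") over `c²`.

The truncated means are joined by the rotation `Z(φ) = X̂ cos φ + Ŷ sin φ`. The `φ`-derivative of
the mean is a sum over entries of `E[velocity · g]`, with `g = Tr(∂V R²)`. In each summand the entry
inside `g` is multiplied by `θ` and the expectation is expanded to second order around `θ = 0`,
where `g` is independent of the entry (`IsEntryModel.norm_integral_smul_le`). The terms of order
zero and one carry `E[velocity]` and `E[velocity · position]`. By centring and by matching of second
moments both vanish up to tails; the rotation is what makes the two variances cancel. The remainder
carries a third absolute moment, which truncation bounds by `O(c)`. The weights depend on the entry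
alone, so bounds on conditional expectations of `g` and its derivatives suffice.

With `T_n` the total tail divided by `n² τ_n²`, the contributions have orders `n^{-1/2}`, `T_n`,
`T_n τ_n`, `T_n τ_n²` and `τ_n`. That `T_n → 0` follows from `L_n(τ_n) τ_n⁻⁴ → 0` for `X`, and from
Gaussian eighth moments with `τ_n ≥ n^{-1/3}` for `Y` (`tendsto_tailSum_div`). -/

theorem norm_trace_le_mul_rank {n : Type*} [Fintype n] [DecidableEq n] (A : Matrix n n ℂ) (K : ℝ)
    (h : ∀ v : EuclideanSpace ℂ n, ‖Matrix.toEuclideanLin A v‖ ≤ K * ‖v‖) :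
    ‖A.trace‖ ≤ K * A.rank := by
  set T := Matrix.toEuclideanLin A with hT
  have h1 : LinearMap.trace ℂ _ T = A.trace := by
    rw [hT, Matrix.toEuclideanLin, Matrix.toLpLin_eq_toLin, Matrix.trace_toLin_eq]
  -- The trace of `T` equals that of its restriction to its range, and an orthonormal basis of the
  -- range has `rank A` elements, each contributing at most `K`.
  set p := LinearMap.range T with hp
  have h2 := LinearMap.trace_restrict_eq_of_forall_mem p T (fun x => ⟨x, rfl⟩)
  have h3 : Module.finrank ℂ p = A.rank := by
    rw [hp, hT, Matrix.toEuclideanLin, Matrix.toLpLin_eq_toLin]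
    exact (Matrix.rank_eq_finrank_range_toLin A _ _).symm
  rw [← h1, ← h2, LinearMap.trace_eq_sum_inner _ (stdOrthonormalBasis ℂ p)]
  refine (norm_sum_le _ _).trans ?_
  refine (Finset.sum_le_card_nsmul _ _ K ?_).trans ?_
  · intro i _
    refine (norm_inner_le_norm _ _).trans ?_
    rw [(stdOrthonormalBasis ℂ p).orthonormal.1 i, one_mul]
    have := h ((stdOrthonormalBasis ℂ p i : p) : EuclideanSpace ℂ n)
    rw [← Submodule.coe_norm, (stdOrthonormalBasis ℂ p).orthonormal.1 i, mul_one] at this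
    exact this
  · simp [h3, mul_comm]

theorem rank_add_le {m n : Type*} [Fintype m] [Fintype n] (A B : Matrix m n ℂ) :
    (A + B).rank ≤ A.rank + B.rank := by
  unfold Matrix.rank
  rw [Matrix.mulVecLin_add]
  refine (Submodule.finrank_mono (LinearMap.range_add_le _ _)).trans ?_
  exact Submodule.finrank_add_le_finrank_add_finrank _ _

theorem rank_sum_le {m n ι : Type*} [Fintype m] [Fintype n] (s : Finset ι)
    (A : ι → Matrix m n ℂ) : (∑ i ∈ s, A i).rank ≤ ∑ i ∈ s, (A i).rank := by
  classical
  induction s using Finset.induction_on with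
  | empty => simp
  | insert a s ha ih =>
    rw [Finset.sum_insert ha, Finset.sum_insert ha]
    exact (rank_add_le _ _).trans (by omega)

theorem rank_neg {m n : Type*} [Fintype n] (A : Matrix m n ℂ) :
    (-A).rank = A.rank := by
  unfold Matrix.rank
  rw [show (-A).mulVecLin = -A.mulVecLin by ext; simp, LinearMap.range_neg]

open scoped ComplexOrder in
theorem rank_fromBlocks_antidiag_le {m n : Type*} [Fintype m] [Fintype n] [DecidableEq m]
    [DecidableEq n] (A : Matrix m n ℂ) :
    (Matrix.fromBlocks 0 A Aᴴ 0 : Matrix (m ⊕ n) (m ⊕ n) ℂ).rank ≤ 2 * A.rank := by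
  -- Each off-diagonal block is put in place by a coordinate inclusion and a coordinate projection,
  -- which do not raise the rank.
  have e1 : (Matrix.fromBlocks 0 A Aᴴ 0 : Matrix (m ⊕ n) (m ⊕ n) ℂ)
      = Matrix.fromRows (1 : Matrix m m ℂ) 0 * (A * Matrix.fromCols 0 (1 : Matrix n n ℂ))
        + Matrix.fromRows 0 (1 : Matrix n n ℂ) * (Aᴴ * Matrix.fromCols (1 : Matrix m m ℂ) 0) := by
    ext i j
    rcases i with i | i <;> rcases j with j | j <;>
      simp [Matrix.mul_fromCols, Matrix.fromRows_mul]
  rw [e1]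
  refine (rank_add_le _ _).trans ?_
  have h1 := (Matrix.rank_mul_le_right (Matrix.fromRows (1 : Matrix m m ℂ) (0 : Matrix n m ℂ))
    (A * Matrix.fromCols (0 : Matrix n m ℂ) (1 : Matrix n n ℂ))).trans (Matrix.rank_mul_le_left _ _)
  have h2 := (Matrix.rank_mul_le_right (Matrix.fromRows (0 : Matrix m n ℂ) (1 : Matrix n n ℂ))
    (Aᴴ * Matrix.fromCols (1 : Matrix m m ℂ) (0 : Matrix m n ℂ))).trans (Matrix.rank_mul_le_left _ _)
  rw [Matrix.rank_conjTranspose] at h2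
  omega

variable {n : Type*} [Fintype n] [DecidableEq n]

/-- The quadratic form of a Hermitian matrix is real, so `⟨v, (V - z) v⟩` has imaginary part `-Im z
‖v‖²`; Cauchy–Schwarz does the rest. Invertibility of `V - z` and the resolvent bound both follow.
-/
theorem im_mul_norm_le_of_isHermitian {V : Matrix n n ℂ} (hV : V.IsHermitian) (z : ℂ)
    (hz : 0 < z.im) (v : EuclideanSpace ℂ n) :
    z.im * ‖v‖ ≤ ‖Matrix.toEuclideanLin (V - z • 1) v‖ := by
  have hs : (Matrix.toEuclideanLin V).IsSymmetric := Matrix.isSymmetric_toEuclideanLin_iff.mpr hV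
  have e : Matrix.toEuclideanLin (V - z • 1) v = Matrix.toEuclideanLin V v - z • v := by
    ext i; simp
  have h1 : (inner ℂ v (Matrix.toEuclideanLin (V - z • 1) v)).im = -(z.im * ‖v‖ ^ 2) := by
    rw [e, inner_sub_right, inner_smul_right, inner_self_eq_norm_sq_to_K]
    have h0 : (inner ℂ v (Matrix.toEuclideanLin V v)).im = 0 := by
      simpa using hs.im_inner_self_apply v
    have h00 : (z * ((‖v‖ : ℝ) : ℂ) ^ 2).im = z.im * ‖v‖ ^ 2 := by
      rw [← Complex.ofReal_pow, Complex.im_mul_ofReal]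
    rw [Complex.sub_im, h0, zero_sub]
    exact congrArg Neg.neg h00
  have h2 : z.im * ‖v‖ ^ 2 ≤ ‖v‖ * ‖Matrix.toEuclideanLin (V - z • 1) v‖ := by
    calc z.im * ‖v‖ ^ 2 = |(inner ℂ v (Matrix.toEuclideanLin (V - z • 1) v)).im| := by
          rw [h1, abs_neg, abs_of_nonneg (by positivity)]
      _ ≤ _ := (Complex.abs_im_le_norm _).trans (norm_inner_le_norm _ _)
  rcases (norm_nonneg v).eq_or_lt with h | h
  · rw [← h]; simp
  · nlinarith

theorem isUnit_det_sub_smul_one {V : Matrix n n ℂ} (hV : V.IsHermitian) {z : ℂ}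
    (hz : 0 < z.im) : IsUnit (V - z • 1).det := by
  rw [isUnit_iff_ne_zero]
  intro h
  obtain ⟨v, hv, hv0⟩ := Matrix.exists_mulVec_eq_zero_iff.mpr h
  have := im_mul_norm_le_of_isHermitian hV z hz (WithLp.toLp 2 v)
  rw [Matrix.toLpLin_toLp, Matrix.toLin'_apply, hv0] at this
  have h3 : 0 < ‖(WithLp.toLp 2 v : EuclideanSpace ℂ n)‖ := by
    rw [norm_pos_iff]
    simpa using hv
  simp at this
  nlinarith [mul_pos hz h3]

theorem norm_resolvent_le {V : Matrix n n ℂ} (hV : V.IsHermitian) {z : ℂ} (hz : 0 < z.im)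
    (v : EuclideanSpace ℂ n) :
    ‖Matrix.toEuclideanLin (V - z • 1)⁻¹ v‖ ≤ (z.im)⁻¹ * ‖v‖ := by
  have h := im_mul_norm_le_of_isHermitian hV z hz (Matrix.toEuclideanLin (V - z • 1)⁻¹ v)
  have e : Matrix.toEuclideanLin (V - z • 1) (Matrix.toEuclideanLin (V - z • 1)⁻¹ v) = v := by
    ext i
    simp only [Matrix.ofLp_toLpLin, Matrix.toLin'_apply, Matrix.mulVec_mulVec]
    rw [Matrix.mul_nonsing_inv _ (isUnit_det_sub_smul_one hV hz), Matrix.one_mulVec]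
  rw [e] at h
  rw [inv_mul_eq_div, le_div_iff₀ hz]
  linarith

theorem norm_trace_resolvent_le {V : Matrix n n ℂ} (hV : V.IsHermitian) {z : ℂ} (hz : 0 < z.im) :
    ‖((V - z • 1)⁻¹).trace‖ ≤ (z.im)⁻¹ * Fintype.card n := by
  refine (norm_trace_le_mul_rank _ _ (norm_resolvent_le hV hz)).trans ?_
  gcongr
  exact Matrix.rank_le_card_width _

/-- By the resolvent identity the difference factors through `V - W`, hence has at most its rank,
while its operator norm is at most `2 / Im z`. The size of `V - W` plays no role, so arbitrarily
large entries can be altered. -/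
theorem norm_trace_resolvent_sub_le {V W : Matrix n n ℂ} (hV : V.IsHermitian)
    (hW : W.IsHermitian) {z : ℂ} (hz : 0 < z.im) :
    ‖((V - z • 1)⁻¹).trace - ((W - z • 1)⁻¹).trace‖ ≤ 2 * (z.im)⁻¹ * (V - W).rank := by
  have e : (V - z • 1)⁻¹ - (W - z • 1)⁻¹ = (V - z • 1)⁻¹ * (-(V - W) * (W - z • 1)⁻¹) := by
    have h1 := Matrix.nonsing_inv_mul _ (isUnit_det_sub_smul_one hV hz)
    have h2 := Matrix.mul_nonsing_inv _ (isUnit_det_sub_smul_one hW hz)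
    calc (V - z • 1)⁻¹ - (W - z • 1)⁻¹
        = (V - z • 1)⁻¹ * ((W - z • 1) * (W - z • 1)⁻¹)
          - ((V - z • 1)⁻¹ * (V - z • 1)) * (W - z • 1)⁻¹ := by rw [h1, h2]; simp
      _ = _ := by noncomm_ring
  rw [← Matrix.trace_sub]
  refine (norm_trace_le_mul_rank _ (2 * (z.im)⁻¹) fun v => ?_).trans ?_
  · rw [map_sub, LinearMap.sub_apply]
    refine (norm_sub_le _ _).trans ?_
    linarith [norm_resolvent_le hV hz v, norm_resolvent_le hW hz v]
  · rw [e]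
    gcongr
    refine (Matrix.rank_mul_le_right _ _).trans ((Matrix.rank_mul_le_left _ _).trans ?_)
    rw [rank_neg]

end LinearAlgebra

/-! ### Sensitivity of the Stieltjes transform to low-rank changes -/

section Stieltjes

variable {m : ℕ} {d : Fin (m + 1) → ℕ}

theorem isHermitian_hermitization (F : MatTuple d → OutMat d) (B : OutMat d) (Z : MatTuple d) :
    (hermitization F B Z).IsHermitian := by
  simp [hermitization, Matrix.IsHermitian, Matrix.fromBlocks_conjTranspose]

/-- The constant is `1/(2n)` from the normalisation, times `2 / Im z` from the two resolvents, times
`2` because hermitization doubles the rank. -/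
theorem norm_stieltjes_sub_le (F : MatTuple d → OutMat d) (B : OutMat d) {z : ℂ} (hz : 0 < z.im)
    (Z W : MatTuple d) :
    ‖stieltjes F B z Z - stieltjes F B z W‖ ≤ 2 / (d 0 * z.im) * (F Z - F W).rank := by
  have h := norm_trace_resolvent_sub_le (isHermitian_hermitization F B Z)
    (isHermitian_hermitization F B W) hz
  have h2 : hermitization F B Z - hermitization F B W
      = Matrix.fromBlocks 0 (F Z - F W) (F Z - F W)ᴴ 0 := by
    simp only [hermitization, sub_eq_add_neg, Matrix.fromBlocks_neg, Matrix.fromBlocks_add,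
      Matrix.conjTranspose_add, Matrix.conjTranspose_neg]
    congr 1 <;> abel
  have h3 : ((hermitization F B Z - hermitization F B W).rank : ℝ) ≤ 2 * (F Z - F W).rank := by
    rw [h2]
    refine (Nat.cast_le.mpr (rank_fromBlocks_antidiag_le _)).trans_eq ?_
    rw [Nat.cast_mul, Nat.cast_ofNat]
  have e : stieltjes F B z Z - stieltjes F B z W = 1 / (2 * (d 0 : ℂ)) *
      ((resolventMat F B z Z).trace - (resolventMat F B z W).trace) := by
    unfold stieltjes; ring
  rw [e, norm_mul]
  have : ‖1 / (2 * (d 0 : ℂ))‖ = 1 / (2 * d 0) := by simp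
  rw [this]
  calc 1 / (2 * (d 0 : ℝ)) * ‖(resolventMat F B z Z).trace - (resolventMat F B z W).trace‖
      ≤ 1 / (2 * (d 0 : ℝ)) * (2 * (z.im)⁻¹ * (2 * (F Z - F W).rank)) := by
        gcongr
        exact h.trans (by gcongr)
    _ = _ := by
        -- For `n = 0` division by zero makes both sides `0`.
        by_cases h0 : (d 0 : ℝ) = 0
        · simp [h0]
        · field_simp

/-- This bound may depend on `n`; it serves only to secure integrability. -/
theorem exists_norm_stieltjes_le (F : MatTuple d → OutMat d) (B : OutMat d) {z : ℂ}
    (hz : 0 < z.im) : ∃ M : ℝ, ∀ Z, ‖stieltjes F B z Z‖ ≤ M := by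
  refine ⟨‖1 / (2 * (d 0 : ℂ))‖ * ((z.im)⁻¹ * Fintype.card (Fin (d 0) ⊕ Fin (d (Fin.last m)))
    + ‖((d (Fin.last m) : ℂ) - (d 0 : ℂ)) / z‖), fun Z => ?_⟩
  unfold stieltjes
  rw [norm_mul]
  gcongr
  refine (norm_add_le _ _).trans ?_
  gcongr
  exact norm_trace_resolvent_le (isHermitian_hermitization F B Z) hz

end Stieltjes

end SVUniversality

namespace SVUniversality

/-! ### Calculus of matrix-valued maps, entry by entry -/

section MatrixCalculus

variable {E : Type*} [NormedAddCommGroup E] [NormedSpace ℝ E] {r s : Type*} [Fintype r] [Fintype s]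
  {k : WithTop ℕ∞}

theorem contDiff_matrix {M : E → Matrix r s ℂ} :
    ContDiff ℝ k M ↔ ∀ i j, ContDiff ℝ k fun x => M x i j := by
  have h1 : ContDiff ℝ k M ↔ ∀ i, ContDiff ℝ k fun x => (M x i : s → ℂ) :=
    contDiff_pi (𝕜 := ℝ) (F' := fun _ : r => s → ℂ) (Φ := M)
  rw [h1]
  exact forall_congr' fun i => contDiff_pi

omit [Fintype r] in
theorem hasDerivAt_matrix {M : ℝ → Matrix r s ℂ} {M' : Matrix r s ℂ} {t : ℝ} :
    HasDerivAt M M' t ↔ ∀ i j, HasDerivAt (fun x => M x i j) (M' i j) t := by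
  have h1 : HasDerivAt M M' t ↔ ∀ i, HasDerivAt (fun x => (M x i : s → ℂ)) (M' i) t :=
    hasDerivAt_pi (𝕜 := ℝ) (E' := fun _ : r => s → ℂ) (φ := M)
  rw [h1]
  exact forall_congr' fun i => hasDerivAt_pi

omit [Fintype r] in
theorem _root_.HasDerivAt.matrix_mul' {p : Type*} [Fintype p] {M : ℝ → Matrix r s ℂ}
    {N : ℝ → Matrix s p ℂ} {M' : Matrix r s ℂ} {N' : Matrix s p ℂ} {t : ℝ}
    (hM : HasDerivAt M M' t) (hN : HasDerivAt N N' t) :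
    HasDerivAt (fun x => M x * N x) (M' * N t + M t * N') t := by
  rw [hasDerivAt_matrix] at hM hN ⊢
  intro i j
  simp only [Matrix.mul_apply, Matrix.add_apply, ← Finset.sum_add_distrib]
  exact HasDerivAt.fun_sum fun l _ => (hM i l).mul (hN l j)

variable [DecidableEq r]

theorem _root_.ContDiff.matrix_det' {M : E → Matrix r r ℂ} (h : ContDiff ℝ k M) :
    ContDiff ℝ k fun x => (M x).det := by
  rw [contDiff_matrix] at h
  simp only [Matrix.det_apply]
  exact ContDiff.sum fun σ _ => (contDiff_prod fun i _ => h _ _).const_smul _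

/-- Cramer's rule: each entry of the inverse is a determinant with one row replaced by a constant
vector, divided by the nonvanishing determinant. -/
theorem _root_.ContDiff.matrix_inv' {M : E → Matrix r r ℂ} (h : ContDiff ℝ k M)
    (h0 : ∀ x, (M x).det ≠ 0) : ContDiff ℝ k fun x => (M x)⁻¹ := by
  rw [contDiff_matrix]
  intro i j
  simp only [Matrix.inv_def, Ring.inverse_eq_inv', Matrix.smul_apply, smul_eq_mul,
    Matrix.adjugate_apply]
  refine (h.matrix_det'.inv h0).mul (ContDiff.matrix_det' ?_)
  rw [contDiff_matrix] at h ⊢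
  intro a b
  by_cases hab : a = j
  · subst hab; simpa using contDiff_const
  · simpa [Matrix.updateRow_ne hab] using h a b

omit [DecidableEq r] in
theorem _root_.ContDiff.matrix_mul' {p : Type*} [Fintype p] {M : E → Matrix r s ℂ}
    {N : E → Matrix s p ℂ} (hM : ContDiff ℝ k M) (hN : ContDiff ℝ k N) :
    ContDiff ℝ k fun x => M x * N x := by
  rw [contDiff_matrix] at hM hN ⊢
  intro i j
  simp only [Matrix.mul_apply]
  exact ContDiff.sum fun l _ => (hM i l).mul (hN l j)

omit [DecidableEq r] in
theorem _root_.ContDiff.matrix_trace' {M : E → Matrix r r ℂ} (hM : ContDiff ℝ k M) :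
    ContDiff ℝ k fun x => (M x).trace := by
  rw [contDiff_matrix] at hM
  exact ContDiff.sum fun l _ => hM l l

end MatrixCalculus

theorem fderiv_fderiv_apply {E F : Type*} [NormedAddCommGroup E] [NormedSpace ℝ E]
    [NormedAddCommGroup F] [NormedSpace ℝ F] {G : E → F} {x : E}
    (hG : DifferentiableAt ℝ (fderiv ℝ G) x) (u v : E) :
    fderiv ℝ (fun y => fderiv ℝ G y u) x v = fderiv ℝ (fderiv ℝ G) x v u := by
  rw [fderiv_clm_apply hG (differentiableAt_const _)]
  simp

/-! ### Single entries of a matrix tuple and the partial derivatives along them -/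

section Entries

variable {m : ℕ} {d : Fin (m + 1) → ℕ}

@[simp]
theorem setEntry_apply_self (Z : MatTuple d) (q : Fin m) (j : Fin (d q.castSucc))
    (k : Fin (d q.succ)) (w : ℂ) : setEntry Z q j k w q j k = w := by
  simp [setEntry]

theorem setEntry_apply_of_ne (Z : MatTuple d) {q q' : Fin m} {j : Fin (d q.castSucc)}
    {k : Fin (d q.succ)} {j' : Fin (d q'.castSucc)} {k' : Fin (d q'.succ)} (w : ℂ)
    (h : (⟨q', j', k'⟩ : EntryIdx d) ≠ ⟨q, j, k⟩) :
    setEntry Z q j k w q' j' k' = Z q' j' k' := by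
  unfold setEntry
  by_cases hq : q' = q
  · subst hq
    rw [Function.update_self]
    by_cases hj : j' = j
    · subst hj
      have hk : k' ≠ k := fun hk => h (by rw [hk])
      simp [hk]
    · rw [Matrix.updateRow_ne hj]
  · rw [Function.update_of_ne hq]

/-- Two tuples agree if they agree at the entry `(q, j, k)` and away from it. -/
theorem matTuple_ext_entry {Z W : MatTuple d} (q : Fin m) (j : Fin (d q.castSucc))
    (k : Fin (d q.succ)) (h : Z q j k = W q j k)
    (h' : ∀ (q' : Fin m) (j' : Fin (d q'.castSucc)) (k' : Fin (d q'.succ)),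
      (⟨q', j', k'⟩ : EntryIdx d) ≠ ⟨q, j, k⟩ → Z q' j' k' = W q' j' k') : Z = W := by
  ext q' j' k'
  by_cases hne : (⟨q', j', k'⟩ : EntryIdx d) = ⟨q, j, k⟩
  · cases hne
    exact h
  · exact h' _ _ _ hne

/-- The tuple with the single possibly nonzero entry `w` at `(q, j, k)`. -/
noncomputable def entryCLM (q : Fin m) (j : Fin (d q.castSucc)) (k : Fin (d q.succ)) :
    ℂ →L[ℝ] MatTuple d :=
  LinearMap.toContinuousLinearMap
    { toFun := fun w => setEntry 0 q j k w
      map_add' := fun a b => by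
        refine matTuple_ext_entry q j k (by simp) fun q' j' k' h => ?_
        simp [setEntry_apply_of_ne _ _ h]
      map_smul' := fun c a => by
        refine matTuple_ext_entry q j k (by simp) fun q' j' k' h => ?_
        simp [setEntry_apply_of_ne _ _ h] }

theorem entryCLM_apply (q : Fin m) (j : Fin (d q.castSucc)) (k : Fin (d q.succ)) (w : ℂ) :
    entryCLM q j k w = setEntry (0 : MatTuple d) q j k w := rfl

/-- Changing an entry is a translation along a fixed linear embedding of `ℂ`. This turns the
entrywise partial derivatives into Fréchet derivatives in the directions `entryCLM q j k 1` and
`entryCLM q j k I`. -/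
theorem setEntry_eq (Z : MatTuple d) (q : Fin m) (j : Fin (d q.castSucc)) (k : Fin (d q.succ))
    (w : ℂ) : setEntry Z q j k w = Z + entryCLM q j k (w - Z q j k) := by
  refine matTuple_ext_entry q j k (by simp [entryCLM_apply]) fun q' j' k' h => ?_
  simp [setEntry_apply_of_ne _ _ h, entryCLM_apply]

@[simp]
theorem setEntry_self (Z : MatTuple d) (q : Fin m) (j : Fin (d q.castSucc))
    (k : Fin (d q.succ)) : setEntry Z q j k (Z q j k) = Z := by
  simp [setEntry_eq]

theorem sum_entryCLM (H : MatTuple d) :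
    ∑ q, ∑ j, ∑ k, entryCLM q j k (H q j k) = H := by
  have e : ∑ q, ∑ j, ∑ k, entryCLM q j k (H q j k)
      = ∑ i : EntryIdx d, entryCLM i.1 i.2.1 i.2.2 (H i.1 i.2.1 i.2.2) := by
    rw [Fintype.sum_sigma]
    refine Finset.sum_congr rfl fun q _ => ?_
    rw [Fintype.sum_prod_type]
  rw [e]
  ext q j k
  simp only [Finset.sum_apply, Matrix.sum_apply]
  rw [Finset.sum_eq_single (⟨q, j, k⟩ : EntryIdx d)]
  · simp [entryCLM_apply]
  · intro i _ hi
    rw [entryCLM_apply, setEntry_apply_of_ne _ _ (by exact hi.symm)]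
    simp
  · simp

theorem continuous_entry (q : Fin m) (j : Fin (d q.castSucc)) (k : Fin (d q.succ)) :
    Continuous fun Z : MatTuple d => Z q j k :=
  (continuous_apply k).comp ((continuous_apply j).comp (continuous_apply q))

variable {E : Type*} [NormedAddCommGroup E] [NormedSpace ℝ E]

theorem pderivRe_eq {G : MatTuple d → E} (hG : Differentiable ℝ G) (q : Fin m)
    (j : Fin (d q.castSucc)) (k : Fin (d q.succ)) :
    pderivRe q j k G = fun Z => fderiv ℝ G Z (entryCLM q j k 1) := by
  ext Z
  refine HasDerivAt.deriv ?_
  have h1 : HasDerivAt (fun s : ℝ => setEntry Z q j k (Z q j k + (s : ℂ)))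
      (entryCLM q j k 1) 0 := by
    have h2 : HasDerivAt (fun s : ℝ => Z + s • entryCLM q j k (1 : ℂ))
        ((1 : ℝ) • entryCLM q j k (1 : ℂ)) 0 :=
      ((hasDerivAt_id (0 : ℝ)).smul_const _).const_add _
    rw [one_smul] at h2
    convert h2 using 2 with s
    rw [setEntry_eq, ← map_smul]
    simp
  have h3 := (hG (setEntry Z q j k (Z q j k + ((0 : ℝ) : ℂ)))).hasFDerivAt.comp_hasDerivAt
    (0 : ℝ) h1
  simpa using! h3

theorem pderivIm_eq {G : MatTuple d → E} (hG : Differentiable ℝ G) (q : Fin m)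
    (j : Fin (d q.castSucc)) (k : Fin (d q.succ)) :
    pderivIm q j k G = fun Z => fderiv ℝ G Z (entryCLM q j k Complex.I) := by
  ext Z
  refine HasDerivAt.deriv ?_
  have h1 : HasDerivAt (fun s : ℝ => setEntry Z q j k (Z q j k + (s : ℂ) * Complex.I))
      (entryCLM q j k Complex.I) 0 := by
    have h2 : HasDerivAt (fun s : ℝ => Z + s • entryCLM q j k Complex.I)
        ((1 : ℝ) • entryCLM q j k Complex.I) 0 :=
      ((hasDerivAt_id (0 : ℝ)).smul_const _).const_add _
    rw [one_smul] at h2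
    convert h2 using 2 with s
    rw [setEntry_eq, ← map_smul]
    simp
  have h3 := (hG (setEntry Z q j k (Z q j k + ((0 : ℝ) : ℂ) * Complex.I))).hasFDerivAt.comp_hasDerivAt
    (0 : ℝ) h1
  simpa using! h3

theorem fderiv_entryCLM {G : MatTuple d → E} (hG : Differentiable ℝ G) (q : Fin m)
    (j : Fin (d q.castSucc)) (k : Fin (d q.succ)) (Z : MatTuple d) (w : ℂ) :
    fderiv ℝ G Z (entryCLM q j k w)
      = w.re • pderivRe q j k G Z + w.im • pderivIm q j k G Z := by
  have hw : w = w.re • (1 : ℂ) + w.im • Complex.I := by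
    apply Complex.ext <;> simp
  conv_lhs => rw [hw, map_add, map_add, map_smul, map_smul, map_smul, map_smul]
  rw [pderivRe_eq hG, pderivIm_eq hG]

theorem fderiv_eq_sum {G : MatTuple d → E} (hG : Differentiable ℝ G) (Z H : MatTuple d) :
    fderiv ℝ G Z H = ∑ q, ∑ j, ∑ k,
      ((H q j k).re • pderivRe q j k G Z + (H q j k).im • pderivIm q j k G Z) := by
  conv_lhs => rw [← sum_entryCLM H]
  simp only [map_sum, fderiv_entryCLM hG]

theorem contDiff_pderivRe {G : MatTuple d → E} {a b : WithTop ℕ∞} (hG : ContDiff ℝ b G)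
    (hab : a + 1 ≤ b) (q : Fin m) (j : Fin (d q.castSucc)) (k : Fin (d q.succ)) :
    ContDiff ℝ a (pderivRe q j k G) := by
  rw [pderivRe_eq (hG.differentiable (by rintro rfl; simp at hab))]
  exact (hG.fderiv_right hab).clm_apply contDiff_const

theorem contDiff_pderivIm {G : MatTuple d → E} {a b : WithTop ℕ∞} (hG : ContDiff ℝ b G)
    (hab : a + 1 ≤ b) (q : Fin m) (j : Fin (d q.castSucc)) (k : Fin (d q.succ)) :
    ContDiff ℝ a (pderivIm q j k G) := by
  rw [pderivIm_eq (hG.differentiable (by rintro rfl; simp at hab))]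
  exact (hG.fderiv_right hab).clm_apply contDiff_const

/-- Symmetry of the second derivative. The hypotheses bound the mixed derivative in one order only,
whereas the Taylor expansion produces both. -/
theorem pderivIm_pderivRe {G : MatTuple d → E} (hG : ContDiff ℝ 2 G) (q : Fin m)
    (j : Fin (d q.castSucc)) (k : Fin (d q.succ)) :
    pderivIm q j k (pderivRe q j k G) = pderivRe q j k (pderivIm q j k G) := by
  have h1 : Differentiable ℝ (fderiv ℝ G) :=
    (hG.fderiv_right (m := 1) (by norm_num)).differentiable (by norm_num)
  have hR := contDiff_pderivRe hG (a := 1) (by norm_num) q j k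
  have hI := contDiff_pderivIm hG (a := 1) (by norm_num) q j k
  rw [pderivIm_eq (hR.differentiable (by norm_num)), pderivRe_eq (hI.differentiable (by norm_num)),
    pderivRe_eq (hG.differentiable (by norm_num)), pderivIm_eq (hG.differentiable (by norm_num))]
  ext Z
  have hs := (hG.contDiffAt (x := Z)).isSymmSndFDerivAt (by simp)
  exact (fderiv_fderiv_apply (h1 Z) _ _).trans ((hs _ _).trans (fderiv_fderiv_apply (h1 Z) _ _).symm)

/-- The derivative of `θ ↦ G (Z with the entry (q, j, k) multiplied by θ)`. -/
theorem hasDerivAt_setEntry_mul {G : MatTuple d → E} (hG : Differentiable ℝ G) (q : Fin m)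
    (j : Fin (d q.castSucc)) (k : Fin (d q.succ)) (Z : MatTuple d) (θ : ℝ) :
    HasDerivAt (fun θ : ℝ => G (setEntry Z q j k ((θ : ℂ) * Z q j k)))
      ((Z q j k).re • pderivRe q j k G (setEntry Z q j k ((θ : ℂ) * Z q j k))
        + (Z q j k).im • pderivIm q j k G (setEntry Z q j k ((θ : ℂ) * Z q j k))) θ := by
  have h1 : HasDerivAt (fun s : ℝ => setEntry Z q j k ((s : ℂ) * Z q j k))
      (entryCLM q j k (Z q j k)) θ := by
    have h2 : HasDerivAt (fun s : ℝ => (Z + entryCLM q j k (- Z q j k))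
        + s • entryCLM q j k (Z q j k)) ((1 : ℝ) • entryCLM q j k (Z q j k)) θ :=
      ((hasDerivAt_id θ).smul_const _).const_add _
    rw [one_smul] at h2
    convert h2 using 2 with s
    rw [setEntry_eq, ← map_smul, add_assoc, ← map_add]
    simp [sub_eq_neg_add]
  rw [← fderiv_entryCLM hG]
  exact (hG _).hasFDerivAt.comp_hasDerivAt θ h1

theorem continuous_setEntry_mul (q : Fin m) (j : Fin (d q.castSucc)) (k : Fin (d q.succ)) :
    Continuous fun p : ℝ × MatTuple d => setEntry p.2 q j k ((p.1 : ℂ) * p.2 q j k) := by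
  simp only [setEntry_eq]
  have h := (continuous_entry q j k).comp (continuous_snd (X := ℝ) (Y := MatTuple d))
  have h2 := Complex.continuous_ofReal.comp (continuous_fst (X := ℝ) (Y := MatTuple d))
  exact continuous_snd.add ((entryCLM q j k).continuous.comp ((h2.mul h).sub h))

end Entries

/-! ### Smoothness and derivative of the Stieltjes transform -/

section Resolvent

variable {m : ℕ} {d : Fin (m + 1) → ℕ} {F : MatTuple d → OutMat d} {z : ℂ}

theorem contDiff_hermitization (hF : ContDiff ℝ 3 F) (B : OutMat d) :
    ContDiff ℝ 3 (hermitization F B) := by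
  rw [contDiff_matrix] at hF ⊢
  rintro (i | i) (j | j)
  · simpa [hermitization] using contDiff_const
  · simpa [hermitization] using (hF i j).add contDiff_const
  · have h : ContDiff ℝ 3 fun x => (starRingEnd ℂ) (F x j i + B j i) :=
      Complex.conjCLE.contDiff.comp ((hF j i).add contDiff_const)
    simpa [hermitization] using h
  · simpa [hermitization] using contDiff_const

theorem contDiff_resolventMat (hF : ContDiff ℝ 3 F) (B : OutMat d) (hz : 0 < z.im) :
    ContDiff ℝ 3 (resolventMat F B z) :=
  ((contDiff_hermitization hF B).sub contDiff_const).matrix_inv' fun Z =>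
    (isUnit_det_sub_smul_one (isHermitian_hermitization F B Z) hz).ne_zero

theorem contDiff_stieltjes (hF : ContDiff ℝ 3 F) (B : OutMat d) (hz : 0 < z.im) :
    ContDiff ℝ 3 (stieltjes F B z) :=
  contDiff_const.mul ((contDiff_resolventMat hF B hz).matrix_trace'.add contDiff_const)

theorem contDiff_gRe (hF : ContDiff ℝ 3 F) (B : OutMat d) (hz : 0 < z.im) (q : Fin m)
    (j : Fin (d q.castSucc)) (k : Fin (d q.succ)) : ContDiff ℝ 2 (gRe F B z q j k) := by
  have hR : ContDiff ℝ 2 (resolventMat F B z) :=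
    (contDiff_resolventMat hF B hz).of_le (by norm_num)
  unfold gRe
  simp only [pow_two]
  exact ((contDiff_pderivRe (contDiff_hermitization hF B) (by norm_num) q j k).matrix_mul'
    (hR.matrix_mul' hR)).matrix_trace'

theorem contDiff_gIm (hF : ContDiff ℝ 3 F) (B : OutMat d) (hz : 0 < z.im) (q : Fin m)
    (j : Fin (d q.castSucc)) (k : Fin (d q.succ)) : ContDiff ℝ 2 (gIm F B z q j k) := by
  have hR : ContDiff ℝ 2 (resolventMat F B z) :=
    (contDiff_resolventMat hF B hz).of_le (by norm_num)
  unfold gIm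
  simp only [pow_two]
  exact ((contDiff_pderivIm (contDiff_hermitization hF B) (by norm_num) q j k).matrix_mul'
    (hR.matrix_mul' hR)).matrix_trace'

/-- The derivative of the Stieltjes transform along a curve. -/
theorem hasDerivAt_stieltjes (hF : ContDiff ℝ 3 F) (B : OutMat d) (hz : 0 < z.im)
    {Z : ℝ → MatTuple d} {H : MatTuple d} {t : ℝ} (hZ : HasDerivAt Z H t) :
    HasDerivAt (fun s => stieltjes F B z (Z s))
      (-(1 / (2 * (d 0 : ℂ))) * ∑ q, ∑ j, ∑ k,
        ((H q j k).re • gRe F B z q j k (Z t) + (H q j k).im • gIm F B z q j k (Z t))) t := by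
  have hVd : Differentiable ℝ (hermitization F B) :=
    (contDiff_hermitization hF B).differentiable (by norm_num)
  have hV := (hVd (Z t)).hasFDerivAt.comp_hasDerivAt t hZ
  have hR := (((contDiff_resolventMat hF B hz).differentiable (by norm_num))
    (Z t)).hasFDerivAt.comp_hasDerivAt t hZ
  set V' := fderiv ℝ (hermitization F B) (Z t) H
  set R' := fderiv ℝ (resolventMat F B z) (Z t) H
  set R := resolventMat F B z (Z t)
  have hVz : HasDerivAt (fun s => hermitization F B (Z s) - z • 1) V' t := hV.sub_const _
  have hprod := HasDerivAt.matrix_mul' hVz hR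
  have hU : ∀ Z, IsUnit (hermitization F B Z - z • 1).det := fun Z =>
    isUnit_det_sub_smul_one (isHermitian_hermitization F B Z) hz
  have hconst : (fun s => (hermitization F B (Z s) - z • 1) * (resolventMat F B z ∘ Z) s)
      = fun _ => 1 := by
    ext1 s
    exact Matrix.mul_nonsing_inv _ (hU _)
  rw [hconst] at hprod
  -- Differentiating `(V - z) R = 1` gives `V' R + (V - z) R' = 0`, hence `R' = -R V' R`; by
  -- cyclicity of the trace, `Tr R' = -Tr(V' R²)`, which is linear in the direction.
  have h0 := hprod.unique (hasDerivAt_const t _)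
  have hinv : R * (hermitization F B (Z t) - z • 1) = 1 := Matrix.nonsing_inv_mul _ (hU _)
  have hR' : R' = -(R * V' * R) := by
    have : R * (V' * R + (hermitization F B (Z t) - z • 1) * R') = 0 := by
      rw [show V' * R + (hermitization F B (Z t) - z • 1) * R' = 0 from h0, Matrix.mul_zero]
    rw [Matrix.mul_add, ← Matrix.mul_assoc, ← Matrix.mul_assoc, hinv, Matrix.one_mul] at this
    exact eq_neg_of_add_eq_zero_right this
  have htr : HasDerivAt (fun s => (resolventMat F B z (Z s)).trace) R'.trace t := by
    have hR2 := hasDerivAt_matrix.1 hR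
    exact HasDerivAt.fun_sum fun l _ => hR2 l l
  have hexp : V' = ∑ q, ∑ j, ∑ k, ((H q j k).re • pderivRe q j k (hermitization F B) (Z t)
      + (H q j k).im • pderivIm q j k (hermitization F B) (Z t)) := fderiv_eq_sum hVd (Z t) H
  have key : R'.trace = -∑ q, ∑ j, ∑ k,
      ((H q j k).re • gRe F B z q j k (Z t) + (H q j k).im • gIm F B z q j k (Z t)) := by
    rw [hR', Matrix.trace_neg, Matrix.trace_mul_comm, ← Matrix.mul_assoc, Matrix.trace_mul_comm,
      ← pow_two, hexp]
    simp only [Finset.sum_mul, Matrix.trace_sum, Matrix.add_mul, Matrix.smul_mul, Matrix.trace_add,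
      Matrix.trace_smul]
    rfl
  have := (htr.add_const (((d (Fin.last m) : ℂ) - (d 0 : ℂ)) / z)).const_mul (1 / (2 * (d 0 : ℂ)))
  rw [key, mul_neg, ← neg_mul] at this
  exact this

end Resolvent

end SVUniversality

namespace SVUniversality

/-! ### Differentiation under the integral sign at bounded random parameters -/

section ParametricIntegral

variable {Ω K : Type*} [MeasurableSpace Ω] {μ : Measure Ω} [IsFiniteMeasure μ]

/-- The parameter stays in a closed ball, compact since the space is proper, so a continuous
function of it is bounded. -/
theorem integrable_smul_comp_of_bounded [NormedAddCommGroup K] [ProperSpace K] {Φ : K → ℂ}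
    (hΦ : Continuous Φ) {ξ : Ω → K} (hξ : AEStronglyMeasurable ξ μ) {C : ℝ}
    (hC : ∀ ω, ‖ξ ω‖ ≤ C) {w : Ω → ℝ} (hw : AEStronglyMeasurable w μ) {D : ℝ}
    (hD : ∀ ω, |w ω| ≤ D) : Integrable (fun ω => w ω • Φ (ξ ω)) μ := by
  obtain ⟨M, hM⟩ := (isCompact_closedBall (0 : K) C).exists_bound_of_continuousOn hΦ.continuousOn
  refine Integrable.of_bound (hw.smul (hΦ.comp_aestronglyMeasurable hξ)) (D * M)
    (ae_of_all _ fun ω => ?_)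
  rw [norm_smul]
  have hD0 := (abs_nonneg _).trans (hD ω)
  exact mul_le_mul (hD ω) (hM _ (by simpa using hC ω)) (norm_nonneg _) hD0

/-- Differentiation under the integral sign for continuously differentiable integrands evaluated
at bounded random parameters. -/
theorem hasDerivAt_integral_of_bounded [NormedAddCommGroup K] [ProperSpace K] {Φ Φ' : ℝ → K → ℂ}
    (hΦ : Continuous (Function.uncurry Φ)) (hΦ' : Continuous (Function.uncurry Φ'))
    (hd : ∀ s x, HasDerivAt (fun s => Φ s x) (Φ' s x) s) {ξ : Ω → K}
    (hξ : AEStronglyMeasurable ξ μ) {C : ℝ} (hC : ∀ ω, ‖ξ ω‖ ≤ C) {w : Ω → ℝ}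
    (hw : AEStronglyMeasurable w μ) {D : ℝ} (hD : ∀ ω, |w ω| ≤ D) (t : ℝ) :
    HasDerivAt (fun s => ∫ ω, w ω • Φ s (ξ ω) ∂μ) (∫ ω, w ω • Φ' t (ξ ω) ∂μ) t := by
  obtain ⟨M, hM⟩ := ((isCompact_closedBall t 1).prod
    (isCompact_closedBall (0 : K) C)).exists_bound_of_continuousOn hΦ'.continuousOn
  have hΦs : ∀ s, Continuous (Φ s) := fun s => hΦ.comp (Continuous.prodMk_right s)
  have hΦs' : ∀ s, Continuous (Φ' s) := fun s => hΦ'.comp (Continuous.prodMk_right s)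
  refine (hasDerivAt_integral_of_dominated_loc_of_deriv_le (F := fun s ω => w ω • Φ s (ξ ω))
    (F' := fun s ω => w ω • Φ' s (ξ ω)) (bound := fun _ => D * M)
    (Metric.closedBall_mem_nhds t one_pos) ?_ ?_ ?_ ?_ (integrable_const _) ?_).2
  · exact Eventually.of_forall fun s => hw.smul ((hΦs s).comp_aestronglyMeasurable hξ)
  · exact integrable_smul_comp_of_bounded (hΦs t) hξ hC hw hD
  · exact hw.smul ((hΦs' t).comp_aestronglyMeasurable hξ)
  · refine ae_of_all _ fun ω s hs => ?_
    rw [norm_smul]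
    have hD0 := (abs_nonneg _).trans (hD ω)
    exact mul_le_mul (hD ω) (hM (s, ξ ω) ⟨hs, by simpa using hC ω⟩) (norm_nonneg _) hD0
  · exact ae_of_all _ fun ω s _ => (hd s (ξ ω)).const_smul (w ω)

end ParametricIntegral

/-! ### Concentration from bounded differences -/

section EfronStein

/-- Law of total variance. The mean conditional variance given the first coordinate is at most `a`;
the conditional mean `G` varies by at most `c`, so it lies within `c` of its average and has
variance at most `c²`. -/
theorem variance_prod_le {α β : Type*} [MeasurableSpace α] [MeasurableSpace β] {μ : Measure α}
    {ν : Measure β} [IsProbabilityMeasure μ] [IsProbabilityMeasure ν] {g : α × β → ℝ}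
    (hg : Measurable g) {M : ℝ} (hM : ∀ x, |g x| ≤ M) {a c : ℝ}
    (ha : ∀ x, Var[fun y => g (x, y); ν] ≤ a) (hc : ∀ x x' y, |g (x, y) - g (x', y)| ≤ c) :
    Var[g; μ.prod ν] ≤ a + c ^ 2 := by
  set G : α → ℝ := fun x => ∫ y, g (x, y) ∂ν with hG
  have hGm : StronglyMeasurable G := hg.stronglyMeasurable.integral_prod_right'
  have hgx : ∀ x, Measurable fun y => g (x, y) := fun x => hg.comp measurable_prodMk_left
  have hgL : MemLp g 2 (μ.prod ν) := MemLp.of_bound hg.aestronglyMeasurable M (ae_of_all _ hM)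
  have hgxL : ∀ x, MemLp (fun y => g (x, y)) 2 ν := fun x =>
    MemLp.of_bound (hgx x).aestronglyMeasurable M (ae_of_all _ fun y => hM _)
  have hGb : ∀ x, |G x| ≤ M := fun x => by
    rw [← Real.norm_eq_abs]
    refine (norm_integral_le_integral_norm _).trans ?_
    refine (integral_mono (hgxL x |>.integrable one_le_two).norm (integrable_const M)
      fun y => hM _).trans ?_
    simp
  have hGL : MemLp G 2 μ := MemLp.of_bound hGm.aestronglyMeasurable M (ae_of_all _ hGb)
  have hGc : ∀ x x', |G x - G x'| ≤ c := fun x x' => by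
    rw [hG]
    simp only
    rw [← integral_sub ((hgxL x).integrable one_le_two) ((hgxL x').integrable one_le_two)]
    rw [← Real.norm_eq_abs]
    refine (norm_integral_le_integral_norm _).trans ?_
    refine (integral_mono ((hgxL x).integrable one_le_two |>.sub
      ((hgxL x').integrable one_le_two)).norm (integrable_const c) fun y => hc _ _ _).trans ?_
    simp
  have hGm' : ∀ x, |G x - ∫ x', G x' ∂μ| ≤ c := fun x => by
    have : G x - ∫ x', G x' ∂μ = ∫ x', (G x - G x') ∂μ := by
      rw [integral_sub (integrable_const _) (hGL.integrable one_le_two)]; simp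
    rw [this]
    rw [← Real.norm_eq_abs]
    refine (norm_integral_le_integral_norm _).trans ?_
    refine (integral_mono ((integrable_const _).sub (hGL.integrable one_le_two)).norm
      (integrable_const c) fun y => hGc _ _).trans ?_
    simp
  have hVG : Var[G; μ] ≤ c ^ 2 := by
    rw [variance_eq_integral hGm.measurable.aemeasurable]
    refine (integral_mono_of_nonneg (ae_of_all _ fun x => sq_nonneg _) (integrable_const (c ^ 2))
      (ae_of_all _ fun x => ?_)).trans ?_
    · exact sq_le_sq' (abs_le.1 (hGm' x)).1 (abs_le.1 (hGm' x)).2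
    · simp
  have hsq : Integrable (fun p => g p ^ 2) (μ.prod ν) := hgL.integrable_sq
  have hVarx : ∀ x, Var[fun y => g (x, y); ν] = ∫ y, g (x, y) ^ 2 ∂ν - G x ^ 2 := fun x => by
    rw [variance_eq_sub (hgxL x)]; simp [hG]
  rw [variance_eq_sub hgL, integral_prod _ (hgL.integrable one_le_two)]
  rw [variance_eq_sub hGL] at hVG
  have e1 : ∫ p, (g ^ 2) p ∂(μ.prod ν) = ∫ x, ∫ y, g (x, y) ^ 2 ∂ν ∂μ :=
    integral_prod _ hsq
  have e2 : ∫ x, ∫ y, g (x, y) ^ 2 ∂ν ∂μ ≤ ∫ x, (a + G x ^ 2) ∂μ := by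
    refine integral_mono hsq.integral_prod_left ((integrable_const _).add hGL.integrable_sq)
      fun x => ?_
    have := ha x
    rw [hVarx] at this
    simp only
    linarith
  rw [integral_add (integrable_const _) hGL.integrable_sq] at e2
  simp at e2 hVG
  rw [e1]
  simp only [hG] at *
  linarith

theorem variance_pi_fin_le {n : ℕ} {α : Fin n → Type*} [∀ i, MeasurableSpace (α i)]
    (ν : ∀ i, Measure (α i)) [∀ i, IsProbabilityMeasure (ν i)] {f : (∀ i, α i) → ℝ}
    (hf : Measurable f) {M : ℝ} (hM : ∀ x, |f x| ≤ M) {c : ℝ}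
    (hc : ∀ i x y, (∀ j, j ≠ i → x j = y j) → |f x - f y| ≤ c) :
    Var[f; Measure.pi ν] ≤ n * c ^ 2 := by
  induction n with
  | zero =>
    have : f = fun _ => f (fun i => i.elim0) := by
      ext x; congr 1; exact Subsingleton.elim _ _
    rw [this]
    rw [variance_eq_integral measurable_const.aemeasurable]
    simp
  | succ n ih =>
    -- Coordinate `0` is split off: the induction hypothesis bounds the variance in the remaining
    -- coordinates, and the bounded difference in coordinate `0` adds one more `c²`.
    set e := MeasurableEquiv.piFinSuccAbove α 0
    have he := measurePreserving_piFinSuccAbove ν 0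
    have hsymm := he.symm
    set g : α 0 × (∀ j : Fin n, α ((0 : Fin (n + 1)).succAbove j)) → ℝ := fun p => f (e.symm p)
    have hgm : Measurable g := hf.comp e.symm.measurable
    have e0 : ∀ p, e.symm p 0 = p.1 := fun p =>
      congrArg Prod.fst (e.apply_symm_apply p)
    have e1 : ∀ p (j : Fin n), e.symm p ((0 : Fin (n + 1)).succAbove j) = p.2 j := fun p j =>
      congrFun (congrArg Prod.snd (e.apply_symm_apply p)) j
    have hvar : Var[f; Measure.pi ν] = Var[g; (ν 0).prod
        (Measure.pi fun j => ν ((0 : Fin (n + 1)).succAbove j))] := by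
      rw [← hsymm.map_eq, variance_map_equiv]
      rfl
    rw [hvar]
    refine (variance_prod_le (a := n * c ^ 2) (c := c) hgm (fun x => hM _) (fun x => ?_)
      fun x x' y => ?_).trans ?_
    · refine ih (fun j => ν ((0 : Fin (n + 1)).succAbove j)) (f := fun y => g (x, y))
        (hgm.comp measurable_prodMk_left) (fun y => hM _) fun i y y' h => ?_
      refine hc ((0 : Fin (n + 1)).succAbove i) _ _ fun j hj => ?_
      rcases Fin.eq_self_or_eq_succAbove 0 j with rfl | ⟨j', rfl⟩
      · rw [e0, e0]
      · rw [e1, e1]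
        exact h _ fun h' => hj (by rw [h'])
    · refine hc 0 _ _ fun j hj => ?_
      rcases Fin.eq_self_or_eq_succAbove 0 j with rfl | ⟨j', rfl⟩
      · exact absurd rfl hj
      · rw [e1, e1]
    · push_cast; linarith

/-- A form of the Efron–Stein inequality: bounded differences control the variance. -/
theorem variance_pi_le {ι : Type*} [Fintype ι] {α : ι → Type*} [∀ i, MeasurableSpace (α i)]
    (ν : ∀ i, Measure (α i)) [∀ i, IsProbabilityMeasure (ν i)] {f : (∀ i, α i) → ℝ}
    (hf : Measurable f) {M : ℝ} (hM : ∀ x, |f x| ≤ M) {c : ℝ}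
    (hc : ∀ i x y, (∀ j, j ≠ i → x j = y j) → |f x - f y| ≤ c) :
    Var[f; Measure.pi ν] ≤ Fintype.card ι * c ^ 2 := by
  let e := (Fintype.equivFin ι).symm
  rw [← (measurePreserving_piCongrLeft ν e).map_eq, variance_map_equiv]
  refine variance_pi_fin_le _ (hf.comp (MeasurableEquiv.measurable _)) (fun x => hM _)
    fun i x y h => ?_
  refine hc (e i) _ _ fun j hj => ?_
  obtain ⟨j', rfl⟩ := e.surjective j
  rw [MeasurableEquiv.piCongrLeft_apply_apply, MeasurableEquiv.piCongrLeft_apply_apply]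
  exact h _ fun h' => hj (by rw [h'])

/-- This is the nonnegativity of the variance of `|f - E f|`. -/
theorem integral_abs_sub_integral_le_sqrt_variance {Ω : Type*} [MeasurableSpace Ω] {μ : Measure Ω}
    [IsProbabilityMeasure μ] {f : Ω → ℝ} (hf : MemLp f 2 μ) :
    ∫ ω, |f ω - ∫ ω', f ω' ∂μ| ∂μ ≤ √(Var[f; μ]) := by
  have h1 : MemLp (fun ω => |f ω - ∫ ω', f ω' ∂μ|) 2 μ := (hf.sub (memLp_const _)).norm
  have h2 := variance_nonneg (fun ω => |f ω - ∫ ω', f ω' ∂μ|) μ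
  rw [variance_eq_sub h1] at h2
  refine Real.le_sqrt_of_sq_le ?_
  rw [variance_eq_integral hf.aemeasurable]
  simp only [Pi.pow_apply, sq_abs] at h2
  linarith

/-- Concentration of a bounded function with bounded differences of independent variables. -/
theorem integral_norm_sub_integral_le_of_bounded_differences {Ω : Type*} [MeasurableSpace Ω]
    {μ : Measure Ω} [IsProbabilityMeasure μ] {ι : Type*} [Fintype ι] {α : ι → Type*}
    [∀ i, MeasurableSpace (α i)] {R : ∀ i, Ω → α i} (hR : ∀ i, Measurable (R i))
    (hind : iIndepFun R μ) {f : (∀ i, α i) → ℂ}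
    (hf : Measurable f) {M : ℝ} (hM : ∀ x, ‖f x‖ ≤ M) {c : ℝ} (hc0 : 0 ≤ c)
    (hc : ∀ i x y, (∀ j, j ≠ i → x j = y j) → ‖f x - f y‖ ≤ c) :
    ∫ ω, ‖f (fun i => R i ω) - ∫ ω', f (fun i => R i ω') ∂μ‖ ∂μ
      ≤ 2 * (c * √(Fintype.card ι)) := by
  have hlaw := (iIndepFun_iff_map_fun_eq_pi_map fun i => (hR i).aemeasurable).1 hind
  have : ∀ i, IsProbabilityMeasure (μ.map (R i)) := fun i =>
    Measure.isProbabilityMeasure_map (hR i).aemeasurable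
  have hRm : Measurable fun ω i => R i ω := measurable_pi_lambda _ hR
  -- Here `g` stands for the real or the imaginary part; the variance bound is for real functions
  -- and is applied to each, whence the factor `2`.
  have key : ∀ g : ℂ → ℝ, Measurable g → (∀ x, |g x| ≤ ‖x‖) → (∀ x y, g (x - y) = g x - g y) →
      (∀ h : Ω → ℂ, Integrable h μ → ∫ ω, g (h ω) ∂μ = g (∫ ω, h ω ∂μ)) →
      ∫ ω, |g (f (fun i => R i ω) - ∫ ω', f (fun i => R i ω') ∂μ)| ∂μ
        ≤ c * √(Fintype.card ι) := by
    intro g hg hgb hgs hgi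
    have hfi : Integrable (fun ω => f (fun i => R i ω)) μ :=
      Integrable.of_bound (hf.comp hRm).aestronglyMeasurable M (ae_of_all _ fun ω => hM _)
    have hm : MemLp (fun ω => g (f (fun i => R i ω))) 2 μ :=
      MemLp.of_bound (hg.comp (hf.comp hRm)).aestronglyMeasurable M
        (ae_of_all _ fun ω => (hgb _).trans (hM _))
    have hv := variance_pi_le (fun i => μ.map (R i)) (f := fun x => g (f x)) (hg.comp hf)
      (fun x => (hgb _).trans (hM x)) (c := c) fun i x y h => by
        rw [← hgs]; exact (hgb _).trans (hc i x y h)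
    rw [← hlaw, variance_map (X := fun x => g (f x)) (hg.comp hf).aemeasurable hRm.aemeasurable] at hv
    have := integral_abs_sub_integral_le_sqrt_variance hm
    simp only [hgs, ← hgi _ hfi]
    refine this.trans ((Real.sqrt_le_sqrt hv).trans ?_)
    rw [Real.sqrt_mul (by positivity), Real.sqrt_sq hc0, mul_comm]
  have hre := key Complex.re Complex.measurable_re Complex.abs_re_le_norm Complex.sub_re
    fun h hh => integral_re hh
  have him := key Complex.im Complex.measurable_im Complex.abs_im_le_norm Complex.sub_im
    fun h hh => integral_im hh
  have hfi : Integrable (fun ω => f (fun i => R i ω) - ∫ ω', f (fun i => R i ω') ∂μ) μ :=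
    (Integrable.of_bound (hf.comp hRm).aestronglyMeasurable M (ae_of_all _ fun ω => hM _)).sub
      (integrable_const _)
  have h1 := integral_mono hfi.norm (hfi.re.abs.add hfi.im.abs)
    (fun ω => Complex.norm_le_abs_re_add_abs_im _)
  have h2 := integral_add hfi.re.abs hfi.im.abs
  simp only [Pi.add_apply] at h1
  refine h1.trans (h2.trans_le ?_)
  refine (add_le_add hre him).trans_eq (by ring)

/-- Grouping independent variables into independent vectors. -/
theorem iIndepFun_curry {Ω : Type*} [MeasurableSpace Ω] {P : Measure Ω} [IsProbabilityMeasure P]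
    {ι : Type*} {κ : ι → Type*} {𝓧 : ∀ i, κ i → Type*} [∀ i j, MeasurableSpace (𝓧 i j)]
    {X : ∀ i j, Ω → 𝓧 i j} (mX : ∀ i j, Measurable (X i j))
    (h : iIndepFun (fun p : (i : ι) × κ i => X p.1 p.2) P) :
    iIndepFun (fun i ω j => X i j ω) P := by
  have hp : ∀ i j, IsProbabilityMeasure (P.map (X i j)) :=
    fun i j => Measure.isProbabilityMeasure_map (mX i j).aemeasurable
  have hi : ∀ i, iIndepFun (X i) P := fun i =>
    h.precomp (g := fun j => (⟨i, j⟩ : (i : ι) × κ i)) sigma_mk_injective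
  rw [iIndepFun_iff_map_fun_eq_infinitePi_map (by fun_prop)] at h ⊢
  -- Currying carries the product of all marginals to a product of products, and each inner product
  -- is the law of one group.
  have e : (fun ω i j => X i j ω)
      = (MeasurableEquiv.piCurry 𝓧) ∘ fun ω (p : (i : ι) × κ i) => X p.1 p.2 ω := by
    ext; simp [Sigma.curry]
  rw [e, ← Measure.map_map (by fun_prop) (by fun_prop), h,
    Measure.infinitePi_map_piCurry fun i j => P.map (X i j)]
  congr 1
  ext1 i
  exact ((iIndepFun_iff_map_fun_eq_infinitePi_map (mX i)).1 (hi i)).symm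

end EfronStein

/-! ### Eighth moments of real Gaussian variables -/

section Gaussian

variable {Ω : Type*} [MeasurableSpace Ω] {μ : Measure Ω} [IsProbabilityMeasure μ]

/-- From `x⁸ ≤ 8! (eˣ + e⁻ˣ)` and the moment generating function at `±1`, which is at most `e`; the
constant is `2 · 8!`. At level `τ_n √n ≥ n^{1/6}` a `p`-th moment makes the normalised Gaussian tail
`O(n^{1 - p/6})`, so `8` is the first even exponent that suffices. -/
theorem _root_.ProbabilityTheory.HasGaussianLaw.integral_pow_eight_le {U : Ω → ℝ}
    (hU : HasGaussianLaw U μ) (h1 : ∫ ω, U ω ∂μ = 0) (h2 : ∫ ω, U ω ^ 2 ∂μ ≤ 1) :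
    Integrable (fun ω => U ω ^ 8) μ ∧ ∫ ω, U ω ^ 8 ∂μ ≤ 80640 * Real.exp 1 := by
  have hm := hU.map_eq_gaussianReal
  have hi : ∀ t, Integrable (fun ω => Real.exp (t * U ω)) μ := fun t => by
    have := integrable_exp_mul_gaussianReal (μ := ∫ ω, U ω ∂μ) (v := Var[U; μ].toNNReal) t
    rw [← hm] at this
    exact this.comp_aemeasurable hU.aemeasurable
  have hv : Var[U; μ] ≤ 1 :=
    (variance_le_expectation_sq hU.aemeasurable.aestronglyMeasurable).trans h2
  have hmgf : ∀ t, t ^ 2 = 1 → ∫ ω, Real.exp (t * U ω) ∂μ ≤ Real.exp 1 := fun t ht => by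
    have := mgf_gaussianReal hm t
    rw [mgf] at this
    rw [this, h1, ht, Real.exp_le_exp, Real.coe_toNNReal _ (variance_nonneg _ _)]
    linarith
  have hb : ∀ x : ℝ, x ^ 8 ≤ 40320 * (Real.exp (1 * x) + Real.exp ((-1) * x)) := fun x => by
    have h := Real.pow_div_factorial_le_exp |x| (abs_nonneg x) 8
    have h8 : |x| ^ 8 = x ^ 8 := by rw [Even.pow_abs ⟨4, rfl⟩]
    rw [h8, div_le_iff₀ (by positivity)] at h
    have h3 : Real.exp |x| ≤ Real.exp (1 * x) + Real.exp ((-1) * x) := by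
      rcases abs_cases x with ⟨h, _⟩ | ⟨h, _⟩ <;> rw [h]
      · rw [one_mul]; linarith [Real.exp_pos (-1 * x)]
      · rw [neg_one_mul]; linarith [Real.exp_pos (1 * x)]
    have h4 : ((Nat.factorial 8 : ℕ) : ℝ) = 40320 := by norm_num [Nat.factorial]
    rw [h4] at h
    linarith
  have hI : Integrable (fun ω => 40320 * (Real.exp (1 * U ω) + Real.exp ((-1) * U ω))) μ :=
    ((hi 1).add (hi (-1))).const_mul _
  have hi8 : Integrable (fun ω => U ω ^ 8) μ :=
    hI.mono' (hU.aemeasurable.pow_const 8).aestronglyMeasurable (ae_of_all _ fun ω => by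
      rw [Real.norm_of_nonneg (by positivity)]; exact hb _)
  refine ⟨hi8, (integral_mono hi8 hI fun ω => hb _).trans ?_⟩
  rw [integral_const_mul, integral_add (hi 1) (hi (-1))]
  linarith [hmgf 1 (by norm_num), hmgf (-1) (by norm_num)]

end Gaussian

end SVUniversality

namespace SVUniversality

/-! ### Rank bounds by rows and by nonzero entries -/

section RankBounds

variable {r s : Type*} [Fintype r] [Fintype s] [DecidableEq r] [DecidableEq s]

omit [Fintype r] [DecidableEq s] in
theorem rank_le_one_of_row {A : Matrix r s ℂ} (i : r) (h : ∀ i', i' ≠ i → A i' = 0) :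
    A.rank ≤ 1 := by
  have e : A = Matrix.vecMulVec (Pi.single i 1) (A i) := by
    ext a b
    by_cases ha : a = i
    · subst ha; simp [Matrix.vecMulVec_apply]
    · simp [Matrix.vecMulVec_apply, ha, h a ha]
  rw [e]
  exact Matrix.rank_vecMulVec_le _ _

open Classical in
-- A matrix is the sum of its single-entry parts, each of rank at most one. The count is written as
-- a sum of indicators so that it can be bounded and integrated entry by entry.
theorem rank_le_sum_entries (A : Matrix r s ℂ) :
    (A.rank : ℝ) ≤ ∑ i, ∑ j, if A i j = 0 then (0 : ℝ) else 1 := by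
  have h1 : A.rank ≤ ∑ i, ∑ j, if A i j = 0 then 0 else 1 := by
    conv_lhs => rw [Matrix.matrix_eq_sum_single A]
    refine (rank_sum_le _ _).trans (Finset.sum_le_sum fun i _ => ?_)
    refine (rank_sum_le _ _).trans (Finset.sum_le_sum fun j _ => ?_)
    split_ifs with h
    · simp [h]
    · refine rank_le_one_of_row i fun i' hi' => ?_
      ext b
      simp [hi'.symm]
  refine (Nat.cast_le.mpr h1).trans_eq ?_
  push_cast
  rfl

end RankBounds

/-! ### Random tuples: concentration and the cost of truncation -/

section RandomTuples

variable {m : ℕ} {d : Fin (m + 1) → ℕ} {Ω : Type*}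

/-- Arrange a vector indexed by the entries into a tuple of matrices. -/
def toTuple (x : EntryIdx d → ℂ) : MatTuple d := fun q => Matrix.of fun j k => x ⟨q, j, k⟩

theorem continuous_toTuple : Continuous (toTuple (d := d)) := by
  refine continuous_pi fun q => ?_
  refine continuous_pi fun j => ?_
  exact continuous_pi fun k => continuous_apply _

theorem measurable_trunc (c : ℝ) : Measurable (trunc c) :=
  Measurable.ite (measurableSet_le measurable_norm measurable_const) measurable_id measurable_const

theorem norm_trunc_le (c : ℝ) (x : ℂ) : ‖trunc c x‖ ≤ ‖x‖ := by
  unfold trunc; split_ifs <;> simp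

theorem norm_trunc_le_abs (c : ℝ) (x : ℂ) : ‖trunc c x‖ ≤ |c| := by
  unfold trunc
  split_ifs with h
  · exact h.trans (le_abs_self c)
  · simp

theorem norm_inv_sqrt_natCast (n : ℕ) : ‖((Real.sqrt n : ℝ) : ℂ)⁻¹‖ = (Real.sqrt n)⁻¹ := by
  rw [norm_inv, Complex.norm_real, Real.norm_of_nonneg (Real.sqrt_nonneg _)]

theorem exists_norm_matTuple_le {X : EntryArray d Ω} {D : ℝ} (hD : 0 ≤ D)
    (hX : ∀ q j k ω, ‖X q j k ω‖ ≤ D) : ∃ M, ∀ ω, ‖matTuple X ω‖ ≤ M := by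
  obtain ⟨E, hE0, hE⟩ : ∃ E : ℝ, 0 ≤ E ∧ ∀ q : Fin m, (Real.sqrt (d q.succ))⁻¹ ≤ E :=
    ⟨∑ q : Fin m, (Real.sqrt (d q.succ))⁻¹, by positivity, fun q =>
      Finset.single_le_sum (f := fun q : Fin m => (Real.sqrt (d q.succ))⁻¹)
        (fun q _ => by positivity) (Finset.mem_univ q)⟩
  refine ⟨E * D, fun ω => ?_⟩
  have h0 : 0 ≤ E * D := by positivity
  refine (pi_norm_le_iff_of_nonneg h0).2 fun q => ?_
  refine (pi_norm_le_iff_of_nonneg h0).2 fun j => ?_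
  refine (pi_norm_le_iff_of_nonneg h0).2 fun k => ?_
  change ‖((Real.sqrt (d q.succ) : ℝ) : ℂ)⁻¹ * X q j k ω‖ ≤ _
  rw [norm_mul, norm_inv_sqrt_natCast]
  exact mul_le_mul (hE q) (hX _ _ _ _) (norm_nonneg _) hE0

variable [MeasurableSpace Ω] {μ : Measure Ω}

theorem stronglyMeasurable_matTuple {X : EntryArray d Ω} (hX : ∀ q j k, Measurable (X q j k)) :
    StronglyMeasurable (matTuple X) := by
  have h : Measurable fun ω (i : EntryIdx d) =>
      ((Real.sqrt (d i.1.succ) : ℝ) : ℂ)⁻¹ * X i.1 i.2.1 i.2.2 ω :=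
    measurable_pi_lambda _ fun i => (hX _ _ _).const_mul _
  exact continuous_toTuple.comp_stronglyMeasurable h.stronglyMeasurable

/-- The expectation of `‖U‖²` over the event `‖U‖ > c`. -/
noncomputable def tailSq (μ : Measure Ω) (U : Ω → ℂ) (c : ℝ) : ℝ :=
  ∫ ω, {ω' | c < ‖U ω'‖}.indicator (fun ω' => ‖U ω'‖ ^ 2) ω ∂μ

theorem tailSq_nonneg (U : Ω → ℂ) (c : ℝ) : 0 ≤ tailSq μ U c :=
  integral_nonneg fun _ => Set.indicator_nonneg (fun _ _ => by positivity) _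

theorem integrable_indicator_sq {U : Ω → ℂ} (hU : Measurable U)
    (hi : Integrable (fun ω => ‖U ω‖ ^ 2) μ) (c : ℝ) :
    Integrable ({ω' | c < ‖U ω'‖}.indicator fun ω' => ‖U ω'‖ ^ 2) μ :=
  hi.indicator (measurableSet_lt measurable_const hU.norm)

variable {F : MatTuple d → OutMat d} {z : ℂ} {C : ℝ}

theorem integrable_stieltjes_comp [IsFiniteMeasure μ] (hF : ContDiff ℝ 3 F) (B : OutMat d)
    (hz : 0 < z.im) {Z : Ω → MatTuple d} (hZ : AEStronglyMeasurable Z μ) :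
    Integrable (fun ω => stieltjes F B z (Z ω)) μ := by
  obtain ⟨M, hM⟩ := exists_norm_stieltjes_le F B hz
  exact Integrable.of_bound ((contDiff_stieltjes hF B hz).continuous.comp_aestronglyMeasurable hZ) M
    (ae_of_all _ fun ω => hM _)

/-- Concentration of the Stieltjes transform: rows are independent and each has a small effect. -/
theorem integral_norm_stieltjes_sub_integral_le [IsProbabilityMeasure μ] {X : EntryArray d Ω}
    (hX : ∀ q j k, Measurable (X q j k))
    (hind : iIndepFun (fun i : EntryIdx d => X i.1 i.2.1 i.2.2) μ) (hF : ContDiff ℝ 3 F)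
    (B : OutMat d) (hz : 0 < z.im) (hC : 0 ≤ C)
    (hrank : ∀ P Q : MatTuple d, ((F P - F Q).rank : ℝ) ≤ C * ∑ q, ((P q - Q q).rank : ℝ)) :
    ∫ ω, ‖stieltjes F B z (matTuple X ω) - ∫ ω', stieltjes F B z (matTuple X ω') ∂μ‖ ∂μ
      ≤ 2 * (2 / (d 0 * z.im) * C * √(∑ q : Fin m, (d q.castSucc : ℝ))) := by
  -- The independent blocks are the rows of all the matrices. A row, like a single entry, costs rank
  -- one, but there are only `O(n)` rows against `O(n²)` entries; with differences of order `1/n`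
  -- only the former count makes the variance tend to zero.
  let ρ := (q : Fin m) × Fin (d q.castSucc)
  let R : (r : ρ) → Ω → Fin (d r.1.succ) → ℂ := fun r ω k => X r.1 r.2 k ω
  have hRm : ∀ r, Measurable (R r) := fun r => measurable_pi_lambda _ fun k => hX _ _ _
  have hRi : iIndepFun R μ := by
    refine iIndepFun_curry (X := fun (r : ρ) (k : Fin (d r.1.succ)) => X r.1 r.2 k)
      (fun r k => hX _ _ _) ?_
    refine hind.precomp (g := fun p : (r : ρ) × Fin (d r.1.succ) =>
      (⟨p.1.1, p.1.2, p.2⟩ : EntryIdx d)) ?_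
    rintro ⟨⟨q, j⟩, k⟩ ⟨⟨q', j'⟩, k'⟩ h
    simp only [Sigma.mk.injEq] at h
    obtain ⟨rfl, h⟩ := h
    simp only [heq_eq_eq, Prod.mk.injEq] at h
    obtain ⟨rfl, rfl⟩ := h
    rfl
  let T : ((r : ρ) → Fin (d r.1.succ) → ℂ) → MatTuple d := fun y q =>
    Matrix.of fun j k => ((Real.sqrt (d q.succ) : ℝ) : ℂ)⁻¹ * y ⟨q, j⟩ k
  have hT : Continuous T := by
    refine continuous_pi fun q => ?_
    refine continuous_pi fun j => ?_
    refine continuous_pi fun k => ?_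
    exact continuous_const.mul ((continuous_apply k).comp (continuous_apply (⟨q, j⟩ : ρ)))
  obtain ⟨M, hM⟩ := exists_norm_stieltjes_le F B hz
  have key := integral_norm_sub_integral_le_of_bounded_differences hRm hRi
    (f := fun y => stieltjes F B z (T y))
    ((contDiff_stieltjes hF B hz).continuous.comp hT).measurable (fun y => hM _)
    (c := 2 / (d 0 * z.im) * C) (by positivity) fun r x y h => by
      refine (norm_stieltjes_sub_le F B hz _ _).trans ?_
      gcongr
      refine (hrank _ _).trans ?_
      refine mul_le_of_le_one_right hC ?_
      have h1 : ∑ q, ((T x q - T y q).rank : ℝ) = ((T x r.1 - T y r.1).rank : ℝ) := by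
        refine Finset.sum_eq_single _ (fun q _ hq => ?_) (by simp)
        have : T x q - T y q = 0 := by
          ext j k
          have := h ⟨q, j⟩ (fun h' => hq (by rw [← h']))
          simp [T, this]
        rw [this]; simp
      rw [h1]
      have h2 : (T x r.1 - T y r.1).rank ≤ 1 := by
        refine rank_le_one_of_row r.2 fun j hj => ?_
        ext k
        have := h ⟨r.1, j⟩ (fun h' => hj (eq_of_heq (Sigma.mk.inj (h'.trans (Sigma.eta r).symm)).2))
        simp [T, this]
      exact_mod_cast h2
  have hcard : (Fintype.card ρ : ℝ) = ∑ q : Fin m, (d q.castSucc : ℝ) := by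
    rw [Fintype.card_sigma]; simp
  rw [hcard] at key
  exact key

open Classical in
/-- The effect of truncation on the expected Stieltjes transform. -/
theorem norm_integral_stieltjes_sub_trunc_le [IsProbabilityMeasure μ] {X : EntryArray d Ω}
    (hX : ∀ q j k, Measurable (X q j k)) (hX2 : ∀ q j k, Integrable (fun ω => ‖X q j k ω‖ ^ 2) μ)
    (hF : ContDiff ℝ 3 F) (B : OutMat d) (hz : 0 < z.im) (hC : 0 ≤ C)
    (hrank : ∀ P Q : MatTuple d, ((F P - F Q).rank : ℝ) ≤ C * ∑ q, ((P q - Q q).rank : ℝ))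
    {c : ℝ} (hc : 0 < c) :
    ‖∫ ω, stieltjes F B z (matTuple X ω) ∂μ
        - ∫ ω, stieltjes F B z (matTuple (fun q j k ω => trunc c (X q j k ω)) ω) ∂μ‖
      ≤ 2 / (d 0 * z.im) * C * (∑ q, ∑ j, ∑ k, tailSq μ (X q j k) c) / c ^ 2 := by
  have hXt : ∀ q j k, Measurable fun ω => trunc c (X q j k ω) := fun q j k =>
    (measurable_trunc c).comp (hX q j k)
  rw [← integral_sub
    (integrable_stieltjes_comp hF B hz (stronglyMeasurable_matTuple hX).aestronglyMeasurable)
    (integrable_stieltjes_comp hF B hz (stronglyMeasurable_matTuple hXt).aestronglyMeasurable)]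
  refine (norm_integral_le_integral_norm _).trans ?_
  have hi : ∀ q j k, Integrable ({ω' | c < ‖X q j k ω'‖}.indicator
      fun ω' => ‖X q j k ω'‖ ^ 2) μ := fun q j k => integrable_indicator_sq (hX _ _ _) (hX2 _ _ _) c
  -- Truncation alters an entry only where `‖X‖ > c`, and there `1 ≤ ‖X‖² / c²`: the number of
  -- altered entries bounds the rank of the change.
  have hpt : ∀ ω, ‖stieltjes F B z (matTuple X ω)
      - stieltjes F B z (matTuple (fun q j k ω => trunc c (X q j k ω)) ω)‖
      ≤ 2 / (d 0 * z.im) * C * (c ^ 2)⁻¹ * ∑ q, ∑ j, ∑ k,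
        {ω' | c < ‖X q j k ω'‖}.indicator (fun ω' => ‖X q j k ω'‖ ^ 2) ω := fun ω => by
    refine (norm_stieltjes_sub_le F B hz _ _).trans ?_
    rw [mul_assoc, mul_assoc]
    gcongr
    refine (hrank _ _).trans ?_
    gcongr
    rw [Finset.mul_sum]
    refine Finset.sum_le_sum fun q _ => (rank_le_sum_entries _).trans ?_
    rw [Finset.mul_sum]
    refine Finset.sum_le_sum fun j _ => ?_
    rw [Finset.mul_sum]
    refine Finset.sum_le_sum fun k _ => ?_
    by_cases h : c < ‖X q j k ω‖
    · rw [Set.indicator_of_mem (by exact h)]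
      refine le_trans (b := 1) (by split_ifs <;> norm_num) ?_
      rw [inv_mul_eq_div, le_div_iff₀ (by positivity), one_mul]
      gcongr
    · rw [Set.indicator_of_notMem (by exact h), mul_zero, if_pos]
      simp [matTuple, trunc, not_lt.1 h]
  have hI : Integrable (fun ω => ∑ q, ∑ j, ∑ k,
        {ω' | c < ‖X q j k ω'‖}.indicator (fun ω' => ‖X q j k ω'‖ ^ 2) ω) μ :=
    integrable_finsetSum _ fun q _ => integrable_finsetSum _ fun j _ =>
      integrable_finsetSum _ fun k _ => hi q j k
  refine (integral_mono_of_nonneg (ae_of_all _ fun ω => norm_nonneg _) (hI.const_mul _)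
    (ae_of_all _ hpt)).trans_eq ?_
  have hsum : ∫ ω, ∑ q, ∑ j, ∑ k,
      {ω' | c < ‖X q j k ω'‖}.indicator (fun ω' => ‖X q j k ω'‖ ^ 2) ω ∂μ
      = ∑ q, ∑ j, ∑ k, tailSq μ (X q j k) c := by
    rw [integral_finsetSum]
    · refine Finset.sum_congr rfl fun q _ => ?_
      rw [integral_finsetSum]
      · refine Finset.sum_congr rfl fun j _ => ?_
        rw [integral_finsetSum]
        · rfl
        · exact fun k _ => hi q j k
      · exact fun j _ => integrable_finsetSum _ fun k _ => hi q j k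
    · exact fun q _ => integrable_finsetSum _ fun j _ => integrable_finsetSum _ fun k _ => hi q j k
  rw [integral_const_mul, hsum]
  ring

end RandomTuples

end SVUniversality

namespace SVUniversality

/-! ### Moments of a truncated variable and its truncated Gaussian match -/

section Moments

variable {Ω : Type*} [MeasurableSpace Ω] {μ : Measure Ω} [IsProbabilityMeasure μ] {U W : Ω → ℂ}
  {c : ℝ} {p r : ℂ →L[ℝ] ℝ}

omit [IsProbabilityMeasure μ] in
theorem memLp_two_of_integrable_sq (hU : Measurable U) (h2 : Integrable (fun ω => ‖U ω‖ ^ 2) μ) :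
    MemLp U 2 μ :=
  (memLp_two_iff_integrable_sq_norm hU.aestronglyMeasurable).2 h2

theorem integrable_clm_trunc (hU : Measurable U) (p : ℂ →L[ℝ] ℝ) (c : ℝ) :
    Integrable (fun ω => p (trunc c (U ω))) μ :=
  Integrable.of_bound (p.continuous.measurable.comp
    ((measurable_trunc c).comp hU)).aestronglyMeasurable (‖p‖ * |c|) (ae_of_all _ fun ω =>
      (p.le_opNorm _).trans (by gcongr; exact norm_trunc_le_abs _ _))

theorem integrable_clm_trunc_mul (hU : Measurable U) (hW : Measurable W) (p r : ℂ →L[ℝ] ℝ)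
    (c : ℝ) : Integrable (fun ω => p (trunc c (U ω)) * r (trunc c (W ω))) μ :=
  (integrable_clm_trunc hW r c).bdd_mul (c := ‖p‖ * |c|) (integrable_clm_trunc (μ := μ) hU p c).1
    (ae_of_all _ fun ω => (p.le_opNorm _).trans (by gcongr; exact norm_trunc_le_abs _ _))

/-- Since `U` is centred, the truncated mean is minus the mean of the discarded part, where `‖U‖ ≤
‖U‖² / c`. -/
theorem abs_integral_trunc_le (hU : Measurable U) (h2 : Integrable (fun ω => ‖U ω‖ ^ 2) μ)
    (h0 : ∫ ω, U ω ∂μ = 0) (hp : ∀ x, |p x| ≤ ‖x‖) (hc : 0 < c) :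
    |∫ ω, p (trunc c (U ω)) ∂μ| ≤ tailSq μ U c / c := by
  have hUi : Integrable U μ := (memLp_two_of_integrable_sq hU h2).integrable one_le_two
  have hpU : Integrable (fun ω => p (U ω)) μ := p.integrable_comp hUi
  have hz : ∫ ω, p (U ω) ∂μ = 0 := by rw [p.integral_comp_comm hUi, h0, map_zero]
  rw [← sub_zero (∫ ω, p (trunc c (U ω)) ∂μ), ← hz,
    ← integral_sub (integrable_clm_trunc hU p c) hpU, ← Real.norm_eq_abs]
  refine (norm_integral_le_integral_norm _).trans ?_
  unfold tailSq
  rw [← integral_div]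
  refine integral_mono_of_nonneg (ae_of_all _ fun ω => norm_nonneg _)
    ((integrable_indicator_sq hU h2 c).div_const c) (ae_of_all _ fun ω => ?_)
  simp only
  by_cases h : c < ‖U ω‖
  · rw [Set.indicator_of_mem (by exact h), trunc, if_neg (not_le.2 h), map_zero, zero_sub, norm_neg,
      le_div_iff₀ hc]
    have := hp (U ω)
    rw [Real.norm_eq_abs]
    nlinarith [norm_nonneg (U ω), abs_nonneg (p (U ω))]
  · rw [Set.indicator_of_notMem (by exact h), trunc, if_pos (not_lt.1 h)]
    simp

theorem abs_integral_trunc_le_one (h2 : Integrable (fun ω => ‖U ω‖ ^ 2) μ)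
    (h1 : ∫ ω, ‖U ω‖ ^ 2 ∂μ = 1) (hp : ∀ x, |p x| ≤ ‖x‖) :
    |∫ ω, p (trunc c (U ω)) ∂μ| ≤ 1 := by
  rw [← Real.norm_eq_abs]
  refine (norm_integral_le_integral_norm _).trans ?_
  have hi : Integrable (fun ω => (1 + ‖U ω‖ ^ 2) / 2) μ := ((integrable_const _).add h2).div_const 2
  refine (integral_mono_of_nonneg (ae_of_all _ fun ω => norm_nonneg _) hi
    (ae_of_all _ fun ω => ?_)).trans_eq ?_
  · have h := (hp (trunc c (U ω))).trans (norm_trunc_le c (U ω))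
    rw [← Real.norm_eq_abs] at h
    simp only
    nlinarith [sq_nonneg (1 - ‖U ω‖)]
  · rw [integral_div, integral_add (integrable_const _) h2, h1]
    simp

theorem abs_integral_trunc_mul_sub_le (hU : Measurable U)
    (h2 : Integrable (fun ω => ‖U ω‖ ^ 2) μ) (hp : ∀ x, |p x| ≤ ‖x‖) (hr : ∀ x, |r x| ≤ ‖x‖) :
    |∫ ω, p (trunc c (U ω)) * r (trunc c (U ω)) ∂μ - ∫ ω, p (U ω) * r (U ω) ∂μ|
      ≤ tailSq μ U c := by
  have hL := memLp_two_of_integrable_sq hU h2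
  have hprod : Integrable (fun ω => p (U ω) * r (U ω)) μ :=
    MemLp.integrable_mul (p := 2) (q := 2) (p.comp_memLp' hL) (r.comp_memLp' hL)
  rw [← integral_sub (integrable_clm_trunc_mul hU hU p r c) hprod, ← Real.norm_eq_abs]
  refine (norm_integral_le_integral_norm _).trans ?_
  refine integral_mono_of_nonneg (ae_of_all _ fun ω => norm_nonneg _)
    (integrable_indicator_sq hU h2 c) (ae_of_all _ fun ω => ?_)
  simp only
  by_cases h : c < ‖U ω‖
  · rw [Set.indicator_of_mem (by exact h), trunc, if_neg (not_le.2 h), map_zero, zero_mul, zero_sub,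
      norm_neg, norm_mul, sq]
    exact mul_le_mul (hp _) (hr _) (norm_nonneg _) (norm_nonneg _)
  · rw [Set.indicator_of_notMem (by exact h), trunc, if_pos (not_lt.1 h)]
    simp

/-- Two independent variables, the first centred with unit variance, the second Gaussian with
matching moments. -/
structure MatchedPair (μ : Measure Ω) (U W : Ω → ℂ) : Prop where
  measurable_left : Measurable U
  measurable_right : Measurable W
  indep : IndepFun U W μ
  mean_left : ∫ ω, U ω ∂μ = 0
  sq_left : ∫ ω, ‖U ω‖ ^ 2 ∂μ = 1
  gauss : IsGaussianMatch μ U W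

namespace MatchedPair

variable (h : MatchedPair μ U W)
include h

omit [IsProbabilityMeasure μ] in
-- A non-integrable function has integral `0` by convention, so the value `1` already forces square
-- integrability.
theorem integrable_sq_left : Integrable (fun ω => ‖U ω‖ ^ 2) μ := by
  by_contra hn
  have := h.sq_left
  rw [integral_undef hn] at this
  exact zero_ne_one this

omit [IsProbabilityMeasure μ] in
theorem memLp_left : MemLp U 2 μ := memLp_two_of_integrable_sq h.measurable_left h.integrable_sq_left

omit [IsProbabilityMeasure μ] in
theorem memLp_right : MemLp W 2 μ := h.gauss.gaussian.memLp_two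

omit [IsProbabilityMeasure μ] in
theorem integrable_sq_right : Integrable (fun ω => ‖W ω‖ ^ 2) μ :=
  (memLp_two_iff_integrable_sq_norm h.measurable_right.aestronglyMeasurable).1 h.memLp_right

theorem mean_re_right : ∫ ω, (W ω).re ∂μ = 0 := by
  rw [h.gauss.mean_re]
  have := integral_re (h.memLp_left.integrable one_le_two)
  rw [h.mean_left] at this
  simpa using this

theorem mean_im_right : ∫ ω, (W ω).im ∂μ = 0 := by
  rw [h.gauss.mean_im]
  have := integral_im (h.memLp_left.integrable one_le_two)
  rw [h.mean_left] at this
  simpa using this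

theorem mean_right : ∫ ω, W ω ∂μ = 0 := by
  have hi := h.memLp_right.integrable one_le_two
  apply Complex.ext
  · exact (integral_re hi).symm.trans h.mean_re_right
  · exact (integral_im hi).symm.trans h.mean_im_right

omit [IsProbabilityMeasure μ] in
theorem sq_re_add_sq_im_left : ∫ ω, (U ω).re ^ 2 ∂μ + ∫ ω, (U ω).im ^ 2 ∂μ = 1 := by
  have i1 : Integrable (fun ω => (U ω).re ^ 2) μ := h.memLp_left.re.integrable_sq
  have i2 : Integrable (fun ω => (U ω).im ^ 2) μ := h.memLp_left.im.integrable_sq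
  rw [← h.sq_left, ← integral_add i1 i2]
  simp only [Complex.sq_norm, Complex.normSq_apply]
  simp only [sq]

omit [IsProbabilityMeasure μ] in
theorem sq_right : ∫ ω, ‖W ω‖ ^ 2 ∂μ = 1 := by
  have i1 : Integrable (fun ω => (W ω).re ^ 2) μ := h.memLp_right.re.integrable_sq
  have i2 : Integrable (fun ω => (W ω).im ^ 2) μ := h.memLp_right.im.integrable_sq
  rw [← h.sq_re_add_sq_im_left, ← h.gauss.sq_re, ← h.gauss.sq_im, ← integral_add i1 i2]
  simp only [Complex.sq_norm, Complex.normSq_apply]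
  simp only [sq]

omit [IsProbabilityMeasure μ] in
theorem integral_mul_eq (hp : p = Complex.reCLM ∨ p = Complex.imCLM)
    (hr : r = Complex.reCLM ∨ r = Complex.imCLM) :
    ∫ ω, p (W ω) * r (W ω) ∂μ = ∫ ω, p (U ω) * r (U ω) ∂μ := by
  rcases hp with rfl | rfl <;> rcases hr with rfl | rfl
  · simpa [sq] using h.gauss.sq_re
  · simpa using h.gauss.re_mul_im
  · simpa [mul_comm] using h.gauss.re_mul_im
  · simpa [sq] using h.gauss.sq_im

/-- On the tail `‖W‖² ≤ ‖W‖⁸ / c⁶`, and convexity gives `‖W‖⁸ ≤ 8 (Re⁸ + Im⁸)`. The constant is `8 ·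
2 · 80640`. -/
theorem tailSq_right_le (hc : 0 < c) :
    tailSq μ W c ≤ 1290240 * Real.exp 1 / c ^ 6 := by
  have h1 : ∫ ω, (W ω).re ^ 2 ∂μ ≤ 1 := by
    rw [h.gauss.sq_re, ← h.sq_re_add_sq_im_left]
    linarith [integral_nonneg (μ := μ) (f := fun ω => (U ω).im ^ 2) fun ω => sq_nonneg _]
  have h2 : ∫ ω, (W ω).im ^ 2 ∂μ ≤ 1 := by
    rw [h.gauss.sq_im, ← h.sq_re_add_sq_im_left]
    linarith [integral_nonneg (μ := μ) (f := fun ω => (U ω).re ^ 2) fun ω => sq_nonneg _]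
  have hr := (h.gauss.gaussian.map_fun Complex.reCLM).integral_pow_eight_le h.mean_re_right h1
  have hi := (h.gauss.gaussian.map_fun Complex.imCLM).integral_pow_eight_le h.mean_im_right h2
  simp only [Complex.reCLM_apply, Complex.imCLM_apply] at hr hi
  have hI : Integrable (fun ω => 8 * ((W ω).re ^ 8 + (W ω).im ^ 8) / c ^ 6) μ :=
    ((hr.1.add hi.1).const_mul 8).div_const _
  have hb : ∀ x : ℂ, ‖x‖ ^ 8 ≤ 8 * (x.re ^ 8 + x.im ^ 8) := fun x => by
    have e : ‖x‖ ^ 8 = (x.re ^ 2 + x.im ^ 2) ^ 4 := by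
      rw [show ‖x‖ ^ 8 = (‖x‖ ^ 2) ^ 4 by ring, Complex.sq_norm, Complex.normSq_apply]; ring
    have h4 := add_pow_le (sq_nonneg x.re) (sq_nonneg x.im) 4
    rw [e]
    exact h4.trans_eq (by ring)
  unfold tailSq
  refine (integral_mono_of_nonneg (ae_of_all _ fun ω =>
    Set.indicator_nonneg (fun _ _ => by positivity) _) hI (ae_of_all _ fun ω => ?_)).trans ?_
  · simp only
    by_cases hcw : c < ‖W ω‖
    · rw [Set.indicator_of_mem (by exact hcw), le_div_iff₀ (by positivity)]
      refine le_trans ?_ (hb _)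
      calc ‖W ω‖ ^ 2 * c ^ 6 ≤ ‖W ω‖ ^ 2 * ‖W ω‖ ^ 6 := by gcongr
        _ = _ := by ring
    · rw [Set.indicator_of_notMem (by exact hcw)]
      positivity
  · rw [integral_div, integral_const_mul, integral_add hr.1 hi.1]
    refine div_le_div_of_nonneg_right ?_ (by positivity)
    linarith [hr.2, hi.2]

theorem abs_integral_velocity_le (hp : ∀ x, |p x| ≤ ‖x‖) (hc : 0 < c) (φ : ℝ) :
    |∫ ω, (-p (trunc c (U ω)) * Real.sin φ + p (trunc c (W ω)) * Real.cos φ) ∂μ|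
      ≤ (tailSq μ U c + tailSq μ W c) / c := by
  have hU := integrable_clm_trunc (μ := μ) h.measurable_left p c
  have hW := integrable_clm_trunc (μ := μ) h.measurable_right p c
  have e : ∫ ω, (-p (trunc c (U ω)) * Real.sin φ + p (trunc c (W ω)) * Real.cos φ) ∂μ
      = -(∫ ω, p (trunc c (U ω)) ∂μ) * Real.sin φ
        + (∫ ω, p (trunc c (W ω)) ∂μ) * Real.cos φ := by
    have hUn : Integrable (fun ω => -p (trunc c (U ω))) μ := hU.neg
    rw [integral_add (hUn.mul_const _) (hW.mul_const _), integral_mul_const, integral_mul_const,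
      integral_neg]
  rw [e, add_div]
  refine (abs_add_le _ _).trans ?_
  rw [abs_mul, abs_mul, abs_neg]
  have h1 := abs_integral_trunc_le h.measurable_left h.integrable_sq_left h.mean_left hp hc
  have h2 := abs_integral_trunc_le h.measurable_right h.integrable_sq_right h.mean_right hp hc
  exact add_le_add (mul_le_of_le_one_right (abs_nonneg _) (Real.abs_sin_le_one φ) |>.trans h1)
    (mul_le_of_le_one_right (abs_nonneg _) (Real.abs_cos_le_one φ) |>.trans h2)

/-- The second-moment cancellation. Of the four products, the two pure ones combine to the
difference of the truncated covariances of `W` and `U`, times `sin φ cos φ`; without truncation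
these covariances agree. The two mixed ones factor by independence into a mean of tail size and a
mean at most `1`. The condition `1 ≤ c` lets the bounds `tail / c` be replaced by `tail`. -/
theorem abs_integral_velocity_mul_position_le (hp : p = Complex.reCLM ∨ p = Complex.imCLM)
    (hr : r = Complex.reCLM ∨ r = Complex.imCLM) (hc : 1 ≤ c) (φ : ℝ) :
    |∫ ω, (-p (trunc c (U ω)) * Real.sin φ + p (trunc c (W ω)) * Real.cos φ)
        * (r (trunc c (U ω)) * Real.cos φ + r (trunc c (W ω)) * Real.sin φ) ∂μ|
      ≤ 2 * (tailSq μ U c + tailSq μ W c) := by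
  have hc0 : 0 < c := by linarith
  have hp' : ∀ x, |p x| ≤ ‖x‖ := by
    rcases hp with rfl | rfl
    · exact Complex.abs_re_le_norm
    · exact Complex.abs_im_le_norm
  have hr' : ∀ x, |r x| ≤ ‖x‖ := by
    rcases hr with rfl | rfl
    · exact Complex.abs_re_le_norm
    · exact Complex.abs_im_le_norm
  have mU := h.measurable_left
  have mW := h.measurable_right
  have i1 := integrable_clm_trunc_mul (μ := μ) mU mU p r c
  have i2 := integrable_clm_trunc_mul (μ := μ) mU mW p r c
  have i3 := integrable_clm_trunc_mul (μ := μ) mW mU p r c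
  have i4 := integrable_clm_trunc_mul (μ := μ) mW mW p r c
  have mpt : Measurable fun x => p (trunc c x) := p.continuous.measurable.comp (measurable_trunc c)
  have mrt : Measurable fun x => r (trunc c x) := r.continuous.measurable.comp (measurable_trunc c)
  have ind1 : ∫ ω, p (trunc c (U ω)) * r (trunc c (W ω)) ∂μ
      = (∫ ω, p (trunc c (U ω)) ∂μ) * ∫ ω, r (trunc c (W ω)) ∂μ :=
    (h.indep.comp mpt mrt).integral_mul_eq_mul_integral (mpt.comp mU).aestronglyMeasurable
      (mrt.comp mW).aestronglyMeasurable
  have ind2 : ∫ ω, p (trunc c (W ω)) * r (trunc c (U ω)) ∂μ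
      = (∫ ω, p (trunc c (W ω)) ∂μ) * ∫ ω, r (trunc c (U ω)) ∂μ :=
    (h.indep.symm.comp mpt mrt).integral_mul_eq_mul_integral (mpt.comp mW).aestronglyMeasurable
      (mrt.comp mU).aestronglyMeasurable
  have e : ∫ ω, (-p (trunc c (U ω)) * Real.sin φ + p (trunc c (W ω)) * Real.cos φ)
        * (r (trunc c (U ω)) * Real.cos φ + r (trunc c (W ω)) * Real.sin φ) ∂μ
      = (∫ ω, p (trunc c (W ω)) * r (trunc c (W ω)) ∂μ
          - ∫ ω, p (trunc c (U ω)) * r (trunc c (U ω)) ∂μ) * (Real.sin φ * Real.cos φ)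
        + ((∫ ω, p (trunc c (W ω)) * r (trunc c (U ω)) ∂μ) * Real.cos φ ^ 2
          - (∫ ω, p (trunc c (U ω)) * r (trunc c (W ω)) ∂μ) * Real.sin φ ^ 2) := by
    have j1 : Integrable (fun ω => (p (trunc c (W ω)) * r (trunc c (W ω))
        - p (trunc c (U ω)) * r (trunc c (U ω))) * (Real.sin φ * Real.cos φ)) μ :=
      (i4.sub i1).mul_const _
    have j2 : Integrable (fun ω => p (trunc c (W ω)) * r (trunc c (U ω)) * Real.cos φ ^ 2
        - p (trunc c (U ω)) * r (trunc c (W ω)) * Real.sin φ ^ 2) μ :=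
      (i3.mul_const _).sub (i2.mul_const _)
    rw [← integral_sub i4 i1, ← integral_mul_const, ← integral_mul_const, ← integral_mul_const,
      ← integral_sub (i3.mul_const _) (i2.mul_const _), ← integral_add j1 j2]
    congr 1
    ext ω
    ring
  have hU := h.integrable_sq_left
  have hW := h.integrable_sq_right
  have a1 := abs_integral_trunc_mul_sub_le (c := c) mU hU hp' hr'
  have a2 := abs_integral_trunc_mul_sub_le (c := c) mW hW hp' hr'
  rw [h.integral_mul_eq hp hr] at a2
  have b1 := abs_integral_trunc_le mU hU h.mean_left hp' hc0
  have b2 := abs_integral_trunc_le mW hW h.mean_right hp' hc0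
  have b3 := abs_integral_trunc_le_one (c := c) hW h.sq_right hr'
  have b4 := abs_integral_trunc_le_one (c := c) hU h.sq_left hr'
  rw [e, ind1, ind2]
  have tU := tailSq_nonneg (μ := μ) U c
  have tW := tailSq_nonneg (μ := μ) W c
  have d1 : tailSq μ U c / c ≤ tailSq μ U c := div_le_self tU hc
  have d2 : tailSq μ W c / c ≤ tailSq μ W c := div_le_self tW hc
  have s1 : |Real.sin φ * Real.cos φ| ≤ 1 := by
    rw [abs_mul]
    exact mul_le_one₀ (Real.abs_sin_le_one φ) (abs_nonneg _) (Real.abs_cos_le_one φ)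
  have s2 : |Real.cos φ ^ 2| ≤ 1 := by
    rw [abs_of_nonneg (sq_nonneg _)]; exact Real.cos_sq_le_one φ
  have s3 : |Real.sin φ ^ 2| ≤ 1 := by
    rw [abs_of_nonneg (sq_nonneg _)]; exact Real.sin_sq_le_one φ
  have t1 : |(∫ ω, p (trunc c (W ω)) * r (trunc c (W ω)) ∂μ
          - ∫ ω, p (trunc c (U ω)) * r (trunc c (U ω)) ∂μ) * (Real.sin φ * Real.cos φ)|
      ≤ tailSq μ U c + tailSq μ W c := by
    rw [abs_mul]
    refine (mul_le_of_le_one_right (abs_nonneg _) s1).trans ?_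
    rw [abs_le] at a1 a2 ⊢
    constructor <;> linarith [a1.1, a1.2, a2.1, a2.2]
  have t2 : |(∫ ω, p (trunc c (W ω)) ∂μ) * (∫ ω, r (trunc c (U ω)) ∂μ) * Real.cos φ ^ 2|
      ≤ tailSq μ W c := by
    rw [abs_mul, abs_mul]
    refine (mul_le_of_le_one_right (by positivity) s2).trans ?_
    exact (mul_le_of_le_one_right (abs_nonneg _) b4).trans (b2.trans d2)
  have t3 : |(∫ ω, p (trunc c (U ω)) ∂μ) * (∫ ω, r (trunc c (W ω)) ∂μ) * Real.sin φ ^ 2|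
      ≤ tailSq μ U c := by
    rw [abs_mul, abs_mul]
    refine (mul_le_of_le_one_right (by positivity) s3).trans ?_
    exact (mul_le_of_le_one_right (abs_nonneg _) b3).trans (b1.trans d1)
  refine (abs_add_le _ _).trans ?_
  have := abs_sub ((∫ ω, p (trunc c (W ω)) ∂μ) * (∫ ω, r (trunc c (U ω)) ∂μ) * Real.cos φ ^ 2)
    ((∫ ω, p (trunc c (U ω)) ∂μ) * (∫ ω, r (trunc c (W ω)) ∂μ) * Real.sin φ ^ 2)
  linarith

omit [IsProbabilityMeasure μ] in
-- One factor is bounded by `2c` and the remaining square by twice the sum of the squares, whose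
-- means are `1` each. Only one power of `c` is lost, which is what makes the Taylor remainder
-- negligible.
theorem integral_cube_le (hc : 0 ≤ c) :
    ∫ ω, (‖trunc c (U ω)‖ + ‖trunc c (W ω)‖) ^ 3 ∂μ ≤ 8 * c := by
  have hI : Integrable (fun ω => 4 * c * (‖U ω‖ ^ 2 + ‖W ω‖ ^ 2)) μ :=
    (h.integrable_sq_left.add h.integrable_sq_right).const_mul _
  refine (integral_mono_of_nonneg (ae_of_all _ fun ω => by positivity) hI
    (ae_of_all _ fun ω => ?_)).trans_eq ?_
  · simp only
    have h1 := norm_trunc_le c (U ω)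
    have h2 := norm_trunc_le c (W ω)
    have h3 := norm_trunc_le_abs c (U ω)
    have h4 := norm_trunc_le_abs c (W ω)
    rw [abs_of_nonneg hc] at h3 h4
    set x := ‖trunc c (U ω)‖
    set y := ‖trunc c (W ω)‖
    have hx : 0 ≤ x := norm_nonneg _
    have hy : 0 ≤ y := norm_nonneg _
    have h5 : x ^ 2 ≤ ‖U ω‖ ^ 2 := by gcongr
    have h6 : y ^ 2 ≤ ‖W ω‖ ^ 2 := by gcongr
    calc (x + y) ^ 3 = (x + y) * (x + y) ^ 2 := by ring
      _ ≤ (2 * c) * (2 * (x ^ 2 + y ^ 2)) := by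
          gcongr
          · linarith
          · nlinarith [sq_nonneg (x - y)]
      _ ≤ 4 * c * (‖U ω‖ ^ 2 + ‖W ω‖ ^ 2) := by nlinarith
  · rw [integral_const_mul, integral_add h.integrable_sq_left h.integrable_sq_right, h.sq_left,
      h.sq_right]
    ring

end MatchedPair

end Moments

end SVUniversality

namespace SVUniversality

/-! ### Taylor expansion in a single entry -/

section EntryEstimate

variable {m : ℕ} {d : Fin (m + 1) → ℕ} {Ω : Type*} [MeasurableSpace Ω] {μ : Measure Ω}
  [IsProbabilityMeasure μ]

omit [MeasurableSpace Ω] [IsProbabilityMeasure μ] in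
-- Since `w` is `𝓕`-measurable it can be pulled out: `E[w G] = E[w E[G | 𝓕]]`. Thus no pointwise
-- bound on `G` enters the estimate.
theorem norm_integral_smul_le_of_norm_condExp_le {𝓕 mΩ : MeasurableSpace Ω} {μ : Measure Ω}
    [IsProbabilityMeasure μ] (hle : 𝓕 ≤ mΩ) {G : Ω → ℂ} {A : ℝ} (h : ∀ᵐ ω ∂μ, ‖(μ[G | 𝓕]) ω‖ ≤ A)
    (hG : Integrable G μ) {w : Ω → ℝ} (hw : StronglyMeasurable[𝓕] w) {D : ℝ}
    (hD : ∀ ω, |w ω| ≤ D) : ‖∫ ω, w ω • G ω ∂μ‖ ≤ A * ∫ ω, |w ω| ∂μ := by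
  have hw' : AEStronglyMeasurable w μ := (hw.mono hle).aestronglyMeasurable
  have hwi : Integrable w μ := Integrable.of_bound hw' D (ae_of_all _ hD)
  have hwG : Integrable (w • G) μ := hG.bdd_smul D hw' (ae_of_all _ hD)
  have hpull := condExp_smul_of_aestronglyMeasurable_left hw.aestronglyMeasurable hwG hG
  have e : ∫ ω, w ω • G ω ∂μ = ∫ ω, w ω • (μ[G | 𝓕]) ω ∂μ :=
    (integral_condExp hle (f := w • G)).symm.trans (integral_congr_ae hpull)
  rw [e, ← integral_const_mul]
  refine (norm_integral_le_integral_norm _).trans ?_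
  refine integral_mono_of_nonneg (ae_of_all _ fun ω => norm_nonneg _) (hwi.abs.const_mul A) ?_
  filter_upwards [h] with ω hω
  rw [norm_smul, Real.norm_eq_abs, mul_comm]
  gcongr

theorem CondExpBound.norm_integral_smul_le {U W G : Ω → ℂ} {A : ℝ} (h : CondExpBound μ U W G A)
    (hU : Measurable U) (hW : Measurable W) (hG : Integrable G μ) {w : ℂ × ℂ → ℝ}
    (hw : Measurable w) {D : ℝ} (hD : ∀ x, |w x| ≤ D) :
    ‖∫ ω, w (U ω, W ω) • G ω ∂μ‖ ≤ A * ∫ ω, |w (U ω, W ω)| ∂μ :=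
  norm_integral_smul_le_of_norm_condExp_le (hU.prodMk hW).comap_le h hG
    (hw.comp (comap_measurable fun ω => (U ω, W ω))).stronglyMeasurable fun _ => hD _

theorem stronglyMeasurable_interp {X Y : EntryArray d Ω} (hX : ∀ q j k, Measurable (X q j k))
    (hY : ∀ q j k, Measurable (Y q j k)) (c φ : ℝ) : StronglyMeasurable (interp X Y c φ) :=
  stronglyMeasurable_matTuple fun q j k =>
    (((measurable_trunc c).comp (hX q j k)).mul_const _).add
      (((measurable_trunc c).comp (hY q j k)).mul_const _)

omit [MeasurableSpace Ω] in
theorem norm_trunc_combination_le (c φ : ℝ) (x y : ℂ) :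
    ‖trunc c x * (Real.cos φ : ℂ) + trunc c y * (Real.sin φ : ℂ)‖ ≤ ‖trunc c x‖ + ‖trunc c y‖ := by
  refine (norm_add_le _ _).trans ?_
  rw [norm_mul, norm_mul, Complex.norm_real, Complex.norm_real]
  exact add_le_add (mul_le_of_le_one_right (norm_nonneg _) (Real.abs_cos_le_one φ))
    (mul_le_of_le_one_right (norm_nonneg _) (Real.abs_sin_le_one φ))

omit [MeasurableSpace Ω] in
theorem exists_norm_interp_le (X Y : EntryArray d Ω) (c φ : ℝ) :
    ∃ M, ∀ ω, ‖interp X Y c φ ω‖ ≤ M := by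
  refine exists_norm_matTuple_le (D := |c| + |c|) (by positivity) fun q j k ω => ?_
  exact (norm_trunc_combination_le _ _ _ _).trans
    (add_le_add (norm_trunc_le_abs _ _) (norm_trunc_le_abs _ _))

/-- The entry of the interpolation as a function of the pair of variables at that position. -/
noncomputable def position (n : ℕ) (c φ : ℝ) (x : ℂ × ℂ) : ℂ :=
  ((Real.sqrt n : ℝ) : ℂ)⁻¹ * (trunc c x.1 * (Real.cos φ : ℂ) + trunc c x.2 * (Real.sin φ : ℂ))

theorem measurable_position (n : ℕ) (c φ : ℝ) : Measurable (position n c φ) :=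
  ((((measurable_trunc c).comp measurable_fst).mul_const _).add
    (((measurable_trunc c).comp measurable_snd).mul_const _)).const_mul _

theorem norm_position_le (n : ℕ) (c φ : ℝ) (x : ℂ × ℂ) :
    ‖position n c φ x‖ ≤ (Real.sqrt n)⁻¹ * (‖trunc c x.1‖ + ‖trunc c x.2‖) := by
  rw [position, norm_mul, norm_inv_sqrt_natCast]
  gcongr
  exact norm_trunc_combination_le _ _ _ _

theorem norm_position_le_const (n : ℕ) (c φ : ℝ) (x : ℂ × ℂ) :
    ‖position n c φ x‖ ≤ (Real.sqrt n)⁻¹ * (|c| + |c|) :=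
  (norm_position_le n c φ x).trans (by gcongr <;> exact norm_trunc_le_abs _ _)

omit [IsProbabilityMeasure μ] in
-- At `θ = 0` the entry is erased, so the tuple is a function of the variables at the other
-- positions only.
theorem IsEntryModel.indepFun_interpScaled_zero {X Y : EntryArray d Ω} (h : IsEntryModel μ X Y)
    (c φ : ℝ) (q : Fin m) (j : Fin (d q.castSucc)) (k : Fin (d q.succ)) {H : MatTuple d → ℂ}
    (hH : Continuous H) :
    IndepFun (fun ω => (X q j k ω, Y q j k ω)) (fun ω => H (interpScaled X Y c φ 0 q j k ω)) μ := by
  classical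
  set I : EntryIdx d := ⟨q, j, k⟩ with hI
  let J := Sum.elim (fun i : EntryIdx d => X i.1 i.2.1 i.2.2) (fun i : EntryIdx d => Y i.1 i.2.1 i.2.2)
  have hJ : ∀ s, Measurable (J s) := by
    rintro (i | i)
    · exact h.measurable_X _ _ _
    · exact h.measurable_Y _ _ _
  let S : Finset (EntryIdx d ⊕ EntryIdx d) := {Sum.inl I, Sum.inr I}
  have hind := h.indep.indepFun_finset S Sᶜ disjoint_compl_right hJ
  -- The construction is replayed with coordinate functions in place of the random variables, to
  -- exhibit the tuple as a measurable function of the variables outside `S`. The value `0` filled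
  -- in on `S` is irrelevant, because the entry there is erased.
  let X' : EntryArray d (EntryIdx d ⊕ EntryIdx d → ℂ) := fun q j k x => x (Sum.inl ⟨q, j, k⟩)
  let Y' : EntryArray d (EntryIdx d ⊕ EntryIdx d → ℂ) := fun q j k x => x (Sum.inr ⟨q, j, k⟩)
  let ext : ((Sᶜ : Finset (EntryIdx d ⊕ EntryIdx d)) → ℂ) → EntryIdx d ⊕ EntryIdx d → ℂ :=
    fun y s => if hs : s ∈ Sᶜ then y ⟨s, hs⟩ else 0
  have hext : Measurable ext := by
    refine measurable_pi_lambda _ fun s => ?_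
    by_cases hs : s ∈ Sᶜ
    · simp only [ext, hs, dif_pos]
      exact measurable_pi_apply _
    · simp only [ext, hs, dif_neg, not_false_iff]
      exact measurable_const
  have hmeas : Measurable fun x => H (interpScaled X' Y' c φ 0 q j k x) := by
    have hs : StronglyMeasurable (interp X' Y' c φ) :=
      stronglyMeasurable_interp (fun _ _ _ => measurable_pi_apply _)
        (fun _ _ _ => measurable_pi_apply _) c φ
    have hc : Continuous fun Z : MatTuple d => H (setEntry Z q j k (((0 : ℝ) : ℂ) * Z q j k)) :=
      hH.comp ((continuous_setEntry_mul q j k).comp (Continuous.prodMk_right (0 : ℝ)))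
    exact (hc.comp_stronglyMeasurable hs).measurable
  have hpair : Measurable fun y : (S → ℂ) =>
      (y ⟨Sum.inl I, by simp [S]⟩, y ⟨Sum.inr I, by simp [S]⟩) :=
    (measurable_pi_apply _).prodMk (measurable_pi_apply _)
  have hcomp := hind.comp hpair (hmeas.comp hext)
  have hZ : ∀ ω, interpScaled X Y c φ 0 q j k ω
      = interpScaled X' Y' c φ 0 q j k (ext fun s => J s ω) := by
    intro ω
    refine matTuple_ext_entry q j k ?_ fun q' j' k' hne => ?_
    · unfold interpScaled
      rw [setEntry_apply_self, setEntry_apply_self, Complex.ofReal_zero, zero_mul, zero_mul]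
    · unfold interpScaled
      rw [setEntry_apply_of_ne _ _ hne, setEntry_apply_of_ne _ _ hne]
      have h1 : (Sum.inl (⟨q', j', k'⟩ : EntryIdx d) : EntryIdx d ⊕ EntryIdx d) ∈ Sᶜ := by
        simpa [S, hI] using hne
      have h2 : (Sum.inr (⟨q', j', k'⟩ : EntryIdx d) : EntryIdx d ⊕ EntryIdx d) ∈ Sᶜ := by
        simpa [S, hI] using hne
      have e1 : X' q' j' k' (ext fun s => J s ω) = X q' j' k' ω := by
        simp only [X', ext, h1, dif_pos]; rfl
      have e2 : Y' q' j' k' (ext fun s => J s ω) = Y q' j' k' ω := by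
        simp only [Y', ext, h2, dif_pos]; rfl
      change _ * (trunc c (X q' j' k' ω) * _ + trunc c (Y q' j' k' ω) * _)
        = _ * (trunc c (X' q' j' k' (ext fun s => J s ω)) * _
          + trunc c (Y' q' j' k' (ext fun s => J s ω)) * _)
      rw [e1, e2]
  simp only [hZ]
  exact hcomp

/-- A second-order Taylor bound for a vector-valued function on `[0, 1]`. -/
theorem norm_le_of_second_derivative_le {E : Type*} [NormedAddCommGroup E] [NormedSpace ℝ E]
    {f f' f'' : ℝ → E} (h1 : ∀ t, HasDerivAt f (f' t) t) (h2 : ∀ t, HasDerivAt f' (f'' t) t) {K : ℝ}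
    (hK : ∀ t ∈ Set.Icc (0 : ℝ) 1, ‖f'' t‖ ≤ K) : ‖f 1‖ ≤ ‖f 0‖ + ‖f' 0‖ + K := by
  have hK0 : 0 ≤ K := (norm_nonneg _).trans (hK 0 (by simp))
  have a1 : ∀ t ∈ Set.Icc (0 : ℝ) 1, ‖f' t - f' 0‖ ≤ K := fun t ht => by
    have := norm_image_sub_le_of_norm_deriv_le_segment' (a := 0) (b := 1) (f := f')
      (fun t _ => (h2 t).hasDerivWithinAt) (fun t ht => hK t (Set.Ico_subset_Icc_self ht)) t ht
    refine this.trans ?_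
    nlinarith [ht.1, ht.2]
  -- After the linear part `t • f' 0` is subtracted, the mean value inequality gives the remainder
  -- `K` instead of the sharp `K / 2`, which is enough here.
  have a2 := norm_image_sub_le_of_norm_deriv_le_segment' (a := 0) (b := 1)
    (f := fun t => f t - t • f' 0) (f' := fun t => f' t - f' 0) (C := K)
    (fun t _ => by
      have := (h1 t).sub ((hasDerivAt_id t).smul_const (f' 0))
      rw [one_smul] at this
      exact this.hasDerivWithinAt)
    (fun t ht => a1 t (Set.Ico_subset_Icc_self ht)) 1 (by simp)
  simp only [one_smul, zero_smul, sub_zero, mul_one] at a2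
  have e : f 1 = (f 1 - f' 0 - f 0) + (f 0 + f' 0) := by abel
  rw [e]
  refine (norm_add_le _ _).trans ?_
  linarith [norm_add_le (f 0) (f' 0)]

omit [IsProbabilityMeasure μ] in
theorem integral_eq_add_four {E : Type*} [NormedAddCommGroup E] [NormedSpace ℝ E]
    {f f₁ f₂ f₃ f₄ : Ω → E} (h₁ : Integrable f₁ μ) (h₂ : Integrable f₂ μ) (h₃ : Integrable f₃ μ)
    (h₄ : Integrable f₄ μ) (h : ∀ ω, f ω = f₁ ω + f₂ ω + (f₃ ω + f₄ ω)) :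
    ∫ ω, f ω ∂μ = (∫ ω, f₁ ω ∂μ + ∫ ω, f₂ ω ∂μ) + (∫ ω, f₃ ω ∂μ + ∫ ω, f₄ ω ∂μ) := by
  rw [← integral_add h₁ h₂, ← integral_add h₃ h₄]
  simp only [h]
  exact integral_add (h₁.add h₂) (h₃.add h₄)

/-- Taylor's formula is applied to the deterministic function `θ ↦ E[w · g(φ, θ)]`, not to `g`
itself. At `θ = 1` it is the wanted expectation; at `θ = 0` it and its first derivative factor by
independence; its second derivative is controlled through conditional expectations. Each
`θ`-derivative brings down the real or imaginary part of the entry, which joins the weight. -/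
theorem IsEntryModel.norm_integral_smul_le {X Y : EntryArray d Ω} (h : IsEntryModel μ X Y)
    {c φ A₀ A₁ A₂ : ℝ} {q : Fin m} {j : Fin (d q.castSucc)} {k : Fin (d q.succ)}
    {g : MatTuple d → ℂ} (hg : ContDiff ℝ 2 g)
    (hb : ∀ θ ∈ Set.Icc (0 : ℝ) 1, DerivBounds μ X Y c φ θ A₀ A₁ A₂ q j k g)
    {w : ℂ × ℂ → ℝ} (hw : Measurable w) {D : ℝ} (hD : ∀ x, |w x| ≤ D) :
    ‖∫ ω, w (X q j k ω, Y q j k ω) • g (interp X Y c φ ω) ∂μ‖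
      ≤ A₀ * |∫ ω, w (X q j k ω, Y q j k ω) ∂μ|
        + A₁ * (|∫ ω, w (X q j k ω, Y q j k ω)
              * (position (d q.succ) c φ (X q j k ω, Y q j k ω)).re ∂μ|
            + |∫ ω, w (X q j k ω, Y q j k ω)
              * (position (d q.succ) c φ (X q j k ω, Y q j k ω)).im ∂μ|)
        + A₂ * ∫ ω, |w (X q j k ω, Y q j k ω)|
            * (|(position (d q.succ) c φ (X q j k ω, Y q j k ω)).re|
              + |(position (d q.succ) c φ (X q j k ω, Y q j k ω)).im|) ^ 2 ∂μ := by
  set pos := position (d q.succ) c φ with hpos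
  set P : Ω → ℂ × ℂ := fun ω => (X q j k ω, Y q j k ω) with hP
  have mX := h.measurable_X q j k
  have mY := h.measurable_Y q j k
  have mP : Measurable P := mX.prodMk mY
  have mre : Measurable fun x => (pos x).re := (measurable_position _ _ _).re
  have mim : Measurable fun x => (pos x).im := (measurable_position _ _ _).im
  set E := (Real.sqrt (d q.succ))⁻¹ * (|c| + |c|) with hE
  have hE0 : 0 ≤ E := by positivity
  have bre : ∀ x, |(pos x).re| ≤ E := fun x =>
    (Complex.abs_re_le_norm _).trans (norm_position_le_const _ _ _ _)
  have bim : ∀ x, |(pos x).im| ≤ E := fun x =>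
    (Complex.abs_im_le_norm _).trans (norm_position_le_const _ _ _ _)
  have hD0 : 0 ≤ D := (abs_nonneg _).trans (hD 0)
  have hζ : ∀ ω, interp X Y c φ ω q j k = pos (P ω) := fun ω => rfl
  obtain ⟨M, hM⟩ := exists_norm_interp_le X Y c φ
  have hξ : AEStronglyMeasurable (interp X Y c φ) μ :=
    (stronglyMeasurable_interp h.measurable_X h.measurable_Y c φ).aestronglyMeasurable
  have hwP : AEStronglyMeasurable (fun ω => w (P ω)) μ := (hw.comp mP).aestronglyMeasurable
  let T : ℝ → MatTuple d → MatTuple d := fun θ Z => setEntry Z q j k ((θ : ℂ) * Z q j k)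
  have hT : Continuous (Function.uncurry T) := continuous_setEntry_mul q j k
  have hTθ : ∀ θ, Continuous (T θ) := fun θ => hT.comp (Continuous.prodMk_right θ)
  have hint : ∀ (θ : ℝ) {H : MatTuple d → ℂ}, Continuous H → ∀ {v : ℂ × ℂ → ℝ}, Measurable v →
      ∀ {D : ℝ}, (∀ x, |v x| ≤ D) →
      Integrable (fun ω => v (P ω) • H (interpScaled X Y c φ θ q j k ω)) μ :=
    fun θ H hH v hv D hD => integrable_smul_comp_of_bounded (hH.comp (hTθ θ)) hξ hM
      (hv.comp mP).aestronglyMeasurable (fun ω => hD _)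
  have hint1 : ∀ (θ : ℝ) {H : MatTuple d → ℂ}, Continuous H →
      Integrable (fun ω => H (interpScaled X Y c φ θ q j k ω)) μ := fun θ H hH => by
    simpa using hint θ hH (v := fun _ => 1) measurable_const (D := 1) (by simp)
  -- the value at `θ = 0` factorizes by independence
  have hzero : ∀ {H : MatTuple d → ℂ} {A : ℝ}, Continuous H →
      CondExpBound μ (X q j k) (Y q j k) (fun ω => H (interpScaled X Y c φ 0 q j k ω)) A →
      ∀ {v : ℂ × ℂ → ℝ}, Measurable v →
      ‖∫ ω, v (P ω) • H (interpScaled X Y c φ 0 q j k ω) ∂μ‖ ≤ A * |∫ ω, v (P ω) ∂μ| := by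
    intro H A hH hA v hv
    have hi := (h.indepFun_interpScaled_zero c φ q j k hH).comp hv measurable_id
    have e := hi.integral_fun_smul_eq_smul_integral (hv.comp mP).aestronglyMeasurable (hint1 0 hH).1
    have h1 := hA.norm_integral_smul_le mX mY (hint1 0 hH) (w := fun _ => 1) measurable_const
      (D := 1) (by simp)
    simp only [one_smul, abs_one, integral_const, probReal_univ, mul_one] at h1
    have e' : ∫ ω, v (P ω) • H (interpScaled X Y c φ 0 q j k ω) ∂μ
      = (∫ ω, v (P ω) ∂μ) • ∫ ω, H (interpScaled X Y c φ 0 q j k ω) ∂μ := e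
    rw [e', norm_smul, Real.norm_eq_abs, mul_comm]
    gcongr
  have dg := hg.differentiable (by norm_num)
  have cR := contDiff_pderivRe hg (a := 1) (by norm_num) q j k
  have cI := contDiff_pderivIm hg (a := 1) (by norm_num) q j k
  have dR := cR.differentiable (by norm_num)
  have dI := cI.differentiable (by norm_num)
  have cRR := (contDiff_pderivRe cR (a := 0) (by norm_num) q j k).continuous
  have cIR := (contDiff_pderivIm cR (a := 0) (by norm_num) q j k).continuous
  have cRI := (contDiff_pderivRe cI (a := 0) (by norm_num) q j k).continuous
  have cII := (contDiff_pderivIm cI (a := 0) (by norm_num) q j k).continuous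
  have cre : Continuous fun p : ℝ × MatTuple d => (p.2 q j k).re :=
    Complex.continuous_re.comp ((continuous_entry q j k).comp continuous_snd)
  have cim : Continuous fun p : ℝ × MatTuple d => (p.2 q j k).im :=
    Complex.continuous_im.comp ((continuous_entry q j k).comp continuous_snd)
  let G1 : ℝ → MatTuple d → ℂ := fun θ Z =>
    (Z q j k).re • pderivRe q j k g (T θ Z) + (Z q j k).im • pderivIm q j k g (T θ Z)
  let G2 : ℝ → MatTuple d → ℂ := fun θ Z =>
    (Z q j k).re • ((Z q j k).re • pderivRe q j k (pderivRe q j k g) (T θ Z)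
        + (Z q j k).im • pderivIm q j k (pderivRe q j k g) (T θ Z))
      + (Z q j k).im • ((Z q j k).re • pderivRe q j k (pderivIm q j k g) (T θ Z)
        + (Z q j k).im • pderivIm q j k (pderivIm q j k g) (T θ Z))
  have cG0 : Continuous (Function.uncurry fun θ Z => g (T θ Z)) := hg.continuous.comp hT
  have cG1 : Continuous (Function.uncurry G1) :=
    (cre.smul (cR.continuous.comp hT)).add (cim.smul (cI.continuous.comp hT))
  have cG2 : Continuous (Function.uncurry G2) :=
    (cre.smul ((cre.smul (cRR.comp hT)).add (cim.smul (cIR.comp hT)))).add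
      (cim.smul ((cre.smul (cRI.comp hT)).add (cim.smul (cII.comp hT))))
  have D0 : ∀ θ, HasDerivAt (fun θ => ∫ ω, w (P ω) • g (T θ (interp X Y c φ ω)) ∂μ)
      (∫ ω, w (P ω) • G1 θ (interp X Y c φ ω) ∂μ) θ := fun θ =>
    hasDerivAt_integral_of_bounded (Φ := fun θ Z => g (T θ Z)) (Φ' := G1) cG0 cG1
      (fun s x => hasDerivAt_setEntry_mul dg q j k x s) hξ hM hwP (fun ω => hD _) θ
  have D1 : ∀ θ, HasDerivAt (fun θ => ∫ ω, w (P ω) • G1 θ (interp X Y c φ ω) ∂μ)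
      (∫ ω, w (P ω) • G2 θ (interp X Y c φ ω) ∂μ) θ := fun θ =>
    hasDerivAt_integral_of_bounded (Φ := G1) (Φ' := G2) cG1 cG2
      (fun s x => ((hasDerivAt_setEntry_mul dR q j k x s).fun_const_smul (x q j k).re).fun_add
        ((hasDerivAt_setEntry_mul dI q j k x s).fun_const_smul (x q j k).im)) hξ hM hwP (fun ω => hD _) θ
  have mwr : Measurable fun x => w x * (pos x).re := hw.mul mre
  have mwi : Measurable fun x => w x * (pos x).im := hw.mul mim
  have bwr : ∀ x, |w x * (pos x).re| ≤ D * E := fun x => by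
    rw [abs_mul]; exact mul_le_mul (hD x) (bre x) (abs_nonneg _) hD0
  have bwi : ∀ x, |w x * (pos x).im| ≤ D * E := fun x => by
    rw [abs_mul]; exact mul_le_mul (hD x) (bim x) (abs_nonneg _) hD0
  have hDE : 0 ≤ D * E := by positivity
  have hmul : ∀ {a b : ℂ × ℂ → ℝ} {s t : ℝ}, 0 ≤ s → (∀ x, |a x| ≤ s) → (∀ x, |b x| ≤ t) →
      ∀ x, |a x * b x| ≤ s * t := fun hs ha hb x => by
    rw [abs_mul]; exact mul_le_mul (ha x) (hb x) (abs_nonneg _) hs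
  set K := A₂ * ∫ ω, |w (P ω)| * (|(pos (P ω)).re| + |(pos (P ω)).im|) ^ 2 ∂μ with hK
  have hbound2 : ∀ θ ∈ Set.Icc (0 : ℝ) 1, ‖∫ ω, w (P ω) • G2 θ (interp X Y c φ ω) ∂μ‖ ≤ K := by
    intro θ hθ
    have hbθ := hb θ hθ
    have b1 := hmul hDE bwr bre
    have b2 := hmul hDE bwr bim
    have b3 := hmul hDE bwi bre
    have b4 := hmul hDE bwi bim
    have i1 := hint θ cRR (mwr.mul mre) b1
    have i2 := hint θ cIR (mwr.mul mim) b2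
    have i3 := hint θ cRI (mwi.mul mre) b3
    have i4 := hint θ cII (mwi.mul mim) b4
    have hIR : CondExpBound μ (X q j k) (Y q j k)
        (fun ω => pderivIm q j k (pderivRe q j k g) (interpScaled X Y c φ θ q j k ω)) A₂ := by
      rw [pderivIm_pderivRe hg]
      exact hbθ.re_im
    have n1 := hbθ.re_re.norm_integral_smul_le mX mY (hint1 θ cRR) (mwr.mul mre) b1
    have n2 := hIR.norm_integral_smul_le mX mY (hint1 θ cIR) (mwr.mul mim) b2
    have n3 := hbθ.re_im.norm_integral_smul_le mX mY (hint1 θ cRI) (mwi.mul mre) b3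
    have n4 := hbθ.im_im.norm_integral_smul_le mX mY (hint1 θ cII) (mwi.mul mim) b4
    have e : ∫ ω, w (P ω) • G2 θ (interp X Y c φ ω) ∂μ
        = (∫ ω, (w (P ω) * (pos (P ω)).re * (pos (P ω)).re) •
              pderivRe q j k (pderivRe q j k g) (interpScaled X Y c φ θ q j k ω) ∂μ
            + ∫ ω, (w (P ω) * (pos (P ω)).re * (pos (P ω)).im) •
              pderivIm q j k (pderivRe q j k g) (interpScaled X Y c φ θ q j k ω) ∂μ)
          + (∫ ω, (w (P ω) * (pos (P ω)).im * (pos (P ω)).re) •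
              pderivRe q j k (pderivIm q j k g) (interpScaled X Y c φ θ q j k ω) ∂μ
            + ∫ ω, (w (P ω) * (pos (P ω)).im * (pos (P ω)).im) •
              pderivIm q j k (pderivIm q j k g) (interpScaled X Y c φ θ q j k ω) ∂μ) := by
      refine integral_eq_add_four i1 i2 i3 i4 fun ω => ?_
      simp only [G2, hζ, smul_add, smul_smul, ← mul_assoc]
      rfl
    have j1 : Integrable (fun ω => |w (P ω) * (pos (P ω)).re * (pos (P ω)).re|) μ :=
      (Integrable.of_bound ((mwr.mul mre).comp mP).aestronglyMeasurable _
        (ae_of_all _ fun ω => b1 _)).abs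
    have j2 : Integrable (fun ω => |w (P ω) * (pos (P ω)).re * (pos (P ω)).im|) μ :=
      (Integrable.of_bound ((mwr.mul mim).comp mP).aestronglyMeasurable _
        (ae_of_all _ fun ω => b2 _)).abs
    have j3 : Integrable (fun ω => |w (P ω) * (pos (P ω)).im * (pos (P ω)).re|) μ :=
      (Integrable.of_bound ((mwi.mul mre).comp mP).aestronglyMeasurable _
        (ae_of_all _ fun ω => b3 _)).abs
    have j4 : Integrable (fun ω => |w (P ω) * (pos (P ω)).im * (pos (P ω)).im|) μ :=
      (Integrable.of_bound ((mwi.mul mim).comp mP).aestronglyMeasurable _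
        (ae_of_all _ fun ω => b4 _)).abs
    have eK : K = A₂ * ∫ ω, |w (P ω) * (pos (P ω)).re * (pos (P ω)).re| ∂μ
        + A₂ * ∫ ω, |w (P ω) * (pos (P ω)).re * (pos (P ω)).im| ∂μ
        + (A₂ * ∫ ω, |w (P ω) * (pos (P ω)).im * (pos (P ω)).re| ∂μ
          + A₂ * ∫ ω, |w (P ω) * (pos (P ω)).im * (pos (P ω)).im| ∂μ) := by
      rw [hK, ← mul_add, ← mul_add, ← mul_add]
      congr 1
      refine integral_eq_add_four j1 j2 j3 j4 fun ω => ?_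
      simp only [abs_mul]
      ring
    rw [e, eK]
    refine (norm_add_le _ _).trans (add_le_add ((norm_add_le _ _).trans ?_)
      ((norm_add_le _ _).trans ?_))
    · exact add_le_add n1 n2
    · exact add_le_add n3 n4
  have key := norm_le_of_second_derivative_le D0 D1 hbound2
  have hb0 := hb 0 (by simp)
  have e1 : ∫ ω, w (P ω) • g (T 1 (interp X Y c φ ω)) ∂μ
      = ∫ ω, w (P ω) • g (interp X Y c φ ω) ∂μ := by
    simp [T]
  have z0 : ‖∫ ω, w (P ω) • g (T 0 (interp X Y c φ ω)) ∂μ‖ ≤ A₀ * |∫ ω, w (P ω) ∂μ| :=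
    hzero hg.continuous hb0.zero hw
  have z1 : ‖∫ ω, w (P ω) • G1 0 (interp X Y c φ ω) ∂μ‖
      ≤ A₁ * (|∫ ω, w (P ω) * (pos (P ω)).re ∂μ| + |∫ ω, w (P ω) * (pos (P ω)).im ∂μ|) := by
    have e : ∫ ω, w (P ω) • G1 0 (interp X Y c φ ω) ∂μ
        = ∫ ω, (w (P ω) * (pos (P ω)).re) •
              pderivRe q j k g (interpScaled X Y c φ 0 q j k ω) ∂μ
            + ∫ ω, (w (P ω) * (pos (P ω)).im) •
              pderivIm q j k g (interpScaled X Y c φ 0 q j k ω) ∂μ := by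
      rw [← integral_add (hint 0 cR.continuous mwr bwr) (hint 0 cI.continuous mwi bwi)]
      congr 1
      ext1 ω
      simp only [G1, hζ, smul_add, smul_smul]
      rfl
    rw [e, mul_add]
    exact (norm_add_le _ _).trans (add_le_add (hzero cR.continuous hb0.re mwr)
      (hzero cI.continuous hb0.im mwi))
  rw [e1] at key
  linarith

end EntryEstimate

end SVUniversality

namespace SVUniversality

/-! ### Comparison of the truncated means along the rotation -/

section Interpolation

variable {m : ℕ} {d : Fin (m + 1) → ℕ} {Ω : Type*} [MeasurableSpace Ω] {μ : Measure Ω}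
  [IsProbabilityMeasure μ] {X Y : EntryArray d Ω}

/-- The derivative in `φ` of the entry of the interpolation, as a function of the pair of variables
at that position. -/
noncomputable def velocity (n : ℕ) (c φ : ℝ) (x : ℂ × ℂ) : ℂ :=
  ((Real.sqrt n : ℝ) : ℂ)⁻¹ * (-trunc c x.1 * (Real.sin φ : ℂ) + trunc c x.2 * (Real.cos φ : ℂ))

theorem measurable_velocity (n : ℕ) (c φ : ℝ) : Measurable (velocity n c φ) :=
  ((((measurable_trunc c).comp measurable_fst).neg.mul_const _).add
    (((measurable_trunc c).comp measurable_snd).mul_const _)).const_mul _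

theorem norm_velocity_le (n : ℕ) (c φ : ℝ) (x : ℂ × ℂ) :
    ‖velocity n c φ x‖ ≤ (Real.sqrt n)⁻¹ * (‖trunc c x.1‖ + ‖trunc c x.2‖) := by
  rw [velocity, norm_mul, norm_inv_sqrt_natCast]
  gcongr
  refine (norm_add_le _ _).trans ?_
  rw [norm_mul, norm_mul, norm_neg, Complex.norm_real, Complex.norm_real]
  exact add_le_add (mul_le_of_le_one_right (norm_nonneg _) (Real.abs_sin_le_one φ))
    (mul_le_of_le_one_right (norm_nonneg _) (Real.abs_cos_le_one φ))

theorem clm_inv_mul_add (p : ℂ →L[ℝ] ℝ) (s a b : ℝ) (x y : ℂ) :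
    p ((s : ℂ)⁻¹ * (x * (a : ℂ) + y * (b : ℂ))) = s⁻¹ * (p x * a + p y * b) := by
  have e : (s : ℂ)⁻¹ * (x * (a : ℂ) + y * (b : ℂ)) = s⁻¹ • (a • x + b • y) := by
    simp only [Complex.real_smul, Complex.ofReal_inv]
    ring
  rw [e, map_smul, map_add, map_smul, map_smul]
  simp only [smul_eq_mul]
  ring

omit [IsProbabilityMeasure μ] in
theorem IsEntryModel.matchedPair (h : IsEntryModel μ X Y) (q : Fin m) (j : Fin (d q.castSucc))
    (k : Fin (d q.succ)) : MatchedPair μ (X q j k) (Y q j k) where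
  measurable_left := h.measurable_X q j k
  measurable_right := h.measurable_Y q j k
  indep := h.indep.indepFun (i := Sum.inl (⟨q, j, k⟩ : EntryIdx d))
    (j := Sum.inr (⟨q, j, k⟩ : EntryIdx d)) (by simp)
  mean_left := h.mean_X q j k
  sq_left := h.var_X q j k
  gauss := h.gauss_Y q j k

/-- The bound for the contribution of one entry to the derivative along the interpolation. -/
noncomputable def entryBound (n : ℕ) (c A₀ A₁ A₂ s : ℝ) : ℝ :=
  A₀ * ((Real.sqrt n)⁻¹ * (s / c)) + A₁ * (4 * ((Real.sqrt n)⁻¹ ^ 2 * s))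
    + A₂ * (16 * ((Real.sqrt n)⁻¹ ^ 3 * c))

/-- The Taylor estimate with a coordinate of the velocity as weight. The `4` is `2` for each of the
real and imaginary parts of the position; the `16` is `2` from `(|Re ζ| + |Im ζ|)² ≤ 2 ‖ζ‖²` times
`8` from the third moment. -/
theorem IsEntryModel.norm_integral_velocity_smul_le (h : IsEntryModel μ X Y)
    {c φ A₀ A₁ A₂ : ℝ} (hc : 1 ≤ c) (hA₀ : 0 ≤ A₀) (hA₁ : 0 ≤ A₁) (hA₂ : 0 ≤ A₂) {q : Fin m}
    {j : Fin (d q.castSucc)} {k : Fin (d q.succ)} {g : MatTuple d → ℂ} (hg : ContDiff ℝ 2 g)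
    (hb : ∀ θ ∈ Set.Icc (0 : ℝ) 1, DerivBounds μ X Y c φ θ A₀ A₁ A₂ q j k g)
    {p : ℂ →L[ℝ] ℝ} (hp : p = Complex.reCLM ∨ p = Complex.imCLM) :
    ‖∫ ω, p (velocity (d q.succ) c φ (X q j k ω, Y q j k ω)) • g (interp X Y c φ ω) ∂μ‖
      ≤ entryBound (d q.succ) c A₀ A₁ A₂ (tailSq μ (X q j k) c + tailSq μ (Y q j k) c) := by
  have hM := h.matchedPair q j k
  set e := (Real.sqrt (d q.succ))⁻¹ with he
  have he0 : 0 ≤ e := by positivity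
  have hc0 : 0 < c := by linarith
  have hpn : ∀ x, |p x| ≤ ‖x‖ := by
    rcases hp with rfl | rfl
    · exact Complex.abs_re_le_norm
    · exact Complex.abs_im_le_norm
  have hv : ∀ ω, p (velocity (d q.succ) c φ (X q j k ω, Y q j k ω))
      = e * (-p (trunc c (X q j k ω)) * Real.sin φ + p (trunc c (Y q j k ω)) * Real.cos φ) := by
    intro ω
    rw [velocity, clm_inv_mul_add, map_neg]
  have hpos : ∀ (r : ℂ →L[ℝ] ℝ) ω, r (position (d q.succ) c φ (X q j k ω, Y q j k ω))
      = e * (r (trunc c (X q j k ω)) * Real.cos φ + r (trunc c (Y q j k ω)) * Real.sin φ) := by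
    intro r ω
    rw [position, clm_inv_mul_add]
  have key := h.norm_integral_smul_le hg hb (w := fun x => p (velocity (d q.succ) c φ x))
    (p.continuous.measurable.comp (measurable_velocity _ _ _))
    (D := e * (|c| + |c|)) (fun x => (hpn _).trans ((norm_velocity_le _ _ _ _).trans
      (by gcongr <;> exact norm_trunc_le_abs _ _)))
  refine key.trans ?_
  unfold entryBound
  have k1 : |∫ ω, p (velocity (d q.succ) c φ (X q j k ω, Y q j k ω)) ∂μ|
      ≤ e * ((tailSq μ (X q j k) c + tailSq μ (Y q j k) c) / c) := by
    simp only [hv]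
    rw [integral_const_mul, abs_mul, abs_of_nonneg he0]
    gcongr
    exact hM.abs_integral_velocity_le hpn hc0 φ
  have k2 : ∀ r : ℂ →L[ℝ] ℝ, (r = Complex.reCLM ∨ r = Complex.imCLM) →
      |∫ ω, p (velocity (d q.succ) c φ (X q j k ω, Y q j k ω))
        * r (position (d q.succ) c φ (X q j k ω, Y q j k ω)) ∂μ|
      ≤ e ^ 2 * (2 * (tailSq μ (X q j k) c + tailSq μ (Y q j k) c)) := by
    intro r hr
    have := hM.abs_integral_velocity_mul_position_le hp hr hc φ
    have e2 : ∀ ω, p (velocity (d q.succ) c φ (X q j k ω, Y q j k ω))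
        * r (position (d q.succ) c φ (X q j k ω, Y q j k ω))
        = e ^ 2 * ((-p (trunc c (X q j k ω)) * Real.sin φ + p (trunc c (Y q j k ω)) * Real.cos φ)
          * (r (trunc c (X q j k ω)) * Real.cos φ + r (trunc c (Y q j k ω)) * Real.sin φ)) := by
      intro ω
      rw [hv, hpos]
      ring
    simp only [e2]
    rw [integral_const_mul, abs_mul, abs_of_nonneg (by positivity : (0 : ℝ) ≤ e ^ 2)]
    gcongr
  have k3 : ∫ ω, |p (velocity (d q.succ) c φ (X q j k ω, Y q j k ω))|
        * (|(position (d q.succ) c φ (X q j k ω, Y q j k ω)).re|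
          + |(position (d q.succ) c φ (X q j k ω, Y q j k ω)).im|) ^ 2 ∂μ
      ≤ 16 * (e ^ 3 * c) := by
    have hI : Integrable (fun ω => 2 * e ^ 3
        * (‖trunc c (X q j k ω)‖ + ‖trunc c (Y q j k ω)‖) ^ 3) μ := by
      refine Integrable.const_mul (Integrable.of_bound (C := (|c| + |c|) ^ 3) ?_
        (ae_of_all _ fun ω => ?_)) _
      · exact ((((measurable_trunc c).comp (h.measurable_X q j k)).norm.add
          ((measurable_trunc c).comp (h.measurable_Y q j k)).norm).pow_const 3).aestronglyMeasurable
      · rw [Real.norm_of_nonneg (by positivity)]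
        gcongr <;> exact norm_trunc_le_abs _ _
    refine (integral_mono_of_nonneg (ae_of_all _ fun ω => by positivity) hI
      (ae_of_all _ fun ω => ?_)).trans ?_
    · simp only
      have b1 := (hpn _).trans (norm_velocity_le (d q.succ) c φ (X q j k ω, Y q j k ω))
      have b2 := norm_position_le (d q.succ) c φ (X q j k ω, Y q j k ω)
      simp only at b1 b2
      set ζ := position (d q.succ) c φ (X q j k ω, Y q j k ω)
      have b3 : (|ζ.re| + |ζ.im|) ^ 2 ≤ 2 * ‖ζ‖ ^ 2 := by
        rw [Complex.sq_norm, Complex.normSq_apply]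
        nlinarith [sq_nonneg (|ζ.re| - |ζ.im|), sq_abs ζ.re, sq_abs ζ.im]
      set t := ‖trunc c (X q j k ω)‖ + ‖trunc c (Y q j k ω)‖
      have ht : 0 ≤ t := by positivity
      have b4 : ‖ζ‖ ^ 2 ≤ (e * t) ^ 2 := by gcongr
      calc _ ≤ (e * t) * (2 * (e * t) ^ 2) :=
            mul_le_mul b1 (b3.trans (by linarith)) (by positivity) (by positivity)
        _ = _ := by ring
    · rw [integral_const_mul]
      calc 2 * e ^ 3 * _ ≤ 2 * e ^ 3 * (8 * c) := by
            gcongr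
            exact hM.integral_cube_le hc0.le
        _ = _ := by ring
  have k2r := k2 Complex.reCLM (Or.inl rfl)
  have k2i := k2 Complex.imCLM (Or.inr rfl)
  simp only [Complex.reCLM_apply, Complex.imCLM_apply] at k2r k2i
  gcongr
  linarith

variable {F : MatTuple d → OutMat d} {z : ℂ}

omit [MeasurableSpace Ω] in
-- The endpoints carry all the randomness and `φ` enters only through `cos` and `sin`, so the pair
-- of endpoints can serve as a bounded random parameter when differentiating in `φ`.
theorem interp_eq (X Y : EntryArray d Ω) (c φ : ℝ) (ω : Ω) :
    interp X Y c φ ω = Real.cos φ • interp X Y c 0 ω + Real.sin φ • interp X Y c (Real.pi / 2) ω := by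
  ext q j k
  simp only [interp, matTuple, Matrix.of_apply, Pi.add_apply, Pi.smul_apply, Matrix.add_apply,
    Matrix.smul_apply, Complex.real_smul, Real.cos_zero, Real.sin_zero, Real.cos_pi_div_two,
    Real.sin_pi_div_two, Complex.ofReal_one, Complex.ofReal_zero]
  ring

/-- Comparison of the expected Stieltjes transforms of the truncated tuples. -/
theorem IsEntryModel.norm_integral_stieltjes_interp_sub_le (h : IsEntryModel μ X Y)
    (hF : ContDiff ℝ 3 F) (B : OutMat d) (hz : 0 < z.im) {c A₀ A₁ A₂ : ℝ} (hc : 1 ≤ c)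
    (hA₀ : 0 ≤ A₀) (hA₁ : 0 ≤ A₁) (hA₂ : 0 ≤ A₂)
    (hb : ∀ (q : Fin m) (j : Fin (d q.castSucc)) (k : Fin (d q.succ)),
      ∀ φ ∈ Set.Icc (0 : ℝ) (Real.pi / 2), ∀ θ ∈ Set.Icc (0 : ℝ) 1,
        DerivBounds μ X Y c φ θ A₀ A₁ A₂ q j k (gRe F B z q j k) ∧
          DerivBounds μ X Y c φ θ A₀ A₁ A₂ q j k (gIm F B z q j k)) :
    ‖∫ ω, stieltjes F B z (interp X Y c (Real.pi / 2) ω) ∂μ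
        - ∫ ω, stieltjes F B z (interp X Y c 0 ω) ∂μ‖
      ≤ 1 / d 0 * (∑ q, ∑ j, ∑ k, entryBound (d q.succ) c A₀ A₁ A₂
          (tailSq μ (X q j k) c + tailSq μ (Y q j k) c)) * (Real.pi / 2) := by
  let K := MatTuple d × MatTuple d
  let Z : ℝ → K → MatTuple d := fun φ x => Real.cos φ • x.1 + Real.sin φ • x.2
  let H : ℝ → K → MatTuple d := fun φ x => (-Real.sin φ) • x.1 + Real.cos φ • x.2
  let Φ : ℝ → K → ℂ := fun φ x => stieltjes F B z (Z φ x)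
  let S : ℝ → K → ℂ := fun φ x => ∑ q, ∑ j, ∑ k,
    ((H φ x q j k).re • gRe F B z q j k (Z φ x) + (H φ x q j k).im • gIm F B z q j k (Z φ x))
  let Φ' : ℝ → K → ℂ := fun φ x => -(1 / (2 * (d 0 : ℂ))) * S φ x
  have cZ : Continuous (Function.uncurry Z) :=
    ((Real.continuous_cos.comp continuous_fst).smul (continuous_fst.comp continuous_snd)).add
      ((Real.continuous_sin.comp continuous_fst).smul (continuous_snd.comp continuous_snd))
  have cH : Continuous (Function.uncurry H) :=
    ((Real.continuous_sin.comp continuous_fst).neg.smul (continuous_fst.comp continuous_snd)).add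
      ((Real.continuous_cos.comp continuous_fst).smul (continuous_snd.comp continuous_snd))
  have dZ : ∀ φ x, HasDerivAt (fun φ => Z φ x) (H φ x) φ := fun φ x =>
    ((Real.hasDerivAt_cos φ).smul_const x.1).add ((Real.hasDerivAt_sin φ).smul_const x.2)
  have cΦ : Continuous (Function.uncurry Φ) := (contDiff_stieltjes hF B hz).continuous.comp cZ
  have cS : Continuous (Function.uncurry S) := by
    refine continuous_finsetSum _ fun q _ => continuous_finsetSum _ fun j _ =>
      continuous_finsetSum _ fun k _ => ?_
    have cH' := (continuous_entry q j k).comp cH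
    exact ((Complex.continuous_re.comp cH').smul
      ((contDiff_gRe hF B hz q j k).continuous.comp cZ)).add
      ((Complex.continuous_im.comp cH').smul ((contDiff_gIm hF B hz q j k).continuous.comp cZ))
  have cΦ' : Continuous (Function.uncurry Φ') := continuous_const.mul cS
  have dΦ : ∀ φ x, HasDerivAt (fun φ => Φ φ x) (Φ' φ x) φ := fun φ x =>
    hasDerivAt_stieltjes hF B hz (dZ φ x)
  let ξ : Ω → K := fun ω => (interp X Y c 0 ω, interp X Y c (Real.pi / 2) ω)
  have hξ : AEStronglyMeasurable ξ μ :=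
    ((stronglyMeasurable_interp h.measurable_X h.measurable_Y c 0).prodMk
      (stronglyMeasurable_interp h.measurable_X h.measurable_Y c _)).aestronglyMeasurable
  obtain ⟨M1, hM1⟩ := exists_norm_interp_le X Y c 0
  obtain ⟨M2, hM2⟩ := exists_norm_interp_le X Y c (Real.pi / 2)
  have hξb : ∀ ω, ‖ξ ω‖ ≤ max M1 M2 := fun ω => max_le_max (hM1 ω) (hM2 ω)
  have hZξ : ∀ φ ω, Z φ (ξ ω) = interp X Y c φ ω := fun φ ω => (interp_eq X Y c φ ω).symm
  have hHξ : ∀ φ ω q j k, H φ (ξ ω) q j k = velocity (d q.succ) c φ (X q j k ω, Y q j k ω) := by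
    intro φ ω q j k
    simp only [H, ξ, interp, matTuple, velocity, Matrix.of_apply, Pi.add_apply, Pi.smul_apply,
      Matrix.add_apply, Matrix.smul_apply, Complex.real_smul, Real.cos_zero, Real.sin_zero,
      Real.cos_pi_div_two, Real.sin_pi_div_two, Complex.ofReal_one, Complex.ofReal_zero,
      Complex.ofReal_neg]
    ring
  have : ProperSpace K := FiniteDimensional.proper_real K
  have D0 : ∀ φ, HasDerivAt (fun φ => ∫ ω, (1 : ℝ) • Φ φ (ξ ω) ∂μ)
      (∫ ω, (1 : ℝ) • Φ' φ (ξ ω) ∂μ) φ := fun φ =>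
    hasDerivAt_integral_of_bounded cΦ cΦ' (fun s x => dΦ s x) hξ hξb
      (aestronglyMeasurable_const (b := (1 : ℝ))) (D := 1) (by simp) φ
  have hbd : ∀ φ ∈ Set.Icc (0 : ℝ) (Real.pi / 2), ‖∫ ω, (1 : ℝ) • Φ' φ (ξ ω) ∂μ‖
      ≤ 1 / d 0 * (∑ q, ∑ j, ∑ k, entryBound (d q.succ) c A₀ A₁ A₂
          (tailSq μ (X q j k) c + tailSq μ (Y q j k) c)) := by
    intro φ hφ
    have hint : ∀ (q : Fin m) (j : Fin (d q.castSucc)) (k : Fin (d q.succ)) (p : ℂ →L[ℝ] ℝ)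
        (g : MatTuple d → ℂ), Continuous g → Integrable (fun ω =>
          p (velocity (d q.succ) c φ (X q j k ω, Y q j k ω)) • g (interp X Y c φ ω)) μ := by
      intro q j k p g hg
      obtain ⟨M, hM⟩ := exists_norm_interp_le X Y c φ
      refine integrable_smul_comp_of_bounded hg (stronglyMeasurable_interp h.measurable_X
        h.measurable_Y c φ).aestronglyMeasurable hM
        ((p.continuous.measurable.comp (measurable_velocity _ _ _)).comp
          ((h.measurable_X q j k).prodMk (h.measurable_Y q j k))).aestronglyMeasurable
        (D := ‖p‖ * ((Real.sqrt (d q.succ))⁻¹ * (|c| + |c|))) fun ω => ?_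
      refine (p.le_opNorm _).trans ?_
      gcongr
      exact (norm_velocity_le _ _ _ _).trans (by gcongr <;> exact norm_trunc_le_abs _ _)
    have iR := fun q j k => hint q j k Complex.reCLM _ (contDiff_gRe hF B hz q j k).continuous
    have iI := fun q j k => hint q j k Complex.imCLM _ (contDiff_gIm hF B hz q j k).continuous
    have iRI := fun q j k => (iR q j k).add (iI q j k)
    have e : ∫ ω, (1 : ℝ) • Φ' φ (ξ ω) ∂μ = -(1 / (2 * (d 0 : ℂ))) * ∑ q, ∑ j, ∑ k,
        (∫ ω, Complex.reCLM (velocity (d q.succ) c φ (X q j k ω, Y q j k ω))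
            • gRe F B z q j k (interp X Y c φ ω) ∂μ
          + ∫ ω, Complex.imCLM (velocity (d q.succ) c φ (X q j k ω, Y q j k ω))
            • gIm F B z q j k (interp X Y c φ ω) ∂μ) := by
      simp only [one_smul, Φ', S]
      rw [integral_const_mul]
      congr 1
      simp only [hZξ, hHξ]
      rw [integral_finsetSum]
      · refine Finset.sum_congr rfl fun q _ => ?_
        rw [integral_finsetSum]
        · refine Finset.sum_congr rfl fun j _ => ?_
          rw [integral_finsetSum]
          · exact Finset.sum_congr rfl fun k _ => integral_add (iR q j k) (iI q j k)
          · exact fun k _ => iRI q j k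
        · exact fun j _ => integrable_finsetSum _ fun k _ => iRI q j k
      · exact fun q _ => integrable_finsetSum _ fun j _ => integrable_finsetSum _ fun k _ =>
          iRI q j k
    rw [e, norm_mul]
    -- The factor `1/2` is set apart to absorb the two bounds per entry, one for `gRe` and one for
    -- `gIm`.
    have e2 : ‖-(1 / (2 * (d 0 : ℂ)))‖ = 1 / d 0 * (1 / 2) := by
      rw [norm_neg]
      simp
    rw [e2, mul_assoc]
    gcongr
    rw [one_div, inv_mul_eq_div, div_le_iff₀ (by norm_num), Finset.sum_mul]
    refine (norm_sum_le _ _).trans (Finset.sum_le_sum fun q _ => ?_)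
    rw [Finset.sum_mul]
    refine (norm_sum_le _ _).trans (Finset.sum_le_sum fun j _ => ?_)
    rw [Finset.sum_mul]
    refine (norm_sum_le _ _).trans (Finset.sum_le_sum fun k _ => ?_)
    refine (norm_add_le _ _).trans ?_
    have n1 := h.norm_integral_velocity_smul_le hc hA₀ hA₁ hA₂ (contDiff_gRe hF B hz q j k)
      (fun θ hθ => (hb q j k φ hφ θ hθ).1) (Or.inl rfl)
    have n2 := h.norm_integral_velocity_smul_le hc hA₀ hA₁ hA₂ (contDiff_gIm hF B hz q j k)
      (fun θ hθ => (hb q j k φ hφ θ hθ).2) (Or.inr rfl)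
    linarith
  have key := norm_image_sub_le_of_norm_deriv_le_segment' (a := 0) (b := Real.pi / 2)
    (fun φ _ => (D0 φ).hasDerivWithinAt) (fun φ hφ => hbd φ (Set.Ico_subset_Icc_self hφ))
    (Real.pi / 2) ⟨by positivity, le_rfl⟩
  simpa only [one_smul, Φ, hZξ, sub_zero] using key

end Interpolation

end SVUniversality

namespace SVUniversality

/-! ### Quantitative bound for fixed `n` and its asymptotics -/

section Universality

variable {m : ℕ} {d : Fin (m + 1) → ℕ} {Ω : Type*} [MeasurableSpace Ω] {μ : Measure Ω}
  [IsProbabilityMeasure μ] {X Y : EntryArray d Ω}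

omit [MeasurableSpace Ω] in
theorem interp_zero (X Y : EntryArray d Ω) (c : ℝ) :
    interp X Y c 0 = matTuple (fun q j k ω => trunc c (X q j k ω)) := by
  funext ω
  simp [interp]

omit [MeasurableSpace Ω] in
theorem interp_pi_div_two (X Y : EntryArray d Ω) (c : ℝ) :
    interp X Y c (Real.pi / 2) = matTuple (fun q j k ω => trunc c (Y q j k ω)) := by
  funext ω
  simp [interp]

/-- The sum of the truncated second moments of all the entries. -/
noncomputable def tailSum (μ : Measure Ω) (X : EntryArray d Ω) (c : ℝ) : ℝ :=
  ∑ q, ∑ j, ∑ k, tailSq μ (X q j k) c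

omit [IsProbabilityMeasure μ] in
theorem tailSum_nonneg (X : EntryArray d Ω) (c : ℝ) : 0 ≤ tailSum μ X c :=
  Finset.sum_nonneg fun _ _ => Finset.sum_nonneg fun _ _ => Finset.sum_nonneg fun _ _ =>
    tailSq_nonneg _ _

omit [IsProbabilityMeasure μ] in
theorem lindeberg_eq (X : EntryArray d Ω) (t : ℝ) :
    lindeberg μ X t = 1 / (d 0 : ℝ) ^ 2 * tailSum μ X (t * Real.sqrt (d 0)) := rfl

/-- The `L¹` distance of the Stieltjes transforms for fixed dimensions. -/
theorem IsEntryModel.integral_norm_stieltjes_sub_le (h : IsEntryModel μ X Y)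
    {F : MatTuple d → OutMat d} (hF : ContDiff ℝ 3 F) (B : OutMat d) {z : ℂ} (hz : 0 < z.im)
    {C : ℝ} (hC : 0 ≤ C)
    (hrank : ∀ P Q : MatTuple d, ((F P - F Q).rank : ℝ) ≤ C * ∑ q, ((P q - Q q).rank : ℝ))
    {c A₀ A₁ A₂ : ℝ} (hc : 1 ≤ c) (hA₀ : 0 ≤ A₀) (hA₁ : 0 ≤ A₁) (hA₂ : 0 ≤ A₂)
    (hb : ∀ (q : Fin m) (j : Fin (d q.castSucc)) (k : Fin (d q.succ)),
      ∀ φ ∈ Set.Icc (0 : ℝ) (Real.pi / 2), ∀ θ ∈ Set.Icc (0 : ℝ) 1,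
        DerivBounds μ X Y c φ θ A₀ A₁ A₂ q j k (gRe F B z q j k) ∧
          DerivBounds μ X Y c φ θ A₀ A₁ A₂ q j k (gIm F B z q j k)) :
    ∫ ω, ‖stieltjes F B z (matTuple Y ω) - stieltjes F B z (matTuple X ω)‖ ∂μ
      ≤ 8 * C / (d 0 * z.im) * √(∑ q : Fin m, (d q.castSucc : ℝ))
        + 2 * C / (d 0 * z.im) * ((tailSum μ X c + tailSum μ Y c) / c ^ 2)
        + 1 / d 0 * (∑ q, ∑ j, ∑ k, entryBound (d q.succ) c A₀ A₁ A₂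
          (tailSq μ (X q j k) c + tailSq μ (Y q j k) c)) * (Real.pi / 2) := by
  have hc0 : 0 < c := by linarith
  have iX := integrable_stieltjes_comp (μ := μ) hF B hz
    (stronglyMeasurable_matTuple h.measurable_X).aestronglyMeasurable
  have iY := integrable_stieltjes_comp (μ := μ) hF B hz
    (stronglyMeasurable_matTuple h.measurable_Y).aestronglyMeasurable
  have cX := integral_norm_stieltjes_sub_integral_le h.measurable_X
    (h.indep.precomp Sum.inl_injective) hF B hz hC hrank
  have cY := integral_norm_stieltjes_sub_integral_le h.measurable_Y
    (h.indep.precomp Sum.inr_injective) hF B hz hC hrank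
  have tX := norm_integral_stieltjes_sub_trunc_le h.measurable_X
    (fun q j k => (h.matchedPair q j k).integrable_sq_left) hF B hz hC hrank hc0
  have tY := norm_integral_stieltjes_sub_trunc_le h.measurable_Y
    (fun q j k => (h.matchedPair q j k).integrable_sq_right) hF B hz hC hrank hc0
  have key := h.norm_integral_stieltjes_interp_sub_le hF B hz hc hA₀ hA₁ hA₂ hb
  rw [interp_zero, interp_pi_div_two] at key
  set sX := fun ω => stieltjes F B z (matTuple X ω)
  set sY := fun ω => stieltjes F B z (matTuple Y ω)
  set x₁ := ∫ ω, sX ω ∂μ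
  set y₁ := ∫ ω, sY ω ∂μ
  set x₂ := ∫ ω, stieltjes F B z (matTuple (fun q j k ω => trunc c (X q j k ω)) ω) ∂μ
  set y₂ := ∫ ω, stieltjes F B z (matTuple (fun q j k ω => trunc c (Y q j k ω)) ω) ∂μ
  -- Truncation and interpolation are used for the means only; the fluctuations are handled for the
  -- untruncated variables.
  have hdet : ‖y₁ - x₁‖ ≤ ‖y₁ - y₂‖ + ‖y₂ - x₂‖ + ‖x₁ - x₂‖ := by
    rw [show y₁ - x₁ = (y₁ - y₂) + (y₂ - x₂) - (x₁ - x₂) by ring]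
    exact (norm_sub_le _ _).trans (by gcongr; exact norm_add_le _ _)
  have iX' : Integrable (fun ω => ‖sX ω - x₁‖) μ := (iX.sub (integrable_const _)).norm
  have iY' : Integrable (fun ω => ‖sY ω - y₁‖) μ := (iY.sub (integrable_const _)).norm
  have iXY : Integrable (fun ω => ‖sY ω - y₁‖ + ‖sX ω - x₁‖) μ := iY'.add iX'
  have hle : ∫ ω, ‖sY ω - sX ω‖ ∂μ
      ≤ ∫ ω, (‖sY ω - y₁‖ + ‖sX ω - x₁‖ + ‖y₁ - x₁‖) ∂μ := by
    refine integral_mono (iY.sub iX).norm (iXY.add (integrable_const _)) fun ω => ?_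
    change ‖sY ω - sX ω‖ ≤ ‖sY ω - y₁‖ + ‖sX ω - x₁‖ + ‖y₁ - x₁‖
    rw [show sY ω - sX ω = (sY ω - y₁) - (sX ω - x₁) + (y₁ - x₁) by ring]
    exact (norm_add_le _ _).trans (by gcongr; exact norm_sub_le _ _)
  rw [integral_add iXY (integrable_const _), integral_add iY' iX', integral_const,
    probReal_univ, one_smul] at hle
  have e : 8 * C / (d 0 * z.im) * √(∑ q : Fin m, (d q.castSucc : ℝ))
        + 2 * C / (d 0 * z.im) * ((tailSum μ X c + tailSum μ Y c) / c ^ 2)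
      = 2 * (2 / (d 0 * z.im) * C * √(∑ q : Fin m, (d q.castSucc : ℝ)))
        + 2 * (2 / (d 0 * z.im) * C * √(∑ q : Fin m, (d q.castSucc : ℝ)))
        + 2 / (d 0 * z.im) * C * tailSum μ X c / c ^ 2
        + 2 / (d 0 * z.im) * C * tailSum μ Y c / c ^ 2 := by ring
  rw [e]
  change ‖x₁ - x₂‖ ≤ 2 / (d 0 * z.im) * C * tailSum μ X c / c ^ 2 at tX
  change ‖y₁ - y₂‖ ≤ 2 / (d 0 * z.im) * C * tailSum μ Y c / c ^ 2 at tY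
  linarith

theorem entryBound_le {n : ℕ} {c A₀ A₁ A₂ s a : ℝ} (ha : 0 < a) (hn : a ≤ n) (hc : 0 ≤ c)
    (hA₀ : 0 ≤ A₀) (hA₁ : 0 ≤ A₁) (hA₂ : 0 ≤ A₂) (hs : 0 ≤ s) :
    entryBound n c A₀ A₁ A₂ s ≤ (A₀ * ((√a)⁻¹ / c) + A₁ * (4 * (√a)⁻¹ ^ 2)) * s
      + A₂ * (16 * ((√a)⁻¹ ^ 3 * c)) := by
  have hi : (√(n : ℝ))⁻¹ ≤ (√a)⁻¹ := inv_anti₀ (Real.sqrt_pos.2 ha) (Real.sqrt_le_sqrt hn)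
  calc entryBound n c A₀ A₁ A₂ s
      ≤ A₀ * ((√a)⁻¹ * (s / c)) + A₁ * (4 * ((√a)⁻¹ ^ 2 * s))
        + A₂ * (16 * ((√a)⁻¹ ^ 3 * c)) := by
        unfold entryBound
        gcongr
    _ = _ := by ring

omit [IsProbabilityMeasure μ] in
theorem sum_entryBound_le {c A₀ A₁ A₂ a N : ℝ} (ha : 0 < a)
    (hd : ∀ q : Fin m, a ≤ d q.succ) (hc : 0 ≤ c) (hA₀ : 0 ≤ A₀) (hA₁ : 0 ≤ A₁) (hA₂ : 0 ≤ A₂)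
    (hN : ∑ q : Fin m, (d q.castSucc * d q.succ : ℝ) ≤ N) :
    ∑ q, ∑ j, ∑ k, entryBound (d q.succ) c A₀ A₁ A₂
        (tailSq μ (X q j k) c + tailSq μ (Y q j k) c)
      ≤ (A₀ * ((√a)⁻¹ / c) + A₁ * (4 * (√a)⁻¹ ^ 2)) * (tailSum μ X c + tailSum μ Y c)
        + A₂ * (16 * ((√a)⁻¹ ^ 3 * c)) * N := by
  calc _ ≤ ∑ q : Fin m, ∑ j : Fin (d q.castSucc), ∑ k : Fin (d q.succ),
          ((A₀ * ((√a)⁻¹ / c) + A₁ * (4 * (√a)⁻¹ ^ 2))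
            * (tailSq μ (X q j k) c + tailSq μ (Y q j k) c)
          + A₂ * (16 * ((√a)⁻¹ ^ 3 * c))) := by
        refine Finset.sum_le_sum fun q _ => Finset.sum_le_sum fun j _ =>
          Finset.sum_le_sum fun k _ => entryBound_le ha (hd q) hc hA₀ hA₁ hA₂ ?_
        exact add_nonneg (tailSq_nonneg _ _) (tailSq_nonneg _ _)
    _ = (A₀ * ((√a)⁻¹ / c) + A₁ * (4 * (√a)⁻¹ ^ 2)) * (tailSum μ X c + tailSum μ Y c)
        + A₂ * (16 * ((√a)⁻¹ ^ 3 * c)) * ∑ q : Fin m, (d q.castSucc * d q.succ : ℝ) := by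
        simp only [tailSum, Finset.sum_add_distrib, ← Finset.mul_sum, Finset.sum_const,
          Finset.card_univ, Fintype.card_fin, nsmul_eq_mul]
        simp only [Finset.mul_sum, mul_add]
        congr 1
        exact Finset.sum_congr rfl fun q _ => by ring
    _ ≤ _ := by gcongr

theorem IsEntryModel.tailSum_right_le (h : IsEntryModel μ X Y) {c N : ℝ} (hc : 0 < c)
    (hN : ∑ q : Fin m, (d q.castSucc * d q.succ : ℝ) ≤ N) :
    tailSum μ Y c ≤ N * (1290240 * Real.exp 1 / c ^ 6) := by
  calc tailSum μ Y c ≤ ∑ q : Fin m, ∑ _j : Fin (d q.castSucc), ∑ _k : Fin (d q.succ),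
          1290240 * Real.exp 1 / c ^ 6 :=
        Finset.sum_le_sum fun q _ => Finset.sum_le_sum fun j _ => Finset.sum_le_sum fun k _ =>
          (h.matchedPair q j k).tailSq_right_le hc
    _ = (∑ q : Fin m, (d q.castSucc * d q.succ : ℝ)) * (1290240 * Real.exp 1 / c ^ 6) := by
        simp only [Finset.sum_const, Finset.card_univ, Fintype.card_fin, nsmul_eq_mul,
          Finset.sum_mul, mul_assoc]
    _ ≤ _ := by gcongr

/-- Dimensions with positive limiting ratios are comparable to `n`. -/
theorem eventually_dim_bounds {d : ℕ → Fin (m + 1) → ℕ} {y : Fin m → ℝ} (hy : ∀ q, 0 < y q)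
    (hshape : ∀ q : Fin m, Tendsto (fun n : ℕ => (n : ℝ) / (d n q.succ : ℝ)) atTop (𝓝 (y q))) :
    ∃ κ K : ℝ, 0 < κ ∧ 1 ≤ K ∧ ∀ᶠ n : ℕ in atTop, ∀ q : Fin m,
      κ * n ≤ d n q.succ ∧ (d n q.succ : ℝ) ≤ K * n := by
  -- Eventually `n / n_q` lies in `(y_q / 2, 2 y_q)`. The sums over `q` dominate every single `2
  -- y_q` and `2 / y_q`; the added `1` gives positivity, and `1 ≤ K` so that the bound also covers
  -- `n_0 = n`.
  have hy2 : ∀ q, 2 * y q ≤ 1 + ∑ q, 2 * y q := fun q => by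
    have := Finset.single_le_sum (f := fun q => 2 * y q)
      (fun q _ => (mul_pos two_pos (hy q)).le) (Finset.mem_univ q)
    linarith
  have hy3 : ∀ q, 2 / y q ≤ 1 + ∑ q, 2 / y q := fun q => by
    have := Finset.single_le_sum (f := fun q => 2 / y q)
      (fun q _ => (div_pos two_pos (hy q)).le) (Finset.mem_univ q)
    linarith
  have p1 : 0 < 1 + ∑ q, 2 * y q :=
    add_pos_of_pos_of_nonneg one_pos (Finset.sum_nonneg fun q _ => (mul_pos two_pos (hy q)).le)
  refine ⟨(1 + ∑ q, 2 * y q)⁻¹, 1 + ∑ q, 2 / y q, inv_pos.2 p1, ?_, ?_⟩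
  · exact le_add_of_nonneg_right (Finset.sum_nonneg fun q _ => (div_pos two_pos (hy q)).le)
  rw [eventually_all]
  intro q
  filter_upwards [(hshape q).eventually (Ioo_mem_nhds (half_lt_self (hy q))
    (show y q < 2 * y q by linarith [hy q]))] with n hn
  -- A zero dimension would make the quotient `n / 0 = 0`, below `y_q / 2`.
  have hd0 : (0 : ℝ) < d n q.succ := by
    rcases (Nat.cast_nonneg (α := ℝ) (d n q.succ)).eq_or_lt with h0 | h0
    · have := hn.1
      rw [← h0, div_zero] at this
      linarith [hy q]
    · exact h0
  have h1 := (lt_div_iff₀ hd0).1 hn.1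
  have h2 := (div_lt_iff₀ hd0).1 hn.2
  have hyq := hy q
  constructor
  · rw [inv_mul_le_iff₀ p1]
    nlinarith [hy2 q]
  · calc (d n q.succ : ℝ) = 2 / y q * (y q / 2 * d n q.succ) := by field_simp
      _ ≤ 2 / y q * n := by gcongr
      _ ≤ _ := by gcongr; exact hy3 q

/-- The tail sums are negligible at the truncation level `τ √n`. -/
theorem tendsto_tailSum_div {d : ℕ → Fin (m + 1) → ℕ} (hd : ∀ n, d n 0 = n)
    {Ω : ℕ → Type*} [∀ n, MeasurableSpace (Ω n)] {μ : ∀ n, Measure (Ω n)}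
    [∀ n, IsProbabilityMeasure (μ n)] {X Y : ∀ n, EntryArray (d n) (Ω n)}
    (hXY : ∀ n, IsEntryModel (μ n) (X n) (Y n)) {τ : ℕ → ℝ} (hτ : Tendsto τ atTop (𝓝 0))
    (hτLind : Tendsto (fun n => lindeberg (μ n) (X n) (τ n) / τ n ^ 4) atTop (𝓝 0))
    (hτlow : ∀ n : ℕ, 1 ≤ n → (n : ℝ) ^ (-(1 / 3) : ℝ) ≤ τ n) {N : ℝ} (hN0 : 0 ≤ N)
    (hN : ∀ᶠ n : ℕ in atTop,
      ∑ q : Fin m, (d n q.castSucc * d n q.succ : ℝ) ≤ N * (n : ℝ) ^ 2) :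
    Tendsto (fun n : ℕ => (tailSum (μ n) (X n) (τ n * √n) + tailSum (μ n) (Y n) (τ n * √n))
      / ((n : ℝ) ^ 2 * τ n ^ 2)) atTop (𝓝 0) := by
  have hx : Tendsto (fun n : ℕ => (n : ℝ) ^ (-(1 / 3) : ℝ)) atTop (𝓝 0) :=
    (tendsto_rpow_neg_atTop (by norm_num)).comp tendsto_natCast_atTop_atTop
  have hlim : Tendsto (fun n : ℕ => lindeberg (μ n) (X n) (τ n) / τ n ^ 4 * τ n ^ 2
      + N * (1290240 * Real.exp 1) * (n : ℝ) ^ (-(1 / 3) : ℝ)) atTop (𝓝 0) := by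
    simpa using (hτLind.mul (hτ.pow 2)).add (hx.const_mul (N * (1290240 * Real.exp 1)))
  refine squeeze_zero' (Eventually.of_forall fun n => ?_) ?_ hlim
  · have := tailSum_nonneg (μ := μ n) (X n) (τ n * √n)
    have := tailSum_nonneg (μ := μ n) (Y n) (τ n * √n)
    positivity
  filter_upwards [hN, eventually_ge_atTop 1] with n hn hn1
  have n0 : (0 : ℝ) < n := by exact_mod_cast hn1
  set x := (n : ℝ) ^ (-(1 / 3) : ℝ) with hxd
  have x0 : 0 < x := Real.rpow_pos_of_pos n0 _
  have hxτ : x ≤ τ n := hτlow n hn1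
  have τ0 : 0 < τ n := x0.trans_le hxτ
  have hx3 : x ^ 3 * n = 1 := by
    rw [hxd, ← Real.rpow_natCast, ← Real.rpow_mul n0.le]
    norm_num
    rw [Real.rpow_neg_one, inv_mul_cancel₀ n0.ne']
  have r0 : 0 < √(n : ℝ) := Real.sqrt_pos.2 n0
  have r2 : √(n : ℝ) ^ 2 = n := Real.sq_sqrt n0.le
  have hY := (hXY n).tailSum_right_le (mul_pos τ0 r0) hn
  rw [add_div]
  refine add_le_add (le_of_eq ?_) ?_
  · rw [lindeberg_eq, hd n]
    field_simp
  · have e6 : (τ n * √(n : ℝ)) ^ 6 = τ n ^ 6 * n ^ 3 := by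
      rw [mul_pow, show √(n : ℝ) ^ 6 = (√(n : ℝ) ^ 2) ^ 3 by ring, r2]
    rw [e6] at hY
    -- With `x = n^{-1/3} ≤ τ_n` and `x³ n = 1` one has `τ_n⁸ n³ ≥ x⁸ n³ = x⁻¹`.
    have hinv : (τ n ^ 8 * (n : ℝ) ^ 3)⁻¹ ≤ x := by
      rw [inv_le_comm₀ (by positivity) x0]
      have : x⁻¹ = x ^ 8 * (n : ℝ) ^ 3 := by
        refine inv_eq_of_mul_eq_one_right ?_
        calc x * (x ^ 8 * (n : ℝ) ^ 3) = (x ^ 3 * n) ^ 3 := by ring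
          _ = 1 := by rw [hx3, one_pow]
      rw [this]
      gcongr
    calc tailSum (μ n) (Y n) (τ n * √n) / ((n : ℝ) ^ 2 * τ n ^ 2)
        ≤ N * (n : ℝ) ^ 2 * (1290240 * Real.exp 1 / (τ n ^ 6 * n ^ 3))
          / ((n : ℝ) ^ 2 * τ n ^ 2) := by gcongr
      _ = N * (1290240 * Real.exp 1) * (τ n ^ 8 * (n : ℝ) ^ 3)⁻¹ := by
          field_simp
      _ ≤ _ := by gcongr

end Universality

end SVUniversality

/-! ### Assembly of the estimates -/

theorem theorem3p1
    {m : ℕ} (_hm : 1 ≤ m)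
    -- the dimensions `n_q(n) = d n q`, with `n_0 = n` and `n / n_q → y_q > 0`
    (d : ℕ → Fin (m + 1) → ℕ) (hd : ∀ n, d n 0 = n)
    (y : Fin m → ℝ) (hy : ∀ q, 0 < y q)
    (hshape : ∀ q : Fin m, Tendsto (fun n : ℕ => (n : ℝ) / (d n q.succ : ℝ)) atTop (𝓝 (y q)))
    -- the probability spaces and the entries of the random matrices
    {Ω : ℕ → Type*} [∀ n, MeasurableSpace (Ω n)]
    (μ : ∀ n, Measure (Ω n)) [∀ n, IsProbabilityMeasure (μ n)]
    (X Y : ∀ n, EntryArray (d n) (Ω n))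
    (hXY : ∀ n, IsEntryModel (μ n) (X n) (Y n))
    -- the matrix-valued functions and the non-random shifts
    (F : ∀ n, MatTuple (d n) → OutMat (d n))
    (hF : ∀ n, ContDiff ℝ 3 (F n))
    (B : ∀ n, OutMat (d n))
    -- the Lindeberg condition
    (hLind : ∀ t : ℝ, 0 < t → Tendsto (fun n => lindeberg (μ n) (X n) t) atTop (𝓝 0))
    -- the rank condition
    (C : ℝ)
    (hrank : ∀ n, ∀ P Q : MatTuple (d n),
      ((F n P - F n Q).rank : ℝ) ≤ C * ∑ q : Fin m, ((P q - Q q).rank : ℝ))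
    -- the truncation levels `τ_n √n`
    (τ : ℕ → ℝ) (hτ : Tendsto τ atTop (𝓝 0))
    (hτLind : Tendsto (fun n => lindeberg (μ n) (X n) (τ n) / τ n ^ 4) atTop (𝓝 0))
    (hτlow : ∀ n : ℕ, 1 ≤ n → (n : ℝ) ^ (-(1 / 3) : ℝ) ≤ τ n)
    -- the point in the upper half plane and the bounds on the conditional expectations
    (z : ℂ) (hz : 0 < z.im)
    (A₀ A₁ A₂ : ℝ) (hA₀ : 0 < A₀) (hA₁ : 0 < A₁) (hA₂ : 0 < A₂)
    (hg : ∀ n, ∀ (q : Fin m) (j : Fin (d n q.castSucc)) (k : Fin (d n q.succ)),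
      ∀ φ ∈ Set.Icc (0 : ℝ) (Real.pi / 2), ∀ θ ∈ Set.Icc (0 : ℝ) 1,
        DerivBounds (μ n) (X n) (Y n) (τ n * Real.sqrt n) φ θ A₀ A₁ A₂ q j k
            (gRe (F n) (B n) z q j k) ∧
          DerivBounds (μ n) (X n) (Y n) (τ n * Real.sqrt n) φ θ A₀ A₁ A₂ q j k
            (gIm (F n) (B n) z q j k)) :
    ∀ ε : ℝ, 0 < ε →
      Tendsto (fun n => μ n {ω | ε ≤ ‖stieltjes (F n) (B n) z (matTuple (Y n) ω)
        - stieltjes (F n) (B n) z (matTuple (X n) ω)‖}) atTop (𝓝 0) := by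
  intro ε hε
  obtain ⟨κ, K, hκ, hK, hdim⟩ := eventually_dim_bounds hy hshape
  -- The rank constant is not assumed nonnegative, and enlarging it is harmless.
  set C' := max C 0 with hC'
  have hC0 : 0 ≤ C' := le_max_right _ _
  have hrank' : ∀ n, ∀ P Q : MatTuple (d n),
      ((F n P - F n Q).rank : ℝ) ≤ C' * ∑ q : Fin m, ((P q - Q q).rank : ℝ) := fun n P Q =>
    (hrank n P Q).trans (mul_le_mul_of_nonneg_right (le_max_left _ _)
      (Finset.sum_nonneg fun _ _ => Nat.cast_nonneg _))
  have hcast : ∀ᶠ n : ℕ in atTop, ∀ q : Fin m, (d n q.castSucc : ℝ) ≤ K * n := by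
    filter_upwards [hdim] with n hn q
    obtain h0 | ⟨p, hp⟩ := Fin.eq_zero_or_eq_succ q.castSucc
    · rw [h0, hd n]
      exact le_mul_of_one_le_left (Nat.cast_nonneg _) hK
    · rw [hp]
      exact (hn p).2
  have hsum : ∀ᶠ n : ℕ in atTop, ∑ q : Fin m, (d n q.castSucc : ℝ) ≤ m * K * n := by
    filter_upwards [hcast] with n hn
    refine (Finset.sum_le_sum fun q _ => hn q).trans_eq ?_
    simp [mul_assoc]
  set N : ℝ := m * K ^ 2 with hNdef
  have hN0 : 0 ≤ N := by positivity
  have hN : ∀ᶠ n : ℕ in atTop,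
      ∑ q : Fin m, (d n q.castSucc * d n q.succ : ℝ) ≤ N * (n : ℝ) ^ 2 := by
    filter_upwards [hcast, hdim] with n hn hn'
    calc ∑ q : Fin m, (d n q.castSucc * d n q.succ : ℝ)
        ≤ ∑ _q : Fin m, (K * n) * (K * n) := by
          gcongr with q
          · exact hn q
          · exact (hn' q).2
      _ = N * (n : ℝ) ^ 2 := by
          simp only [Finset.sum_const, Finset.card_univ, Fintype.card_fin, nsmul_eq_mul, hNdef]
          ring
  set T : ℕ → ℝ := fun n =>
    (tailSum (μ n) (X n) (τ n * √n) + tailSum (μ n) (Y n) (τ n * √n)) / ((n : ℝ) ^ 2 * τ n ^ 2)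
  have hT : Tendsto T atTop (𝓝 0) := tendsto_tailSum_div hd hXY hτ hτLind hτlow hN0 hN
  have hr : Tendsto (fun n : ℕ => (√(n : ℝ))⁻¹) atTop (𝓝 0) :=
    tendsto_inv_atTop_zero.comp (Real.tendsto_sqrt_atTop.comp tendsto_natCast_atTop_atTop)
  -- In order: fluctuation, truncation, and the Taylor terms of order zero, one and two, the latter
  -- three integrated over an interval of length `π / 2`.
  set G : ℕ → ℝ := fun n => 8 * C' / z.im * √(m * K) * (√(n : ℝ))⁻¹ + 2 * C' / z.im * T n
    + (A₀ * (√κ)⁻¹ * (T n * τ n) + 4 * A₁ * (√κ)⁻¹ ^ 2 * (T n * τ n ^ 2)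
      + 16 * A₂ * (√κ)⁻¹ ^ 3 * N * τ n) * (Real.pi / 2) with hG
  have hG0 : Tendsto G atTop (𝓝 0) := by
    have t1 := hr.const_mul (8 * C' / z.im * √(m * K))
    have t2 := hT.const_mul (2 * C' / z.im)
    have t3 := (hT.mul hτ).const_mul (A₀ * (√κ)⁻¹)
    have t4 := (hT.mul (hτ.pow 2)).const_mul (4 * A₁ * (√κ)⁻¹ ^ 2)
    have t5 := hτ.const_mul (16 * A₂ * (√κ)⁻¹ ^ 3 * N)
    rw [hG]
    simpa using (t1.add t2).add (((t3.add t4).add t5).mul_const (Real.pi / 2))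
  have hmain : ∀ᶠ n : ℕ in atTop, ∫ ω, ‖stieltjes (F n) (B n) z (matTuple (Y n) ω)
      - stieltjes (F n) (B n) z (matTuple (X n) ω)‖ ∂(μ n) ≤ G n := by
    filter_upwards [hdim, hsum, hN, eventually_ge_atTop 1] with n hn hs hNn hn1
    have n1 : (1 : ℝ) ≤ n := by exact_mod_cast hn1
    have n0 : (0 : ℝ) < n := one_pos.trans_le n1
    have r0 : 0 < √(n : ℝ) := Real.sqrt_pos.2 n0
    have r2 : √(n : ℝ) ^ 2 = n := Real.sq_sqrt n0.le
    have τ0 : 0 < τ n := (Real.rpow_pos_of_pos n0 _).trans_le (hτlow n hn1)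
    -- The lower bound on `τ_n` puts the truncation level above `n^{-1/3 + 1/2} = n^{1/6}`.
    have hc : 1 ≤ τ n * √n := by
      calc (1 : ℝ) ≤ (n : ℝ) ^ (1 / 6 : ℝ) := Real.one_le_rpow n1 (by norm_num)
        _ = (n : ℝ) ^ (-(1 / 3) : ℝ) * √n := by
            rw [Real.sqrt_eq_rpow, ← Real.rpow_add n0]
            norm_num
        _ ≤ _ := by
            gcongr
            exact hτlow n hn1
    have s0 : 0 < √κ := Real.sqrt_pos.2 hκ
    have hκn : √(κ * n) = √κ * √n := Real.sqrt_mul hκ.le _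
    have h1 := (hXY n).integral_norm_stieltjes_sub_le (hF n) (B n) hz hC0 (hrank' n) hc hA₀.le
      hA₁.le hA₂.le (hg n)
    have h2 := sum_entryBound_le (X := X n) (Y := Y n) (μ := μ n) (mul_pos hκ n0)
      (fun q => (hn q).1) (zero_le_one.trans hc) hA₀.le hA₁.le hA₂.le hNn
    have hST : tailSum (μ n) (X n) (τ n * √n) + tailSum (μ n) (Y n) (τ n * √n)
        = T n * ((n : ℝ) ^ 2 * τ n ^ 2) := by
      simp only [T]
      field_simp
    rw [hST, hκn] at h2
    rw [hST, hd n] at h1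
    refine h1.trans ?_
    have h3 : √(∑ q : Fin m, (d n q.castSucc : ℝ)) ≤ √(m * K) * √n := by
      rw [← Real.sqrt_mul (by positivity)]
      exact Real.sqrt_le_sqrt hs
    simp only [hG]
    refine add_le_add (add_le_add ?_ (le_of_eq ?_)) ?_
    · calc 8 * C' / (n * z.im) * √(∑ q : Fin m, (d n q.castSucc : ℝ))
          ≤ 8 * C' / (n * z.im) * (√(m * K) * √n) := by gcongr
        _ = 8 * C' / z.im * √(m * K) * (√(n : ℝ) / n) := by ring
        _ = _ := by rw [Real.sqrt_div_self', one_div]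
    · rw [mul_pow, r2]
      field_simp
    · gcongr
      refine (mul_le_mul_of_nonneg_left h2 (by positivity)).trans_eq ?_
      generalize √(n : ℝ) = r at r0 r2 ⊢
      rw [← r2]
      field_simp
  -- Markov's inequality: the probability is at most `G n / ε` eventually.
  have hreal : Tendsto (fun n => (μ n).real {ω | ε ≤ ‖stieltjes (F n) (B n) z (matTuple (Y n) ω)
      - stieltjes (F n) (B n) z (matTuple (X n) ω)‖}) atTop (𝓝 0) := by
    refine squeeze_zero' (Eventually.of_forall fun n => measureReal_nonneg) ?_
      (by simpa using hG0.const_mul ε⁻¹)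
    filter_upwards [hmain] with n hn
    have hi := ((integrable_stieltjes_comp (μ := μ n) (hF n) (B n) hz
      (stronglyMeasurable_matTuple (hXY n).measurable_Y).aestronglyMeasurable).sub
      (integrable_stieltjes_comp (μ := μ n) (hF n) (B n) hz
      (stronglyMeasurable_matTuple (hXY n).measurable_X).aestronglyMeasurable)).norm
    have := mul_meas_ge_le_integral_of_nonneg (ae_of_all _ fun ω => norm_nonneg _) hi ε
    rw [le_inv_mul_iff₀ hε]
    exact this.trans hn
  have := (ENNReal.tendsto_ofReal hreal)
  simpa only [ofReal_measureReal (measure_ne_top _ _), ENNReal.ofReal_zero] using this
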